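/- Let $\mathfrak M_{n,m}$ be the space of real $n\times m$ matrices with Lebesgue measure, $\mathcal P_m$ the cone of positive definite symmetric $m\times m$ matrices with $dr=\prod_{i\le j}dr_{ij}$, $|r|=\det r$, and invariant measure $d_*r=|r|^{-(m+1)/2}dr$. Put $\Gamma_m(\alpha)=\int_{\mathcal P_m}e^{-\mathrm{tr}\,r}|r|^{\alpha-(m+1)/2}dr$, $\sigma_{n,m}=2^m\pi^{nm/2}/\Gamma_m(n/2)$, and $|x|_m=\det(x'x)^{1/2}$ for $x\in\mathfrak M_{n,m}$. Let $V_{n,n-k}=\{\xi\in\mathfrak M_{n,n-k}:\xi'\xi=I\}$ with its $O(n)$-invariant probability measure $d_*\xi$. The Radon transform of $f:\mathfrak M_{n,m}\to\mathbb C$ and the dual transform of $\varphi$ are $$\hat f(\xi,t)=\int_{\mathfrak M_{k,m}}f\Big(g_\xi\begin{bmatrix}\omega\\ t\end{bmatrix}\Big)d\omega,\qquad \check\varphi(x)=\int_{V_{n,n-k}}\varphi(\xi,\xi'x)\,d_*\xi,$$ where $\xi\in V_{n,n-k}$, $t\in\mathfrak M_{n-k,m}$, and $g_\xi\in SO(n)$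 is any rotation with $g_\xi\begin{bmatrix}0\\ I_{n-k}\end{bmatrix}=\xi$. Let $(\mathcal Fw)(y)=\int_{\mathfrak M_{n,m}}e^{i\,\mathrm{tr}(y'x)}w(x)\,dx$, and for $a\in\mathcal P_m$ let $(\mathcal W_a\varphi)(x)=\int_{\mathfrak M_{n,m}}\varphi(x-ya^{1/2})w(y)\,dy$. **Theorem.** Let $m\ge1$, $1\le k\le n-m$, and $f\in L^2\cap L^p(\mathfrak M_{n,m})$ for some real $p$ with $1\le p<\dfrac n{k+m-1}$. Let $w$ be a Schwartz function on $\mathfrak M_{n,m}$ which is radial ($w(y)=w_0(y'y)$) and such that (a) $(\mathcal Fw)(y)=u_0(y'y)$ for all $y$ of rank $m$, where $u_0$ is a function on $\mathcal P_m$ that is symmetric, i.e. $u_0(s^{1/2}rs^{1/2})=u_0(r^{1/2}sr^{1/2})$ for all $r,s\in\mathcal P_m$, and vanishes identically in a neighborhood of the boundary $\partial\mathcal P_m$; (b) the integral $$d_w(k)=\frac{2^m}{\sigma_{n,m}}\int_{\mathfrak M_{n,m}}\frac{(\mathcal Fw)(z)}{|z|_m^{n+k}}\,dz=\lim_{B\to\infty}\frac{2^m}{\sigma_{n,m}}\int_{\{z'z<B\}}\frac{(\mathcal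 Fw)(z)}{|z|_m^{n+k}}\,dz\qquad(B\in\mathcal P_m)$$ is finite, in the sense that the limit on the right exists. Then the integral $d_w(k)$ converges absolutely; the integrals defining $\hat f$, $(\hat f)^\vee$, $\mathcal W_a(\hat f)^\vee$ (for every $a\in\mathcal P_m$) and, for $0<\varepsilon<\rho<\infty$, $$\int_{\varepsilon I_m}^{\rho I_m}\frac{\mathcal W_a(\hat f)^\vee}{|a|^{k/2}}\,d_*a\qquad\text{(the integral over }\varepsilon I_m<a<\rho I_m)$$ converge absolutely almost everywhere; the last one belongs to $L^2(\mathfrak M_{n,m})$; and the Radon transform is inverted by $$d_w(k)\,f=c_{n,k,m}^{-1}\lim_{\varepsilon\to0,\ \rho\to\infty}^{(L^2)}\int_{\varepsilon I_m}^{\rho I_m}\frac{\mathcal W_a(\hat f)^\vee}{|a|^{k/2}}\,d_*a,\qquad c_{n,k,m}=\frac{2^{km}\pi^{km/2}\,\Gamma_m(n/2)}{\Gamma_m((n-k)/2)} .$$ -/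

import Mathlib

open MeasureTheory Filter Topology
open scoped Matrix MatrixOrder SchwartzMap

namespace MatrixRadon

noncomputable section

/-- The Borel structure of the space of real `n × m` matrices, identified with `ℝ^(nm)`. -/
instance instMeasurableSpaceMat (n m : ℕ) : MeasurableSpace (Matrix (Fin n) (Fin m) ℝ) :=
  inferInstanceAs (MeasurableSpace (Fin n → Fin m → ℝ))

instance instBorelSpaceMat (n m : ℕ) : BorelSpace (Matrix (Fin n) (Fin m) ℝ) :=
  inferInstanceAs (BorelSpace (Fin n → Fin m → ℝ))

/-- Lebesgue measure `dx = ∏ dx_{ij}` on the space of real `n × m` matrices. -/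
instance instMeasureSpaceMat (n m : ℕ) : MeasureSpace (Matrix (Fin n) (Fin m) ℝ) where
  volume := (volume : Measure (Fin n → Fin m → ℝ))

/-! ### The cone of positive definite matrices -/

/-- The symmetric `m × m` matrix whose entries on and above the diagonal are given by `c`. -/
def symOf (m : ℕ) (c : {q : Fin m × Fin m // q.1 ≤ q.2} → ℝ) : Matrix (Fin m) (Fin m) ℝ :=
  Matrix.of fun i j =>
    if h : i ≤ j then c ⟨(i, j), h⟩ else c ⟨(j, i), le_of_lt (not_le.mp h)⟩

/-- The measure `dr = ∏_{i ≤ j} dr_{ij}` on the cone of positive definite matrices. -/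
def coneVolume (m : ℕ) : Measure (Matrix (Fin m) (Fin m) ℝ) :=
  ((volume : Measure ({q : Fin m × Fin m // q.1 ≤ q.2} → ℝ)).map (symOf m)).restrict
    {r | r.PosDef}

/-- The invariant measure `d_* r = |r|^{-(m+1)/2} dr` on the cone. -/
def coneInvMeasure (m : ℕ) : Measure (Matrix (Fin m) (Fin m) ℝ) :=
  (coneVolume m).withDensity fun r => ENNReal.ofReal (r.det ^ (-((m : ℝ) + 1) / 2))

/-- The Siegel gamma function of the cone (for real arguments),
`Γ_m(α) = ∫ exp(-tr r) |r|^{α - (m+1)/2} dr`. -/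
def siegelGamma (m : ℕ) (α : ℝ) : ℝ :=
  ∫ r, Real.exp (-r.trace) * r.det ^ (α - ((m : ℝ) + 1) / 2) ∂(coneVolume m)

/-- `σ_{n,m} = 2^m π^{nm/2} / Γ_m(n/2)`, the volume of the Stiefel manifold. -/
def sigma (n m : ℕ) : ℝ :=
  2 ^ m * Real.pi ^ ((n : ℝ) * m / 2) / siegelGamma m ((n : ℝ) / 2)

/-- `|x|_m = det(x'x)^{1/2}`. -/
def absDet {n m : ℕ} (x : Matrix (Fin n) (Fin m) ℝ) : ℝ := √(xᵀ * x).det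

/-- The Loewner interval `(a, b) = {s : a < s < b}`. -/
def loewnerIoo {m : ℕ} (a b : Matrix (Fin m) (Fin m) ℝ) : Set (Matrix (Fin m) (Fin m) ℝ) :=
  {s | (s - a).PosDef ∧ (b - s).PosDef}

/-! ### The Stiefel manifold, the Radon transform and its dual -/

/-- The block matrix with `ω` (`k` rows) above `t` (`n - k` rows), for `k ≤ n`. -/
def stack {n k m : ℕ} (ω : Matrix (Fin k) (Fin m) ℝ) (t : Matrix (Fin (n - k)) (Fin m) ℝ) :
    Matrix (Fin n) (Fin m) ℝ :=
  Matrix.of fun i j =>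
    if h : (i : ℕ) < k then ω ⟨i, h⟩ j else t ⟨i - k, by omega⟩ j

/-- The frame `ξ₀ = [0; I_{n-k}]`. -/
def xi0 (n k : ℕ) : Matrix (Fin n) (Fin (n - k)) ℝ :=
  stack (0 : Matrix (Fin k) (Fin (n - k)) ℝ) 1

/-- The Stiefel manifold `V_{n,l}` of orthonormal `l`-frames in `ℝ^n`. -/
def Stiefel (n l : ℕ) : Type := {v : Matrix (Fin n) (Fin l) ℝ // vᵀ * v = 1}

instance instMeasurableSpaceStiefel (n l : ℕ) : MeasurableSpace (Stiefel n l) :=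
  inferInstanceAs (MeasurableSpace {v : Matrix (Fin n) (Fin l) ℝ // vᵀ * v = 1})

theorem xi0_apply (n k : ℕ) (i : Fin n) (b : Fin (n - k)) :
    xi0 n k i b = if (i : ℕ) = k + b then 1 else 0 := by
  simp only [xi0, stack, Matrix.of_apply]
  by_cases h : (i : ℕ) < k
  · have h' : ¬ ((i : ℕ) = k + b) := by omega
    simp [h, h']
  · have hiff : (⟨(i : ℕ) - k, by omega⟩ : Fin (n - k)) = b ↔ (i : ℕ) = k + b := by
      rw [Fin.ext_iff]
      simp only
      omega
    simp only [h, dite_false, Matrix.one_apply, hiff]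

theorem mul_xi0_apply {l n k : ℕ} (g : Matrix (Fin l) (Fin n) ℝ) (i : Fin l) (a : Fin (n - k))
    (ha : k + (a : ℕ) < n) : (g * xi0 n k) i a = g i ⟨k + a, ha⟩ := by
  rw [Matrix.mul_apply, Finset.sum_eq_single (⟨k + a, ha⟩ : Fin n)]
  · rw [xi0_apply]
    simp
  · intro j _ hj
    have h : ¬ ((j : ℕ) = k + a) := fun h => hj (Fin.ext h)
    rw [xi0_apply, if_neg h, mul_zero]
  · simp

theorem xi0_mem (n k : ℕ) : (xi0 n k)ᵀ * xi0 n k = 1 := by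
  ext a b
  have hb : k + (b : ℕ) < n := by omega
  rw [mul_xi0_apply _ a b hb, Matrix.transpose_apply, xi0_apply, Matrix.one_apply]
  have h : (k + (b : ℕ) = k + a) ↔ a = b := by
    rw [Fin.ext_iff]
    omega
  simp only [h]

theorem orthogonal_mul_xi0_mem (n k : ℕ) (γ : Matrix.orthogonalGroup (Fin n) ℝ) :
    ((γ : Matrix (Fin n) (Fin n) ℝ) * xi0 n k)ᵀ * ((γ : Matrix (Fin n) (Fin n) ℝ) * xi0 n k)
      = 1 := by
  have h : (γ : Matrix (Fin n) (Fin n) ℝ)ᵀ * (γ : Matrix (Fin n) (Fin n) ℝ) = 1 :=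
    (Matrix.mem_orthogonalGroup_iff' (Fin n) ℝ).mp γ.2
  rw [Matrix.transpose_mul, Matrix.mul_assoc, ← Matrix.mul_assoc _ _ (xi0 n k), h,
    Matrix.one_mul, xi0_mem]

instance instCompactSpaceOrthogonal (n : ℕ) : CompactSpace (Matrix.orthogonalGroup (Fin n) ℝ) := by
  have hc : IsCompact {M : Matrix (Fin n) (Fin n) ℝ | ∀ i j, M i j ∈ Set.Icc (-1 : ℝ) 1} := by
    have h := isCompact_univ_pi fun _ : Fin n => isCompact_univ_pi fun _ : Fin n =>
      (isCompact_Icc : IsCompact (Set.Icc (-1 : ℝ) 1))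
    have he : {M : Matrix (Fin n) (Fin n) ℝ | ∀ i j, M i j ∈ Set.Icc (-1 : ℝ) 1} =
        Set.pi Set.univ fun _ : Fin n => Set.pi Set.univ fun _ : Fin n =>
          Set.Icc (-1 : ℝ) 1 := by
      refine Set.ext fun M => ?_
      exact ⟨fun h i _ j _ => h i j, fun h i j => h i trivial j trivial⟩
    rw [he]
    exact h
  refine isCompact_iff_compactSpace.mp (hc.of_isClosed_subset isClosed_unitary ?_)
  intro M hM i j
  have h := entry_norm_bound_of_unitary hM i j
  exact abs_le.mp h

/-- The Haar probability measure on `O(n)`. -/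
def haarO (n : ℕ) : Measure (Matrix.orthogonalGroup (Fin n) ℝ) :=
  Measure.haarMeasure ⊤

/-- The invariant probability measure `d_* ξ` on `V_{n,n-k}`: the image of the Haar probability
measure on `O(n)` under `γ ↦ γ ξ₀`. -/
def stiefelMeasure (n k : ℕ) : Measure (Stiefel n (n - k)) :=
  (haarO n).map fun γ : Matrix.orthogonalGroup (Fin n) ℝ =>
    ⟨(γ : Matrix (Fin n) (Fin n) ℝ) * xi0 n k, orthogonal_mul_xi0_mem n k γ⟩

/-- Every frame `ξ` is `g ξ₀` for a rotation `g`. -/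
theorem exists_rotation (n k : ℕ) (hk : 1 ≤ k) (hkn : k ≤ n) (ξ : Stiefel n (n - k)) :
    ∃ g : Matrix (Fin n) (Fin n) ℝ,
      g ∈ Matrix.specialOrthogonalGroup (Fin n) ℝ ∧ g * xi0 n k = ξ.1 := by
  let v : Fin n → EuclideanSpace ℝ (Fin n) := fun j =>
    WithLp.toLp 2 fun i => if h : (j : ℕ) < k then 0 else ξ.1 i ⟨j - k, by omega⟩
  let s : Set (Fin n) := {j | k ≤ (j : ℕ)}
  have hv : Orthonormal ℝ (s.domRestrict v) := by
    rw [orthonormal_iff_ite]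
    rintro ⟨a, ha⟩ ⟨b, hb⟩
    have ha' : ¬ ((a : ℕ) < k) := not_lt.mpr ha
    have hb' : ¬ ((b : ℕ) < k) := not_lt.mpr hb
    have h := congrFun (congrFun ξ.2 ⟨(a : ℕ) - k, by omega⟩) ⟨(b : ℕ) - k, by omega⟩
    rw [Matrix.mul_apply, Matrix.one_apply] at h
    have hab : ((⟨(a : ℕ) - k, by omega⟩ : Fin (n - k)) = ⟨(b : ℕ) - k, by omega⟩) ↔
        ((⟨a, ha⟩ : s) = ⟨b, hb⟩) := by
      rw [Subtype.mk.injEq, Fin.ext_iff, Fin.ext_iff]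
      change (a : ℕ) - k = (b : ℕ) - k ↔ _
      omega
    rw [PiLp.inner_apply]
    by_cases hc : (⟨a, ha⟩ : s) = ⟨b, hb⟩
    · rw [if_pos hc]
      rw [if_pos (hab.mpr hc)] at h
      rw [← h]
      refine Finset.sum_congr rfl fun i _ => ?_
      simp only [v, Set.domRestrict_apply, dif_neg ha', dif_neg hb', Matrix.transpose_apply]
      exact mul_comm _ _
    · rw [if_neg hc]
      rw [if_neg fun e => hc (hab.mp e)] at h
      rw [← h]
      refine Finset.sum_congr rfl fun i _ => ?_
      simp only [v, Set.domRestrict_apply, dif_neg ha', dif_neg hb', Matrix.transpose_apply]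
      exact mul_comm _ _
  obtain ⟨b, hb⟩ := hv.exists_orthonormalBasis_extension_of_card_eq (by simp)
  let M : Matrix (Fin n) (Fin n) ℝ := Matrix.of fun i j => b j i
  have hM : M ∈ Matrix.orthogonalGroup (Fin n) ℝ := by
    rw [Matrix.mem_orthogonalGroup_iff']
    ext i j
    have h := orthonormal_iff_ite.mp b.orthonormal i j
    rw [Matrix.mul_apply, Matrix.one_apply, ← h, PiLp.inner_apply]
    refine Finset.sum_congr rfl fun l _ => ?_
    simp [M, mul_comm]
  have hMξ : M * xi0 n k = ξ.1 := by
    ext i a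
    have ha : k + (a : ℕ) < n := by omega
    rw [mul_xi0_apply M i a ha]
    have h1 : ¬ (k + (a : ℕ) < k) := by omega
    have h2 : ∀ h, (⟨k + (a : ℕ) - k, h⟩ : Fin (n - k)) = a := fun h => by
      ext
      simp
    simp only [M, Matrix.of_apply]
    rw [hb ⟨k + a, ha⟩ (Nat.le_add_right k a)]
    simp only [v, h1, dite_false, h2]
  have hdet : M.det = 1 ∨ M.det = -1 := by
    have h := congrArg Matrix.det ((Matrix.mem_orthogonalGroup_iff' (Fin n) ℝ).mp hM)
    rw [Matrix.det_mul, Matrix.det_transpose, Matrix.det_one] at h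
    exact mul_self_eq_one_iff.mp h
  rcases hdet with hd | hd
  · exact ⟨M, Matrix.mem_specialOrthogonalGroup_iff.mpr ⟨hM, hd⟩, hMξ⟩
  · let z : Fin n := ⟨0, by omega⟩
    let D : Matrix (Fin n) (Fin n) ℝ := Matrix.diagonal fun i => if i = z then -1 else 1
    have hD : D ∈ Matrix.orthogonalGroup (Fin n) ℝ := by
      rw [Matrix.mem_orthogonalGroup_iff']
      simp only [D, Matrix.diagonal_transpose, Matrix.diagonal_mul_diagonal]
      rw [← Matrix.diagonal_one]
      congr 1
      funext i
      by_cases h : i = z <;> simp [h]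
    have hDd : D.det = -1 := by
      simp only [D, Matrix.det_diagonal]
      rw [Finset.prod_ite_eq' Finset.univ z fun _ => (-1 : ℝ)]
      simp
    refine ⟨M * D, Matrix.mem_specialOrthogonalGroup_iff.mpr ⟨mul_mem hM hD, ?_⟩, ?_⟩
    · rw [Matrix.det_mul, hd, hDd]
      norm_num
    · rw [← hMξ]
      ext i a
      have ha : k + (a : ℕ) < n := by omega
      rw [mul_xi0_apply (M * D) i a ha, mul_xi0_apply M i a ha]
      have hne : (⟨k + a, ha⟩ : Fin n) ≠ z := by
        intro h
        have := congrArg Fin.val h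
        simp only [z] at this
        omega
      simp [D, Matrix.mul_diagonal, hne]

/-- A rotation `g_ξ ∈ SO(n)` with `g_ξ ξ₀ = ξ`; it exists for `1 ≤ k ≤ n` by `exists_rotation`. -/
def rotationTo {n k : ℕ} (ξ : Stiefel n (n - k)) : Matrix (Fin n) (Fin n) ℝ :=
  Classical.epsilon fun g =>
    g ∈ Matrix.specialOrthogonalGroup (Fin n) ℝ ∧ g * xi0 n k = ξ.1

theorem rotationTo_spec {n k : ℕ} (hk : 1 ≤ k) (hkn : k ≤ n) (ξ : Stiefel n (n - k)) :
    rotationTo ξ ∈ Matrix.specialOrthogonalGroup (Fin n) ℝ ∧ rotationTo ξ * xi0 n k = ξ.1 :=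
  Classical.epsilon_spec (exists_rotation n k hk hkn ξ)

/-- The matrix `k`-plane Radon transform: the integral of `f` over the plane `{x : ξ'x = t}`,
`f̂(ξ, t) = ∫ f(g_ξ [ω; t]) dω` over `k × m` matrices `ω`. -/
def radon {n m k : ℕ} (f : Matrix (Fin n) (Fin m) ℝ → ℂ) (ξ : Stiefel n (n - k))
    (t : Matrix (Fin (n - k)) (Fin m) ℝ) : ℂ :=
  ∫ ω : Matrix (Fin k) (Fin m) ℝ, f (rotationTo ξ * stack ω t)

/-- The dual Radon transform `φ^∨(x) = ∫ φ(ξ, ξ'x) d_* ξ`. -/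
def dualRadon {n m k : ℕ} (φ : Stiefel n (n - k) → Matrix (Fin (n - k)) (Fin m) ℝ → ℂ)
    (x : Matrix (Fin n) (Fin m) ℝ) : ℂ :=
  ∫ ξ, φ ξ (ξ.1ᵀ * x) ∂(stiefelMeasure n k)

/-! ### The wavelet transform -/

/-- The Fourier transform `(Fw)(y) = ∫ exp(i tr(y'x)) w(x) dx`. -/
def fourier {n m : ℕ} (w : Matrix (Fin n) (Fin m) ℝ → ℂ) (y : Matrix (Fin n) (Fin m) ℝ) : ℂ :=
  ∫ x, Complex.exp (Complex.I * ((yᵀ * x).trace : ℂ)) * w x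

/-- The Schwartz class on matrices, through the identification with `ℝ^(nm)`. -/
def IsSchwartz {n m : ℕ} (w : Matrix (Fin n) (Fin m) ℝ → ℂ) : Prop :=
  ∃ g : 𝓢(EuclideanSpace ℝ (Fin n × Fin m), ℂ),
    ∀ x, w x = g (WithLp.toLp 2 fun ij => x ij.1 ij.2)

/-- The wavelet transform `(W_a φ)(x) = ∫ φ(x - y a^{1/2}) w(y) dy`. -/
def wavelet {n m : ℕ} (w : Matrix (Fin n) (Fin m) ℝ → ℂ) (a : Matrix (Fin m) (Fin m) ℝ)
    (φ : Matrix (Fin n) (Fin m) ℝ → ℂ) (x : Matrix (Fin n) (Fin m) ℝ) : ℂ :=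
  ∫ y, φ (x - y * CFC.sqrt a) * w y

/-- The truncated integral `∫_{εI}^{ρI} (W_a φ)(x) |a|^{-k/2} d_* a`. -/
def truncated {n m : ℕ} (k : ℕ) (w φ : Matrix (Fin n) (Fin m) ℝ → ℂ) (ε ρ : ℝ)
    (x : Matrix (Fin n) (Fin m) ℝ) : ℂ :=
  ∫ a in loewnerIoo (ε • (1 : Matrix (Fin m) (Fin m) ℝ)) (ρ • 1),
    wavelet w a φ x * ((a.det ^ (-(k : ℝ) / 2) : ℝ) : ℂ) ∂(coneInvMeasure m)

/-- A function on the cone is symmetric if `u(s^{1/2} r s^{1/2}) = u(r^{1/2} s r^{1/2})`. -/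
def IsSymmetricOnCone {m : ℕ} (u : Matrix (Fin m) (Fin m) ℝ → ℂ) : Prop :=
  ∀ r s : Matrix (Fin m) (Fin m) ℝ, r.PosDef → s.PosDef →
    u (CFC.sqrt s * r * CFC.sqrt s) = u (CFC.sqrt r * s * CFC.sqrt r)

/-- The integrand `(Fw)(z) / |z|_m^{n+k}` of `d_w(k)`. -/
def dwIntegrand {n m : ℕ} (k : ℕ) (w : Matrix (Fin n) (Fin m) ℝ → ℂ)
    (z : Matrix (Fin n) (Fin m) ℝ) : ℂ :=
  fourier w z / ((absDet z ^ (n + k) : ℝ) : ℂ)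

/-- `d_w(k) = (2^m / σ_{n,m}) ∫ (Fw)(z) |z|_m^{-(n+k)} dz`. -/
def dw {n m : ℕ} (k : ℕ) (w : Matrix (Fin n) (Fin m) ℝ → ℂ) : ℂ :=
  ((2 ^ m / sigma n m : ℝ) : ℂ) * ∫ z, dwIntegrand k w z

/-- `c_{n,k,m} = 2^{km} π^{km/2} Γ_m(n/2) / Γ_m((n-k)/2)`. -/
def cConst (n k m : ℕ) : ℝ :=
  2 ^ (k * m) * Real.pi ^ ((k : ℝ) * m / 2) * siegelGamma m ((n : ℝ) / 2) /
    siegelGamma m (((n : ℝ) - k) / 2)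

/-- The conditions on the wavelet: `w` is a radial Schwartz function such that
(a) `(Fw)(y) = u₀(y'y)` (for `y` of rank `m`) with `u₀` a symmetric function on the cone that
vanishes in a neighbourhood of the boundary of the cone (the singular positive semidefinite
matrices); (b) the integral `d_w(k)`, as the limit of the integrals over `{z'z < B}` when
`B → ∞` in the cone, is finite. -/
structure IsRieszWavelet {n m : ℕ} (k : ℕ) (w : Matrix (Fin n) (Fin m) ℝ → ℂ) : Prop where
  schwartz : IsSchwartz w
  radial : ∃ w₀ : Matrix (Fin m) (Fin m) ℝ → ℂ, ∀ y, w y = w₀ (yᵀ * y)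
  fourier_radial : ∃ u₀ : Matrix (Fin m) (Fin m) ℝ → ℂ,
    IsSymmetricOnCone u₀ ∧
    (∃ U : Set (Matrix (Fin m) (Fin m) ℝ), IsOpen U ∧
      {r | r.PosSemidef ∧ ¬ r.PosDef} ⊆ U ∧ ∀ r ∈ U, r.PosDef → u₀ r = 0) ∧
    ∀ y : Matrix (Fin n) (Fin m) ℝ, y.rank = m → fourier w y = u₀ (yᵀ * y)
  finite_integral : ∃ L : ℂ, ∀ δ > 0, ∃ C : Matrix (Fin m) (Fin m) ℝ, C.PosDef ∧
    ∀ B : Matrix (Fin m) (Fin m) ℝ, (B - C).PosDef →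
      ‖((2 ^ m / sigma n m : ℝ) : ℂ) * (∫ z in {z | (B - zᵀ * z).PosDef}, dwIntegrand k w z)
        - L‖ < δ

end

end MatrixRadon

open MatrixRadon

/-! Averaging the Radon transform over the frames is convolution with one positive measure:
`(f̂)^∨(x) = ∫ f(x + z) dμ(z)`, where `μ` (`meanPlaneMeasure`) is the average over `O(n)` of the
Lebesgue measures of the planes `γ[ω; 0]`. The projection-slice theorem expresses `μ` on the Fourier
side through integrals over the rotated complementary subspaces `γ[0; t]`, and the polar
decomposition of Lebesgue measure (`lintegral_gram`) turns the average of these integrals into the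
weight `|ξ|_m^{-k}`, up to an explicit constant (`lintegral_haarO_lintegral_stack`,
`integral_meanPlane_eq`). Thus `(f̂)^∨` is a Riesz potential of `f` of order `k`.

Convolution with `w` dilated by `a^{1/2}` contributes the factor `u₀(a^{1/2} r a^{1/2})`, where `r`
is the Gram matrix of the frequency. The symmetry of `u₀` replaces it by `u₀(r^{1/2} a r^{1/2})`.
Since `d_*a` is invariant under `a ↦ r^{1/2} a r^{1/2}`, integration against `|a|^{-k/2} d_*a`
produces `|r|^{k/2}`, which cancels the Riesz multiplier, times the integral of `u₀(s)|s|^{-k/2}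
d_*s` over `εr < s < ρr` (`setIntegral_cone_fourier`, `integral_adjoint_eq`). So the truncated
integral is the Fourier multiplier `c_{n,k,m} · truncSymbol`. The symbols are bounded by an `L¹`
norm and tend to `d_w(k)` at every frequency of full rank, because the order intervals exhaust the
cone. Plancherel and dominated convergence then give the `L²` limit.

The integral `d_w(k)` converges absolutely because `Fw` is a Schwartz function vanishing near every
singular matrix: the distance to the singular matrices is controlled by the determinant, so Taylor's
formula bounds `Fw` by any power of `|z|_m` (`schwartz_flat_bound`).

Convergence almost everywhere rests on an explicit dual Radon transform, that of `|1 + t't|^{-n/2}`,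
which is `|1 + x'x|^{-(n-k)/2}` (`lintegral_haarO_det_one_add`). The bound on `p` places this
function in the conjugate Lebesgue space, or `p = 1` and boundedness suffices. Hölder's inequality
then makes `|f| * μ` integrable against a polynomial weight (`lintegral_wt_conv_lt_top`). The rapid
decay of `w` transfers this to the integral over `(a, y, z)` and justifies every use of Fubini's
theorem. The multiplier identity is proved in weak form, with all operators moved onto a Schwartz
test function, which also shows that the truncated integral is in `L²`. -/

namespace MatrixRadon

noncomputable section

/-! ### Lebesgue measure on spaces of matrices -/

/-- The space of real `n × m` matrices. -/
abbrev Mat (n m : ℕ) : Type := Matrix (Fin n) (Fin m) ℝ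

instance instSecondCountableMat (n m : ℕ) : SecondCountableTopology (Mat n m) :=
  inferInstanceAs (SecondCountableTopology (Fin n → Fin m → ℝ))

instance instSigmaFiniteMat (n m : ℕ) : SigmaFinite (volume : Measure (Mat n m)) :=
  inferInstanceAs (SigmaFinite (volume : Measure (Fin n → Fin m → ℝ)))

instance instIsAddHaarMat (n m : ℕ) : (volume : Measure (Mat n m)).IsAddHaarMeasure :=
  Measure.pi.isAddHaarMeasure (fun _ : Fin n => (volume : Measure (Fin m → ℝ)))

open scoped Matrix.Norms.L2Operator in
theorem map_linearMap_volume {n m : ℕ} {L : Mat n m →ₗ[ℝ] Mat n m} (hL : LinearMap.det L ≠ 0) :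
    (volume : Measure (Mat n m)).map L = ENNReal.ofReal |(LinearMap.det L)⁻¹| • volume :=
  Measure.map_linearMap_addHaar_eq_smul_addHaar volume hL

theorem measurable_entry {n m : ℕ} (i : Fin n) (j : Fin m) : Measurable fun x : Mat n m => x i j :=
  (measurable_pi_apply (X := fun _ : Fin m => ℝ) j).comp
    (measurable_pi_apply (X := fun _ : Fin n => Fin m → ℝ) i)

theorem measurable_of_entries {α : Type*} [MeasurableSpace α] {n m : ℕ} {f : α → Mat n m}
    (h : ∀ i j, Measurable fun a => f a i j) : Measurable f :=
  measurable_pi_lambda (X := fun _ : Fin n => Fin m → ℝ) _ fun i => measurable_pi_lambda _ (h i)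

theorem measurable_linearMap {n m n' m' : ℕ} (L : Mat n m →ₗ[ℝ] Mat n' m') : Measurable L :=
  L.continuous_of_finiteDimensional.measurable

theorem lintegral_comp_linearMap {n m : ℕ} {L : Mat n m →ₗ[ℝ] Mat n m}
    (hL : LinearMap.det L ≠ 0) {F : Mat n m → ENNReal} (hF : Measurable F) :
    ∫⁻ y, F (L y) = ENNReal.ofReal |(LinearMap.det L)⁻¹| * ∫⁻ y, F y := by
  rw [← lintegral_map hF (measurable_linearMap L), map_linearMap_volume hL, lintegral_smul_measure,
    smul_eq_mul]

/-- Right multiplication acts independently on the `n` rows, on each one as the transpose of `B`. -/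
theorem det_mulRightLinearMap {m : ℕ} (n : ℕ) (B : Mat m m) :
    LinearMap.det (mulRightLinearMap (Fin n) ℝ B) = B.det ^ n := by
  have h : mulRightLinearMap (Fin n) ℝ B =
      LinearMap.pi fun i : Fin n => (Matrix.toLin' Bᵀ) ∘ₗ
        LinearMap.proj (φ := fun _ : Fin n => Fin m → ℝ) i := by
    refine LinearMap.ext fun x => ?_
    ext i j
    change (x * B) i j = (Bᵀ *ᵥ (x i)) j
    rw [Matrix.mul_apply]
    simp only [Matrix.mulVec, dotProduct, Matrix.transpose_apply]
    exact Finset.sum_congr rfl fun _ _ => mul_comm _ _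
  rw [h]
  refine (LinearMap.det_pi (fun _ : Fin n => Matrix.toLin' Bᵀ)).trans ?_
  simp

theorem det_mulLeftLinearMap {n : ℕ} (m : ℕ) (A : Mat n n) :
    LinearMap.det (mulLeftLinearMap (Fin m) ℝ A) = A.det ^ m := by
  let e := Matrix.transposeLinearEquiv (Fin m) (Fin n) ℝ ℝ
  have h : mulLeftLinearMap (Fin m) ℝ A =
      (e : Mat m n →ₗ[ℝ] Mat n m) ∘ₗ (mulRightLinearMap (Fin m) ℝ Aᵀ) ∘ₗ
        (e.symm : Mat n m →ₗ[ℝ] Mat m n) := by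
    refine LinearMap.ext fun x => ?_
    change A * x = (xᵀ * Aᵀ)ᵀ
    simp
  rw [h, LinearMap.det_conj, det_mulRightLinearMap, Matrix.det_transpose]

theorem lintegral_mul_right {n m : ℕ} {g : Mat m m} (hg : g.det ≠ 0) {F : Mat n m → ENNReal}
    (hF : Measurable F) :
    ∫⁻ y : Mat n m, F (y * g) = ENNReal.ofReal (|g.det| ^ n)⁻¹ * ∫⁻ y, F y := by
  have h := lintegral_comp_linearMap (L := mulRightLinearMap (Fin n) ℝ g)
    (by rw [det_mulRightLinearMap]; exact pow_ne_zero _ hg) hF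
  rw [det_mulRightLinearMap, abs_inv, abs_pow] at h
  exact h

theorem measurePreserving_mul_left {n : ℕ} (m : ℕ) {A : Mat n n} (hA : |A.det| = 1) :
    MeasurePreserving (fun y : Mat n m => A * y) := by
  refine ⟨measurable_linearMap (mulLeftLinearMap (Fin m) ℝ A), ?_⟩
  have h0 : A.det ≠ 0 := fun h => by simp [h] at hA
  have h := map_linearMap_volume (L := mulLeftLinearMap (Fin m) ℝ A)
    (by rw [det_mulLeftLinearMap]; exact pow_ne_zero _ h0)
  rw [det_mulLeftLinearMap, abs_inv, abs_pow, hA, one_pow, inv_one, ENNReal.ofReal_one,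
    one_smul] at h
  exact h

theorem abs_det_orthogonal {n : ℕ} (γ : Matrix.orthogonalGroup (Fin n) ℝ) :
    |(γ : Mat n n).det| = 1 := by
  have h := congrArg Matrix.det ((Matrix.mem_orthogonalGroup_iff' (Fin n) ℝ).mp γ.2)
  rw [Matrix.det_mul, Matrix.det_one] at h
  have h' : (γ : Mat n n)ᵀ.det * (γ : Mat n n).det = 1 := h
  rw [Matrix.det_transpose] at h'
  rcases mul_self_eq_one_iff.mp h' with h | h <;> simp [h]

theorem orthogonal_transpose_mul {n : ℕ} (γ : Matrix.orthogonalGroup (Fin n) ℝ) :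
    (γ : Mat n n)ᵀ * (γ : Mat n n) = 1 :=
  (Matrix.mem_orthogonalGroup_iff' (Fin n) ℝ).mp γ.2

theorem orthogonal_mul_transpose {n : ℕ} (γ : Matrix.orthogonalGroup (Fin n) ℝ) :
    (γ : Mat n n) * (γ : Mat n n)ᵀ = 1 :=
  (Matrix.mem_orthogonalGroup_iff (Fin n) ℝ).mp γ.2

/-! ### Stacking and flattening -/

/-- The index equivalence behind `stack`. -/
def stackIndex {n k : ℕ} (hk : k ≤ n) : Fin k ⊕ Fin (n - k) ≃ Fin n :=
  finSumFinEquiv.trans (finCongr (by omega))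

theorem stack_stackIndex_inl {n k m : ℕ} (hk : k ≤ n) (ω : Mat k m) (t : Mat (n - k) m)
    (i : Fin k) (j : Fin m) : stack ω t (stackIndex hk (Sum.inl i)) j = ω i j := by
  simp [stack, stackIndex]

theorem stack_stackIndex_inr {n k m : ℕ} (hk : k ≤ n) (ω : Mat k m) (t : Mat (n - k) m)
    (i : Fin (n - k)) (j : Fin m) : stack ω t (stackIndex hk (Sum.inr i)) j = t i j := by
  simp [stack, stackIndex]

/-- Stacking as a measurable equivalence. -/
def stackEquiv {n k : ℕ} (hk : k ≤ n) (m : ℕ) : (Mat k m × Mat (n - k) m) ≃ᵐ Mat n m where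
  toFun p := stack p.1 p.2
  invFun x := (Matrix.of fun i j => x (stackIndex hk (Sum.inl i)) j,
    Matrix.of fun i j => x (stackIndex hk (Sum.inr i)) j)
  left_inv p := by
    refine Prod.ext ?_ ?_ <;> ext i j
    · exact stack_stackIndex_inl hk _ _ i j
    · exact stack_stackIndex_inr hk _ _ i j
  right_inv x := by
    ext i j
    obtain ⟨i, rfl⟩ := (stackIndex hk).surjective i
    rcases i with i | i
    · exact stack_stackIndex_inl hk _ _ i j
    · exact stack_stackIndex_inr hk _ _ i j
  measurable_toFun := by
    refine measurable_of_entries fun i j => ?_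
    obtain ⟨i, rfl⟩ := (stackIndex hk).surjective i
    rcases i with i | i
    · simp only [Equiv.coe_fn_mk, stack_stackIndex_inl]
      exact (measurable_entry i j).comp measurable_fst
    · simp only [Equiv.coe_fn_mk, stack_stackIndex_inr]
      exact (measurable_entry i j).comp measurable_snd
  measurable_invFun := by
    refine Measurable.prodMk ?_ ?_ <;>
    · refine measurable_of_entries fun i j => ?_
      exact measurable_entry _ _

theorem stackEquiv_apply {n k m : ℕ} (hk : k ≤ n) (p : Mat k m × Mat (n - k) m) :
    stackEquiv hk m p = stack p.1 p.2 := rfl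

theorem volume_rows {n m : ℕ} (s : Fin n → Set (Fin m → ℝ)) :
    (volume : Measure (Mat n m)) {x | ∀ i, (fun j => x i j) ∈ s i} = ∏ i, volume (s i) := by
  refine Eq.trans ?_ (Measure.pi_pi (fun _ : Fin n => (volume : Measure (Fin m → ℝ))) s)
  congr 1
  ext x
  exact ⟨fun h i _ => h i, fun h i => h i trivial⟩

/-- A measure on matrices that agrees with `volume` on products of sets of rows is `volume`. -/
theorem eq_volume_of_rows {n m : ℕ} {μ : Measure (Mat n m)}
    (h : ∀ s : Fin n → Set (Fin m → ℝ), (∀ i, MeasurableSet (s i)) →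
      μ {x | ∀ i, (fun j => x i j) ∈ s i} = ∏ i, volume (s i)) : μ = volume := by
  symm
  refine Measure.pi_eq (μ := fun _ : Fin n => (volume : Measure (Fin m → ℝ))) fun s hs => ?_
  rw [← h s hs]
  have he : Set.univ.pi s = {x : Mat n m | ∀ i, (fun j => x i j) ∈ s i} := by
    ext x
    exact ⟨fun h i => h i trivial, fun h i _ => h i⟩
  exact congrArg μ he

theorem measurableSet_rows {n m : ℕ} {s : Fin n → Set (Fin m → ℝ)}
    (hs : ∀ i, MeasurableSet (s i)) :
    MeasurableSet {x : Mat n m | ∀ i, (fun j => x i j) ∈ s i} := by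
  rw [Set.ofPred_forall]
  exact MeasurableSet.iInter fun i => (measurable_pi_lambda _ fun j => measurable_entry i j) (hs i)

theorem measurePreserving_stackEquiv {n k : ℕ} (hk : k ≤ n) (m : ℕ) :
    MeasurePreserving (stackEquiv hk m) := by
  refine ⟨(stackEquiv hk m).measurable, eq_volume_of_rows fun s hs => ?_⟩
  rw [MeasurableEquiv.map_apply]
  have h : (stackEquiv hk m) ⁻¹' {x | ∀ i, (fun j => x i j) ∈ s i} =
      {x | ∀ i, (fun j => x i j) ∈ s (stackIndex hk (Sum.inl i))} ×ˢ
        {x | ∀ i, (fun j => x i j) ∈ s (stackIndex hk (Sum.inr i))} := by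
    ext p
    simp only [Set.mem_preimage, Set.mem_ofPred_eq, Set.mem_prod, stackEquiv_apply]
    rw [← (stackIndex hk).forall_congr_right, Sum.forall]
    simp only [stack_stackIndex_inl, stack_stackIndex_inr]
  rw [h, Measure.volume_eq_prod, Measure.prod_prod, volume_rows, volume_rows,
    ← (stackIndex hk).prod_comp, Fintype.prod_sum_type]

/-! ### Flattening to Euclidean space -/

/-- The Euclidean space of flattened `n × m` matrices. -/
abbrev EMat (n m : ℕ) : Type := EuclideanSpace ℝ (Fin n × Fin m)

/-- Flattening a matrix. -/
def flat {n m : ℕ} (x : Mat n m) : EMat n m := WithLp.toLp 2 fun ij => x ij.1 ij.2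

/-- Flattening as a linear equivalence. -/
def flatL (n m : ℕ) : Mat n m ≃ₗ[ℝ] EMat n m where
  toFun := flat
  invFun v := Matrix.of fun i j => v (i, j)
  map_add' _ _ := rfl
  map_smul' _ _ := rfl
  left_inv _ := rfl
  right_inv _ := rfl

theorem flatL_apply {n m : ℕ} (x : Mat n m) : flatL n m x = flat x := rfl

/-- Flattening as a measurable equivalence. -/
def flatEquiv (n m : ℕ) : Mat n m ≃ᵐ EMat n m where
  toEquiv := (flatL n m).toEquiv
  measurable_toFun := (flatL n m).toLinearMap.continuous_of_finiteDimensional.measurable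
  measurable_invFun := (flatL n m).symm.toLinearMap.continuous_of_finiteDimensional.measurable

theorem flatEquiv_apply {n m : ℕ} (x : Mat n m) : flatEquiv n m x = flat x := rfl

theorem measurePreserving_flatEquiv (n m : ℕ) : MeasurePreserving (flatEquiv n m) := by
  have h : MeasurePreserving (fun x : Mat n m => fun ij : Fin n × Fin m => x ij.1 ij.2) := by
    have hm : Measurable (fun x : Mat n m => fun ij : Fin n × Fin m => x ij.1 ij.2) :=
      measurable_pi_lambda _ fun ij => measurable_entry ij.1 ij.2
    refine ⟨hm, ?_⟩
    symm
    refine Measure.pi_eq (μ := fun _ : Fin n × Fin m => (volume : Measure ℝ)) fun s hs => ?_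
    rw [Measure.map_apply hm (MeasurableSet.univ_pi hs)]
    have he : (fun x : Mat n m => fun ij : Fin n × Fin m => x ij.1 ij.2) ⁻¹' (Set.univ.pi s) =
        {x | ∀ i, (fun j => x i j) ∈ Set.univ.pi fun j => s (i, j)} := by
      ext x
      simp [Set.mem_pi]
    rw [he, volume_rows, Fintype.prod_prod_type]
    exact Finset.prod_congr rfl fun i _ => Measure.pi_pi _ _
  exact (PiLp.volume_preserving_toLp (Fin n × Fin m)).comp h

theorem norm_flat_sq {n m : ℕ} (x : Mat n m) : ‖flat x‖ ^ 2 = (xᵀ * x).trace := by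
  rw [EuclideanSpace.norm_sq_eq, Fintype.sum_prod_type, Finset.sum_comm]
  simp only [flat, Matrix.trace, Matrix.diag, Matrix.mul_apply, Matrix.transpose_apply,
    Real.norm_eq_abs, abs_mul_abs_self, sq]

theorem inner_flat {n m : ℕ} (x y : Mat n m) : inner ℝ (flat x) (flat y) = (xᵀ * y).trace := by
  rw [PiLp.inner_apply, Fintype.sum_prod_type, Finset.sum_comm]
  simp only [flat, Matrix.trace, Matrix.diag, Matrix.mul_apply, Matrix.transpose_apply]
  refine Finset.sum_congr rfl fun _ _ => Finset.sum_congr rfl fun _ _ => ?_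
  exact mul_comm _ _

/-! ### The invariant measure of the cone -/

theorem measurable_of_continuous {n m : ℕ} {α : Type*} [TopologicalSpace α] [MeasurableSpace α]
    [BorelSpace α] {f : Mat n m → α} (hf : Continuous f) : Measurable f := hf.measurable

/-- The cone is the intersection of a closed set (symmetric with nonnegative quadratic form) and an
open one (nonzero determinant). -/
theorem measurableSet_posDef (m : ℕ) : MeasurableSet {r : Mat m m | r.PosDef} := by
  have h : {r : Mat m m | r.PosDef} =
      ({r | rᵀ = r} ∩ ⋂ x : Fin m → ℝ, {r : Mat m m | 0 ≤ x ⬝ᵥ (r *ᵥ x)}) ∩ {r | r.det ≠ 0} := by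
    ext r
    simp only [Set.mem_ofPred_eq, Set.mem_inter_iff, Set.mem_iInter]
    constructor
    · intro h
      refine ⟨⟨h.isHermitian, fun x => ?_⟩, h.det_pos.ne'⟩
      exact h.posSemidef.dotProduct_mulVec_nonneg x
    · rintro ⟨⟨h1, h2⟩, h3⟩
      exact (Matrix.PosSemidef.posDef_iff_det_ne_zero
        (Matrix.PosSemidef.of_dotProduct_mulVec_nonneg h1 h2)).mpr h3
  rw [h]
  refine MeasurableSet.inter (IsClosed.measurableSet ?_) (IsOpen.measurableSet ?_)
  · refine IsClosed.inter (isClosed_eq (by fun_prop) continuous_id)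
      (isClosed_iInter fun x => isClosed_le continuous_const (by fun_prop))
  · exact isOpen_ne_fun (by fun_prop) continuous_const

/-- The coordinates of a symmetric matrix. -/
abbrev SymCoord (m : ℕ) : Type := {q : Fin m × Fin m // q.1 ≤ q.2} → ℝ

theorem symOf_apply_of_le {m : ℕ} (c : SymCoord m) {i j : Fin m} (h : i ≤ j) :
    symOf m c i j = c ⟨(i, j), h⟩ := by
  simp [symOf, h]

theorem symOf_transpose {m : ℕ} (c : SymCoord m) : (symOf m c)ᵀ = symOf m c := by
  ext i j
  rcases lt_trichotomy i j with h | h | h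
  · simp [symOf, h.le, not_le.mpr h]
  · simp [h]
  · simp [symOf, h.le, not_le.mpr h]

/-- The upper triangular coordinates of a matrix. -/
def symCoord (m : ℕ) (r : Mat m m) : SymCoord m := fun q => r q.1.1 q.1.2

theorem symCoord_symOf {m : ℕ} (c : SymCoord m) : symCoord m (symOf m c) = c := by
  funext q
  exact symOf_apply_of_le c q.2

theorem symOf_symCoord {m : ℕ} {r : Mat m m} (hr : rᵀ = r) : symOf m (symCoord m r) = r := by
  ext i j
  by_cases h : i ≤ j
  · simp [symOf, h, symCoord]
  · have h' := congrFun (congrFun hr i) j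
    simp only [Matrix.transpose_apply] at h'
    simp [symOf, h, symCoord, h']

theorem symOf_add {m : ℕ} (c d : SymCoord m) : symOf m (c + d) = symOf m c + symOf m d := by
  ext i j
  simp only [symOf, Matrix.of_apply, Matrix.add_apply]
  split_ifs <;> rfl

theorem symOf_smul {m : ℕ} (a : ℝ) (c : SymCoord m) : symOf m (a • c) = a • symOf m c := by
  ext i j
  simp only [symOf, Matrix.of_apply, Matrix.smul_apply]
  split_ifs <;> rfl

theorem measurable_symOf (m : ℕ) : Measurable (symOf m) := by
  refine measurable_of_entries fun i j => ?_
  simp only [symOf, Matrix.of_apply]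
  split_ifs <;> exact measurable_pi_apply _

/-- The action `r ↦ g'rg` in coordinates. -/
def congrL {m : ℕ} (g : Mat m m) : SymCoord m →ₗ[ℝ] SymCoord m where
  toFun c := symCoord m (gᵀ * symOf m c * g)
  map_add' c d := by
    rw [symOf_add, Matrix.mul_add, Matrix.add_mul]
    rfl
  map_smul' a c := by
    rw [symOf_smul, Matrix.mul_smul, Matrix.smul_mul]
    rfl

theorem symOf_congrL {m : ℕ} (g : Mat m m) (c : SymCoord m) :
    symOf m (congrL g c) = gᵀ * symOf m c * g := by
  refine symOf_symCoord (r := gᵀ * symOf m c * g) ?_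
  simp [Matrix.transpose_mul, symOf_transpose, Matrix.mul_assoc]

theorem congrL_mul {m : ℕ} (g h : Mat m m) : congrL (g * h) = congrL h ∘ₗ congrL g := by
  refine LinearMap.ext fun c => ?_
  rw [LinearMap.comp_apply, ← symCoord_symOf (congrL (g * h) c),
    ← symCoord_symOf (congrL h (congrL g c))]
  simp only [symOf_congrL, Matrix.transpose_mul, Matrix.mul_assoc]

theorem congrL_one (m : ℕ) : congrL (1 : Mat m m) = LinearMap.id := by
  refine LinearMap.ext fun c => ?_
  rw [← symCoord_symOf (congrL 1 c)]
  simp [symOf_congrL, symCoord_symOf]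

/-- With indices counted from `0`, the index `i` occurs `m - i` times as first entry and `i + 1`
times as second entry of a pair, so `m + 1` times in all. -/
theorem prod_upper {m : ℕ} (d : Fin m → ℝ) :
    ∏ q : {q : Fin m × Fin m // q.1 ≤ q.2}, (d q.1.1 * d q.1.2) = (∏ i, d i) ^ (m + 1) := by
  have h : ∀ F : Fin m × Fin m → ℝ, ∏ q : {q : Fin m × Fin m // q.1 ≤ q.2}, F q.1 =
      ∏ i, ∏ j, if i ≤ j then F (i, j) else 1 := fun F => by
    rw [← Fintype.prod_prod_type (fun q : Fin m × Fin m => if q.1 ≤ q.2 then F q else 1),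
      Finset.prod_ite, Finset.prod_const_one, mul_one]
    exact (Finset.prod_subtype _ (by simp) F).symm
  rw [Finset.prod_mul_distrib, h fun q => d q.1, h fun q => d q.2]
  have h1 : ∀ i : Fin m, (∏ j, if i ≤ j then d i else 1) = d i ^ (m - (i : ℕ)) := fun i => by
    rw [Finset.prod_ite, Finset.prod_const_one, mul_one, Finset.prod_const]
    congr 1
    rw [← Fin.card_Ici]
    congr 1
    ext j
    simp
  have h2 : ∀ j : Fin m, (∏ i, if i ≤ j then d j else 1) = d j ^ ((j : ℕ) + 1) := fun j => by
    rw [Finset.prod_ite, Finset.prod_const_one, mul_one, Finset.prod_const]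
    congr 1
    rw [← Fin.card_Iic]
    congr 1
    ext i
    simp
  rw [Finset.prod_congr rfl fun i _ => h1 i, Finset.prod_comm,
    Finset.prod_congr rfl fun i _ => h2 i, ← Finset.prod_mul_distrib, ← Finset.prod_pow]
  refine Finset.prod_congr rfl fun i _ => ?_
  rw [← pow_add]
  congr 1
  omega

theorem det_congrL_diagonal {m : ℕ} (d : Fin m → ℝ) :
    LinearMap.det (congrL (Matrix.diagonal d)) = (∏ i, d i) ^ (m + 1) := by
  have h : congrL (Matrix.diagonal d) =
      Matrix.toLin' (Matrix.diagonal fun q : {q : Fin m × Fin m // q.1 ≤ q.2} =>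
        d q.1.1 * d q.1.2) := by
    refine LinearMap.ext fun c => ?_
    funext q
    rw [Matrix.toLin'_apply, Matrix.mulVec_diagonal]
    simp only [congrL, symCoord, LinearMap.coe_mk, AddHom.coe_mk, Matrix.diagonal_transpose,
      Matrix.mul_diagonal, Matrix.diagonal_mul, symOf_apply_of_le c q.2]
    ring
  rw [h, LinearMap.det_toLin', Matrix.det_diagonal, prod_upper]

/-- The determinant is multiplicative in `g`. Conjugation by a diagonal matrix carries the
transvection with parameter `c` to the one with parameter `2c`, which is its square. Hence the
determinant equals its own square, and it is nonzero because transvections are invertible. -/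
theorem det_congrL_transvection {m : ℕ} (t : Matrix.TransvectionStruct (Fin m) ℝ) :
    LinearMap.det (congrL t.toMatrix) = 1 := by
  have hmul : ∀ g h : Mat m m, LinearMap.det (congrL (g * h)) =
      LinearMap.det (congrL g) * LinearMap.det (congrL h) := fun g h => by
    rw [congrL_mul, LinearMap.det_comp, mul_comm]
  obtain ⟨i, j, hij, c⟩ := t
  set τ : ℝ → Mat m m := fun c => Matrix.transvection i j c with hτ
  change LinearMap.det (congrL (τ c)) = 1
  have h2 : τ (c + c) = τ c * τ c := by
    simp only [hτ]
    rw [Matrix.transvection_mul_transvection_same i j hij]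
  let d : Fin m → ℝ := fun l => if l = i then 2 else 1
  have hd : Matrix.diagonal d * τ c = τ (c + c) * Matrix.diagonal d := by
    ext a b
    rw [Matrix.diagonal_mul, Matrix.mul_diagonal]
    simp only [hτ, Matrix.transvection, Matrix.add_apply, Matrix.single_apply, Matrix.one_apply, d]
    split_ifs <;> first | (exfalso; grind) | ring
  have h3 := congrArg (fun g => LinearMap.det (congrL g)) hd
  simp only [hmul, det_congrL_diagonal] at h3
  have hd0 : (∏ l, d l) ^ (m + 1) ≠ 0 := by
    refine pow_ne_zero _ (Finset.prod_ne_zero_iff.mpr fun l _ => ?_)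
    simp only [d]
    split_ifs <;> norm_num
  have h4 : LinearMap.det (congrL (τ c)) = LinearMap.det (congrL (τ (c + c))) := by
    rw [mul_comm] at h3
    exact mul_right_cancel₀ hd0 h3
  rw [h2, hmul] at h4
  have h5 : LinearMap.det (congrL (τ c)) ≠ 0 := by
    intro h0
    have h6 : τ c * τ (-c) = 1 := by
      simp only [hτ]
      rw [Matrix.transvection_mul_transvection_same i j hij, add_neg_cancel,
        Matrix.transvection_zero]
    have h7 := hmul (τ c) (τ (-c))
    rw [h6, congrL_one, LinearMap.det_id, h0, zero_mul] at h7
    exact one_ne_zero h7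
  exact (mul_left_cancel₀ h5 (by rw [← h4, mul_one])).symm

/-- Both sides are multiplicative in `g`, so Gaussian elimination reduces the claim to diagonal
matrices and transvections. -/
theorem abs_det_congrL {m : ℕ} {g : Mat m m} (hg : g.det ≠ 0) :
    |LinearMap.det (congrL g)| = |g.det| ^ (m + 1) := by
  refine Matrix.diagonal_transvection_induction_of_det_ne_zero
    (fun g => |LinearMap.det (congrL g)| = |g.det| ^ (m + 1)) g hg ?_ ?_ ?_
  · intro d _
    rw [det_congrL_diagonal, abs_pow, Matrix.det_diagonal]
  · intro t
    rw [det_congrL_transvection, Matrix.TransvectionStruct.det]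
    simp
  · intro A B _ _ hA hB
    rw [congrL_mul, LinearMap.det_comp, abs_mul, hA, hB, Matrix.det_mul, abs_mul, mul_pow, mul_comm]

theorem posDef_congr_iff {m : ℕ} {g r : Mat m m} (hg : g.det ≠ 0) :
    (gᵀ * r * g).PosDef ↔ r.PosDef := by
  have h : ∀ {g r : Mat m m}, g.det ≠ 0 → r.PosDef → (gᵀ * r * g).PosDef := fun {g r} hg hr => by
    refine Matrix.PosDef.conjTranspose_mul_mul_same hr ?_
    exact Matrix.mulVec_injective_iff_isUnit.mpr
      ((Matrix.isUnit_iff_isUnit_det g).mpr (isUnit_iff_ne_zero.mpr hg))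
  refine ⟨fun h' => ?_, h hg⟩
  have hu : IsUnit g.det := isUnit_iff_ne_zero.mpr hg
  have h2 := h (g := g⁻¹) (by rw [Matrix.det_nonsing_inv]; simpa using hg) h'
  rw [← Matrix.mul_assoc, ← Matrix.mul_assoc, ← Matrix.transpose_mul, Matrix.mul_nonsing_inv g hu,
    Matrix.transpose_one, Matrix.one_mul, Matrix.mul_assoc, Matrix.mul_nonsing_inv g hu,
    Matrix.mul_one] at h2
  exact h2

instance instSFiniteConeVolume (m : ℕ) : SFinite (coneVolume m) := by
  unfold coneVolume
  infer_instance

instance instSFiniteConeInv (m : ℕ) : SFinite (coneInvMeasure m) := by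
  unfold coneInvMeasure
  infer_instance

theorem measurable_det_rpow {m : ℕ} (s : ℝ) : Measurable fun r : Mat m m => r.det ^ s :=
  (measurable_of_continuous (by fun_prop : Continuous fun r : Mat m m => r.det)).pow_const s

theorem ae_coneVolume_posDef (m : ℕ) : ∀ᵐ r ∂(coneVolume m), r.PosDef :=
  ae_restrict_mem (measurableSet_posDef m)

theorem ae_coneInv_posDef (m : ℕ) : ∀ᵐ r ∂(coneInvMeasure m), r.PosDef :=
  (withDensity_absolutelyContinuous _ _).ae_le (ae_coneVolume_posDef m)

theorem lintegral_coneInv {m : ℕ} {F : Mat m m → ENNReal} (hF : Measurable F) :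
    ∫⁻ r, F r ∂(coneInvMeasure m) =
      ∫⁻ r, ENNReal.ofReal (r.det ^ (-((m : ℝ) + 1) / 2)) * F r ∂(coneVolume m) :=
  lintegral_withDensity_eq_lintegral_mul _ (measurable_det_rpow _).ennreal_ofReal hF

theorem lintegral_coneVolume {m : ℕ} {F : Mat m m → ENNReal} (hF : Measurable F) :
    ∫⁻ r, F r ∂(coneVolume m) =
      ∫⁻ c : SymCoord m, {r : Mat m m | r.PosDef}.indicator F (symOf m c) := by
  rw [coneVolume, ← lintegral_indicator (measurableSet_posDef m),
    lintegral_map (hF.indicator (measurableSet_posDef m)) (measurable_symOf m)]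

/-- The Jacobian `|det g|^{m+1}` of `r ↦ g'rg` in the upper triangular coordinates is exactly
compensated by the density `|r|^{-(m+1)/2}`, since `|g'rg| = |det g|²|r|`. -/
theorem lintegral_coneInv_congr {m : ℕ} {g : Mat m m} (hg : g.det ≠ 0) {F : Mat m m → ENNReal}
    (hF : Measurable F) :
    ∫⁻ r, F (gᵀ * r * g) ∂(coneInvMeasure m) = ∫⁻ r, F r ∂(coneInvMeasure m) := by
  have hw := (measurable_det_rpow (m := m) (-((m : ℝ) + 1) / 2)).ennreal_ofReal
  have hc : Measurable fun r : Mat m m => gᵀ * r * g :=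
    measurable_of_continuous (by fun_prop)
  rw [lintegral_coneInv hF, lintegral_coneInv (F := fun r => F (gᵀ * r * g)) (hF.comp hc),
    lintegral_coneVolume (F := fun r => ENNReal.ofReal (r.det ^ (-((m : ℝ) + 1) / 2)) * F r)
      (hw.mul hF),
    lintegral_coneVolume (F := fun r => ENNReal.ofReal (r.det ^ (-((m : ℝ) + 1) / 2)) *
      F (gᵀ * r * g)) (hw.mul (hF.comp hc))]
  set H : SymCoord m → ENNReal := fun c => {r : Mat m m | r.PosDef}.indicator
    (fun r => ENNReal.ofReal (r.det ^ (-((m : ℝ) + 1) / 2)) * F r) (symOf m c) with hH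
  have hHm : Measurable H :=
    ((hw.mul hF).indicator (measurableSet_posDef m)).comp (measurable_symOf m)
  have hdet : LinearMap.det (congrL g) ≠ 0 := by
    rw [← abs_ne_zero, abs_det_congrL hg]
    exact pow_ne_zero _ (abs_ne_zero.mpr hg)
  have hLm : Measurable (congrL g) := (congrL g).continuous_of_finiteDimensional.measurable
  have key : ∫⁻ c, H (congrL g c) = ENNReal.ofReal (|g.det| ^ (m + 1))⁻¹ * ∫⁻ c, H c := by
    rw [← lintegral_map hHm hLm, Measure.map_linearMap_addHaar_eq_smul_addHaar volume hdet,
      lintegral_smul_measure, smul_eq_mul, abs_inv, abs_det_congrL hg]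
  have hpos : 0 < |g.det| ^ (m + 1) := pow_pos (abs_pos.mpr hg) _
  have hpt : ∀ c : SymCoord m, H (congrL g c) = ENNReal.ofReal (|g.det| ^ (m + 1))⁻¹ *
      {r : Mat m m | r.PosDef}.indicator (fun r =>
        ENNReal.ofReal (r.det ^ (-((m : ℝ) + 1) / 2)) * F (gᵀ * r * g)) (symOf m c) := by
    intro c
    simp only [hH, symOf_congrL]
    by_cases hc : (symOf m c).PosDef
    · rw [Set.indicator_of_mem (show symOf m c ∈ {r : Mat m m | r.PosDef} from hc),
        Set.indicator_of_mem (show _ ∈ {r : Mat m m | r.PosDef} from (posDef_congr_iff hg).mpr hc),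
        ← mul_assoc, ← ENNReal.ofReal_mul (inv_nonneg.mpr hpos.le)]
      congr 2
      rw [Matrix.det_mul, Matrix.det_mul, Matrix.det_transpose,
        show g.det * (symOf m c).det * g.det = |g.det| ^ 2 * (symOf m c).det by
          rw [sq_abs]; ring,
        Real.mul_rpow (by positivity) hc.det_pos.le]
      congr 1
      rw [← Real.rpow_natCast, ← Real.rpow_natCast, ← Real.rpow_mul (abs_nonneg _),
        ← Real.rpow_neg (abs_nonneg _)]
      congr 1
      push_cast
      ring
    · rw [Set.indicator_of_notMem (show symOf m c ∉ {r : Mat m m | r.PosDef} from hc),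
        Set.indicator_of_notMem (show _ ∉ {r : Mat m m | r.PosDef} from
          fun h => hc ((posDef_congr_iff hg).mp h)), mul_zero]
  rw [lintegral_congr hpt, lintegral_const_mul' _ _ ENNReal.ofReal_ne_top] at key
  exact (ENNReal.mul_right_inj (by simpa using hpos) ENNReal.ofReal_ne_top).mp key

/-! ### Square roots -/

open scoped Matrix.Norms.L2Operator in
theorem continuousOn_sqrt (m : ℕ) : ContinuousOn (CFC.sqrt : Mat m m → Mat m m) {a | 0 ≤ a} :=
  CFC.continuousOn_sqrt

theorem isClosed_posSemidef (m : ℕ) : IsClosed {r : Mat m m | r.PosSemidef} := by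
  have h : {r : Mat m m | r.PosSemidef} =
      {r | rᵀ = r} ∩ ⋂ x : Fin m → ℝ, {r : Mat m m | 0 ≤ x ⬝ᵥ (r *ᵥ x)} := by
    ext r
    simp only [Set.mem_ofPred_eq, Set.mem_inter_iff, Set.mem_iInter]
    constructor
    · exact fun h => ⟨h.isHermitian, fun x => h.dotProduct_mulVec_nonneg x⟩
    · exact fun h => Matrix.PosSemidef.of_dotProduct_mulVec_nonneg h.1 h.2
  rw [h]
  exact IsClosed.inter (isClosed_eq (by fun_prop) continuous_id)
    (isClosed_iInter fun x => isClosed_le continuous_const (by fun_prop))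

theorem measurable_sqrt (m : ℕ) : Measurable (CFC.sqrt : Mat m m → Mat m m) := by
  classical
  have hs : {a : Mat m m | 0 ≤ a} = {a : Mat m m | a.PosSemidef} := by
    ext a
    exact Matrix.nonneg_iff_posSemidef
  -- Outside the nonnegative matrices the functional calculus returns `0`, so the square root is
  -- continuous on a closed set and constant on the complement.
  have h : (CFC.sqrt : Mat m m → Mat m m) = {a : Mat m m | 0 ≤ a}.piecewise CFC.sqrt fun _ => 0 := by
    funext a
    by_cases ha : a ∈ {a : Mat m m | 0 ≤ a}
    · rw [Set.piecewise_eq_of_mem _ _ _ ha]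
    · rw [Set.piecewise_eq_of_notMem _ _ _ ha]
      exact cfcₙ_apply_of_not_predicate a ha
  rw [h]
  refine (continuousOn_sqrt m).measurable_piecewise continuousOn_const ?_
  rw [hs]
  exact (isClosed_posSemidef m).measurableSet

theorem sqrt_mul_sqrt {m : ℕ} {r : Mat m m} (hr : r.PosSemidef) :
    CFC.sqrt r * CFC.sqrt r = r :=
  CFC.sqrt_mul_sqrt_self r hr.nonneg

theorem sqrt_posSemidef {m : ℕ} (r : Mat m m) : (CFC.sqrt r).PosSemidef :=
  Matrix.nonneg_iff_posSemidef.mp (CFC.sqrt_nonneg r)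

theorem sqrt_transpose {m : ℕ} (r : Mat m m) : (CFC.sqrt r)ᵀ = CFC.sqrt r :=
  (sqrt_posSemidef r).isHermitian

theorem sqrt_transpose_mul {m : ℕ} {r : Mat m m} (hr : r.PosSemidef) :
    (CFC.sqrt r)ᵀ * CFC.sqrt r = r := by
  rw [sqrt_transpose, sqrt_mul_sqrt hr]

theorem det_sqrt {m : ℕ} {r : Mat m m} (hr : r.PosSemidef) : (CFC.sqrt r).det = √r.det := by
  have h : (CFC.sqrt r).det * (CFC.sqrt r).det = r.det := by
    rw [← Matrix.det_mul, sqrt_mul_sqrt hr]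
  rw [← h, Real.sqrt_mul_self (sqrt_posSemidef r).det_nonneg]

theorem det_sqrt_ne_zero {m : ℕ} {r : Mat m m} (hr : r.PosDef) : (CFC.sqrt r).det ≠ 0 := by
  rw [det_sqrt hr.posSemidef]
  exact (Real.sqrt_pos.mpr hr.det_pos).ne'

/-! ### The orthogonal group -/

instance instProbHaarO (n : ℕ) : IsProbabilityMeasure (haarO n) := by
  refine ⟨?_⟩
  have h := Measure.haarMeasure_self (K₀ := (⊤ : TopologicalSpace.PositiveCompacts
    (Matrix.orthogonalGroup (Fin n) ℝ)))
  exact h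

instance instIsHaarHaarO (n : ℕ) : (haarO n).IsHaarMeasure :=
  Measure.isHaarMeasure_haarMeasure _

/-- A compact group is unimodular: a right translate of the Haar probability measure is again a Haar
probability measure, and this is unique. -/
theorem measurePreserving_mul_right_haarO {n : ℕ} (η : Matrix.orthogonalGroup (Fin n) ℝ) :
    MeasurePreserving (fun γ : Matrix.orthogonalGroup (Fin n) ℝ => γ * η) (haarO n) (haarO n) := by
  have hm : Measurable (fun γ : Matrix.orthogonalGroup (Fin n) ℝ => γ * η) :=
    measurable_mul_const η
  refine ⟨hm, ?_⟩
  have := Measure.isHaarMeasure_map_mul_right (haarO n) η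
  have : IsProbabilityMeasure ((haarO n).map fun γ => γ * η) :=
    Measure.isProbabilityMeasure_map hm.aemeasurable
  exact Measure.isHaarMeasure_eq_of_isProbabilityMeasure _ _

theorem norm_toLp_sq {m : ℕ} (v : Fin m → ℝ) : ‖WithLp.toLp 2 v‖ ^ 2 = v ⬝ᵥ v := by
  rw [EuclideanSpace.norm_sq_eq]
  simp [dotProduct, sq]

theorem mulVec_dotProduct_mulVec {n m : ℕ} (y : Mat n m) (u v : Fin m → ℝ) :
    (y *ᵥ u) ⬝ᵥ (y *ᵥ v) = u ⬝ᵥ ((yᵀ * y) *ᵥ v) := by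
  rw [← Matrix.mulVec_mulVec, Matrix.dotProduct_mulVec u, Matrix.vecMul_transpose]

/-- The orthogonal group acts transitively on the matrices with a given Gram matrix. -/
theorem exists_orthogonal_mul_eq {n m : ℕ} {y z : Mat n m} (h : yᵀ * y = zᵀ * z) :
    ∃ γ : Matrix.orthogonalGroup (Fin n) ℝ, (γ : Mat n n) * y = z := by
  let T : EuclideanSpace ℝ (Fin m) →ₗ[ℝ] EuclideanSpace ℝ (Fin n) := Matrix.toLpLin 2 2 y
  let S : EuclideanSpace ℝ (Fin m) →ₗ[ℝ] EuclideanSpace ℝ (Fin n) := Matrix.toLpLin 2 2 z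
  have hTS : ∀ v, ‖S v‖ = ‖T v‖ := fun v => by
    have h2 : ‖S v‖ ^ 2 = ‖T v‖ ^ 2 := by
      simp only [S, T, Matrix.toLpLin_apply, norm_toLp_sq, mulVec_dotProduct_mulVec, h]
    exact (sq_eq_sq₀ (norm_nonneg _) (norm_nonneg _)).mp h2
  -- Equal Gram matrices make `yv ↦ zv` a well-defined linear isometry on the range of `y`. It is
  -- built as `S ∘ g` with a linear section `g` of `T` and then extended to an isometry of the whole
  -- space.
  obtain ⟨g, hg⟩ := T.rangeRestrict.exists_rightInverse_of_surjective
    (LinearMap.range_eq_top.mpr T.surjective_rangeRestrict)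
  have hg' : ∀ s : LinearMap.range T, T (g s) = s := fun s =>
    congrArg Subtype.val (LinearMap.congr_fun hg s)
  let L : LinearMap.range T →ₗᵢ[ℝ] EuclideanSpace ℝ (Fin n) :=
    ⟨S ∘ₗ g, fun s => by rw [LinearMap.comp_apply, hTS, hg']; rfl⟩
  let U := L.extend
  have hU : ∀ v, U (T v) = S v := fun v => by
    have h1 : U (T v) = S (g ⟨T v, v, rfl⟩) := L.extend_apply ⟨T v, v, rfl⟩
    rw [h1, ← sub_eq_zero, ← map_sub, ← norm_eq_zero, hTS, map_sub, hg', sub_self, norm_zero]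
  let A : Mat n n := (Matrix.toLpLin 2 2).symm U.toLinearMap
  have hA : ∀ v : Fin n → ℝ, WithLp.toLp 2 (A *ᵥ v) = U (WithLp.toLp 2 v) := fun v => by
    have h1 : Matrix.toLpLin 2 2 A = U.toLinearMap := LinearEquiv.apply_symm_apply _ _
    exact (LinearMap.congr_fun h1 (WithLp.toLp 2 v))
  have hAA : Aᵀ * A = 1 := by
    ext i j
    have h1 : (A *ᵥ Pi.single i 1) ⬝ᵥ (A *ᵥ Pi.single j 1) = Pi.single i 1 ⬝ᵥ Pi.single j 1 := by
      have h2 := U.inner_map_map (WithLp.toLp 2 (Pi.single j 1)) (WithLp.toLp 2 (Pi.single i 1))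
      rw [← hA, ← hA] at h2
      exact h2
    rw [mulVec_dotProduct_mulVec] at h1
    simpa [Matrix.one_apply, Pi.single_apply, eq_comm] using h1
  refine ⟨⟨A, (Matrix.mem_orthogonalGroup_iff' (Fin n) ℝ).mpr hAA⟩, ?_⟩
  refine Matrix.ext_of_mulVec_single fun j => ?_
  rw [← Matrix.mulVec_mulVec]
  have h1 := (hA (y *ᵥ Pi.single j 1)).trans (hU (WithLp.toLp 2 (Pi.single j 1)))
  exact congrArg WithLp.ofLp h1

/-- Two matrices with the same Gram matrix differ by an orthogonal factor, which right invariance of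
the Haar measure absorbs. -/
theorem lintegral_haarO_congr {n m : ℕ} {y z : Mat n m} (h : yᵀ * y = zᵀ * z)
    {F : Mat n m → ENNReal} (hF : Measurable F) :
    ∫⁻ γ, F ((γ : Mat n n) * y) ∂(haarO n) = ∫⁻ γ, F ((γ : Mat n n) * z) ∂(haarO n) := by
  obtain ⟨η, rfl⟩ := exists_orthogonal_mul_eq h
  have hm : Measurable fun γ : Matrix.orthogonalGroup (Fin n) ℝ => F ((γ : Mat n n) * y) := by
    refine hF.comp (Continuous.measurable ?_)
    fun_prop
  rw [← (measurePreserving_mul_right_haarO η).lintegral_comp hm]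
  simp [Matrix.mul_assoc]

/-! ### Matrices of full rank -/

/-- For fixed `A` the function `t ↦ det(A + tI)` is a monic polynomial, so it has finitely many
zeros. By Fubini some `t` satisfies `det(A + tI) ≠ 0` for almost every `A`, and translation
invariance removes `t`. -/
theorem ae_det_ne_zero (m : ℕ) : ∀ᵐ A : Mat m m, A.det ≠ 0 := by
  have hm : MeasurableSet {q : Mat m m × ℝ | (q.1 + q.2 • (1 : Mat m m)).det ≠ 0} := by
    refine IsOpen.measurableSet (isOpen_ne_fun (by fun_prop) continuous_const)
  have h1 : ∀ᵐ A : Mat m m, ∀ᵐ t : ℝ, (A + t • (1 : Mat m m)).det ≠ 0 := by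
    refine Eventually.of_forall fun A => ?_
    rw [ae_iff]
    simp only [ne_eq, not_not]
    refine Set.Finite.measure_zero ?_ _
    refine ((Polynomial.finite_setOfPred_isRoot (Matrix.charpoly_monic (-A)).ne_zero).subset ?_)
    intro t ht
    simp only [Set.mem_ofPred_eq, Polynomial.IsRoot, Matrix.eval_charpoly] at ht ⊢
    rw [← ht]
    congr 1
    rw [sub_neg_eq_add, add_comm, Matrix.smul_one_eq_diagonal]
    rfl
  have h3 := (Measure.ae_ae_comm (μ := (volume : Measure (Mat m m))) (ν := (volume : Measure ℝ))
    (p := fun A t => (A + t • (1 : Mat m m)).det ≠ 0) hm).mp h1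
  obtain ⟨t, ht⟩ := h3.exists
  have h4 := (measurePreserving_add_right (volume : Measure (Mat m m))
    (-(t • (1 : Mat m m)))).quasiMeasurePreserving.ae ht
  refine h4.mono fun A hA => ?_
  simpa using hA

theorem gram_stack {n k m : ℕ} (hk : k ≤ n) (A : Mat k m) (B : Mat (n - k) m) :
    (stack A B : Mat n m)ᵀ * stack A B = Aᵀ * A + Bᵀ * B := by
  ext i j
  simp only [Matrix.mul_apply, Matrix.add_apply, Matrix.transpose_apply]
  rw [← (stackIndex hk).sum_comp, Fintype.sum_sum_type]
  simp only [stack_stackIndex_inl, stack_stackIndex_inr]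

theorem gram_posSemidef {n m : ℕ} (y : Mat n m) : (yᵀ * y).PosSemidef :=
  Matrix.posSemidef_conjTranspose_mul_self y

theorem gram_posDef_iff {n m : ℕ} (y : Mat n m) : (yᵀ * y).PosDef ↔ (yᵀ * y).det ≠ 0 :=
  (gram_posSemidef y).posDef_iff_det_ne_zero

theorem gram_posDef_of_det {m : ℕ} {A : Mat m m} (hA : A.det ≠ 0) : (Aᵀ * A).PosDef := by
  rw [gram_posDef_iff, Matrix.det_mul, Matrix.det_transpose]
  exact mul_ne_zero hA hA

/-- The top `m × m` block is almost surely invertible, and the remaining rows only add a positive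
semidefinite matrix to the Gram matrix. -/
theorem ae_gram_posDef {n m : ℕ} (hmn : m ≤ n) : ∀ᵐ y : Mat n m, (yᵀ * y).PosDef := by
  have h : ∀ᵐ p : Mat m m × Mat (n - m) m,
      ((stackEquiv hmn m p)ᵀ * stackEquiv hmn m p).PosDef := by
    have h1 : ∀ᵐ p : Mat m m × Mat (n - m) m, p.1.det ≠ 0 :=
      Measure.quasiMeasurePreserving_fst.ae (ae_det_ne_zero m)
    refine h1.mono fun p hp => ?_
    rw [stackEquiv_apply, gram_stack hmn]
    exact (gram_posDef_of_det hp).add_posSemidef (gram_posSemidef _)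
  have h2 := (measurePreserving_stackEquiv hmn m).symm.quasiMeasurePreserving.ae h
  simpa using h2

/-! ### Uniqueness of the invariant measure of the cone -/

/-- The Haar measure `|det g|^{-m} dg` of `GL_m`. -/
def glMeasure (m : ℕ) : Measure (Mat m m) :=
  volume.withDensity fun g => ENNReal.ofReal (|g.det| ^ m)⁻¹

instance instSFiniteGl (m : ℕ) : SFinite (glMeasure m) := by
  unfold glMeasure
  infer_instance

theorem measurable_glDensity (m : ℕ) :
    Measurable fun g : Mat m m => ENNReal.ofReal (|g.det| ^ m)⁻¹ := by
  have h : Measurable fun g : Mat m m => g.det := measurable_of_continuous (by fun_prop)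
  fun_prop

theorem ae_gl (m : ℕ) : ∀ᵐ g ∂(glMeasure m), g.det ≠ 0 :=
  (withDensity_absolutelyContinuous _ _).ae_le (ae_det_ne_zero m)

theorem lintegral_gl {m : ℕ} {F : Mat m m → ENNReal} (hF : Measurable F) :
    ∫⁻ g, F g ∂(glMeasure m) = ∫⁻ g, ENNReal.ofReal (|g.det| ^ m)⁻¹ * F g :=
  lintegral_withDensity_eq_lintegral_mul _ (measurable_glDensity m) hF

theorem lintegral_gl_mul_right {m : ℕ} {h : Mat m m} (hh : h.det ≠ 0) {F : Mat m m → ENNReal}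
    (hF : Measurable F) :
    ∫⁻ g, F (g * h) ∂(glMeasure m) = ∫⁻ g, F g ∂(glMeasure m) := by
  have hc : Measurable fun g : Mat m m => g * h := measurable_of_continuous (by fun_prop)
  have hpos : 0 < |h.det| ^ m := pow_pos (abs_pos.mpr hh) _
  have hG := (measurable_glDensity m).mul hF
  have h1 := lintegral_mul_right (n := m) hh hG
  rw [lintegral_gl hF, lintegral_gl (F := fun g => F (g * h)) (hF.comp hc)]
  have h2 : ∀ g : Mat m m, ENNReal.ofReal (|g.det| ^ m)⁻¹ * F (g * h) =
      ENNReal.ofReal (|h.det| ^ m) * (ENNReal.ofReal (|(g * h).det| ^ m)⁻¹ * F (g * h)) := by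
    intro g
    rw [← mul_assoc, ← ENNReal.ofReal_mul hpos.le]
    congr 2
    rw [Matrix.det_mul, abs_mul, mul_pow, mul_inv, mul_comm, mul_assoc,
      inv_mul_cancel₀ hpos.ne', mul_one]
  rw [lintegral_congr h2, lintegral_const_mul' _ _ ENNReal.ofReal_ne_top]
  refine (congrArg _ h1).trans ?_
  rw [← mul_assoc, ← ENNReal.ofReal_mul hpos.le, mul_inv_cancel₀ hpos.ne', ENNReal.ofReal_one,
    one_mul]
  rfl

theorem lintegral_gl_mul_left {m : ℕ} {h : Mat m m} (hh : h.det ≠ 0) {F : Mat m m → ENNReal}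
    (hF : Measurable F) :
    ∫⁻ g, F (h * g) ∂(glMeasure m) = ∫⁻ g, F g ∂(glMeasure m) := by
  have hc : Measurable fun g : Mat m m => h * g := measurable_of_continuous (by fun_prop)
  have hpos : 0 < |h.det| ^ m := pow_pos (abs_pos.mpr hh) _
  have hG := (measurable_glDensity m).mul hF
  have h1 := lintegral_comp_linearMap (L := mulLeftLinearMap (Fin m) ℝ h)
    (by rw [det_mulLeftLinearMap]; exact pow_ne_zero _ hh) hG
  rw [det_mulLeftLinearMap, abs_inv, abs_pow] at h1
  rw [lintegral_gl hF, lintegral_gl (F := fun g => F (h * g)) (hF.comp hc)]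
  have h2 : ∀ g : Mat m m, ENNReal.ofReal (|g.det| ^ m)⁻¹ * F (h * g) =
      ENNReal.ofReal (|h.det| ^ m) * (ENNReal.ofReal (|(h * g).det| ^ m)⁻¹ * F (h * g)) := by
    intro g
    rw [← mul_assoc, ← ENNReal.ofReal_mul hpos.le]
    congr 2
    rw [Matrix.det_mul, abs_mul, mul_pow, mul_inv, ← mul_assoc,
      mul_inv_cancel₀ hpos.ne', one_mul]
  rw [lintegral_congr h2, lintegral_const_mul' _ _ ENNReal.ofReal_ne_top]
  refine (congrArg _ h1).trans ?_
  rw [← mul_assoc, ← ENNReal.ofReal_mul hpos.le, mul_inv_cancel₀ hpos.ne', ENNReal.ofReal_one,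
    one_mul]
  rfl

theorem measurable_inv (m : ℕ) : Measurable fun g : Mat m m => g⁻¹ := by
  have hd : Measurable fun g : Mat m m => g.det := measurable_of_continuous (by fun_prop)
  have ha : Measurable fun g : Mat m m => g.adjugate := measurable_of_continuous (by fun_prop)
  refine measurable_of_entries fun i j => ?_
  simp only [Matrix.inv_def, Ring.inverse_eq_inv', Matrix.smul_apply, smul_eq_mul]
  exact hd.inv.mul ((measurable_entry i j).comp ha)

theorem det_inv_ne_zero {m : ℕ} {g : Mat m m} (hg : g.det ≠ 0) : (g⁻¹).det ≠ 0 := by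
  rw [Matrix.det_nonsing_inv]
  simpa using hg

/-- Any two invariant measures on the cone are proportional: each is determined, up to a
constant, by the Haar measure of `GL_m`. -/
theorem lintegral_mul_lintegral_gl {m : ℕ} {κ : Measure (Mat m m)} [SFinite κ]
    (hpd : ∀ᵐ r ∂κ, r.PosDef)
    (hκ : ∀ g : Mat m m, g.det ≠ 0 → ∀ F : Mat m m → ENNReal, Measurable F →
      ∫⁻ r, F (gᵀ * r * g) ∂κ = ∫⁻ r, F r ∂κ)
    {F H : Mat m m → ENNReal} (hF : Measurable F) (hH : Measurable H) :
    (∫⁻ r, F r ∂κ) * (∫⁻ g, H (gᵀ * g) ∂(glMeasure m)) =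
      (∫⁻ r, H r ∂κ) * ∫⁻ g, F ((g⁻¹)ᵀ * g⁻¹) ∂(glMeasure m) := by
  have hgram : Measurable fun g : Mat m m => gᵀ * g := measurable_of_continuous (by fun_prop)
  have hact : Measurable fun q : Mat m m × Mat m m => q.2ᵀ * q.1 * q.2 :=
    Continuous.measurable (by fun_prop)
  -- Write `g'rg` as the Gram matrix of `r^{1/2} g` and use left invariance.
  have h1 : ∀ r : Mat m m, r.PosDef →
      ∫⁻ g, H (gᵀ * r * g) ∂(glMeasure m) = ∫⁻ g, H (gᵀ * g) ∂(glMeasure m) := by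
    intro r hr
    rw [← lintegral_gl_mul_left (F := fun g => H (gᵀ * g)) (det_sqrt_ne_zero hr)
      (hH.comp hgram)]
    refine lintegral_congr fun g => ?_
    simp only [Matrix.transpose_mul, sqrt_transpose]
    rw [Matrix.mul_assoc gᵀ (CFC.sqrt r), ← Matrix.mul_assoc (CFC.sqrt r),
      sqrt_mul_sqrt hr.posSemidef, Matrix.mul_assoc]
  have hinvgram : Measurable fun g : Mat m m => F ((g⁻¹)ᵀ * g⁻¹) :=
    hF.comp (hgram.comp (measurable_inv m))
  -- Here `r^{1/2} g⁻¹` is the inverse of `g r^{-1/2}`, so right invariance applies.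
  have h2 : ∀ r : Mat m m, r.PosDef →
      ∫⁻ g, F ((g⁻¹)ᵀ * r * g⁻¹) ∂(glMeasure m) =
        ∫⁻ g, F ((g⁻¹)ᵀ * g⁻¹) ∂(glMeasure m) := by
    intro r hr
    have hs := det_sqrt_ne_zero hr
    rw [← lintegral_gl_mul_right (det_inv_ne_zero hs) hinvgram]
    refine lintegral_congr fun g => ?_
    simp only [Matrix.mul_inv_rev, Matrix.nonsing_inv_nonsing_inv _ (isUnit_iff_ne_zero.mpr hs),
      Matrix.transpose_mul, sqrt_transpose]
    rw [Matrix.mul_assoc (g⁻¹)ᵀ (CFC.sqrt r), ← Matrix.mul_assoc (CFC.sqrt r),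
      sqrt_mul_sqrt hr.posSemidef, Matrix.mul_assoc]
  calc (∫⁻ r, F r ∂κ) * (∫⁻ g, H (gᵀ * g) ∂(glMeasure m))
      = ∫⁻ r, F r * (∫⁻ g, H (gᵀ * r * g) ∂(glMeasure m)) ∂κ := by
        rw [← lintegral_mul_const _ hF]
        exact lintegral_congr_ae (hpd.mono fun r hr => by simp only [h1 r hr])
    _ = ∫⁻ r, ∫⁻ g, F r * H (gᵀ * r * g) ∂(glMeasure m) ∂κ := by
        refine lintegral_congr fun r => ?_
        rw [lintegral_const_mul]
        exact hH.comp (measurable_of_continuous (by fun_prop))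
    _ = ∫⁻ g, ∫⁻ r, F r * H (gᵀ * r * g) ∂κ ∂(glMeasure m) := by
        refine lintegral_lintegral_swap (Measurable.aemeasurable ?_)
        exact (hF.comp measurable_fst).mul (hH.comp hact)
    -- For fixed `g` the substitution `r ↦ (g⁻¹)' r g⁻¹` moves the action from `H` to `F`; this is
    -- the only use of the invariance of `κ`.
    _ = ∫⁻ g, ∫⁻ r, F ((g⁻¹)ᵀ * r * g⁻¹) * H r ∂κ ∂(glMeasure m) := by
        refine lintegral_congr_ae ((ae_gl m).mono fun g hg => ?_)
        have hi : Measurable fun r : Mat m m => F ((g⁻¹)ᵀ * r * g⁻¹) * H r :=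
          (hF.comp (measurable_of_continuous (by fun_prop))).mul hH
        simp only
        rw [← hκ g hg _ hi]
        refine lintegral_congr fun r => ?_
        have hu : IsUnit g.det := isUnit_iff_ne_zero.mpr hg
        congr 2
        rw [← Matrix.mul_assoc, ← Matrix.mul_assoc, ← Matrix.transpose_mul,
          Matrix.mul_nonsing_inv g hu, Matrix.transpose_one, Matrix.one_mul, Matrix.mul_assoc,
          Matrix.mul_nonsing_inv g hu, Matrix.mul_one]
    _ = ∫⁻ r, ∫⁻ g, F ((g⁻¹)ᵀ * r * g⁻¹) * H r ∂(glMeasure m) ∂κ := by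
        refine lintegral_lintegral_swap (Measurable.aemeasurable ?_)
        have h0 : Measurable fun q : Mat m m × Mat m m => F (q.1ᵀ * q.2 * q.1) :=
          hF.comp (Continuous.measurable (by fun_prop))
        have h3 : Measurable fun q : Mat m m × Mat m m => (q.1⁻¹, q.2) :=
          ((measurable_inv m).comp measurable_fst).prodMk measurable_snd
        exact (h0.comp h3).mul (hH.comp measurable_snd)
    _ = (∫⁻ r, H r ∂κ) * ∫⁻ g, F ((g⁻¹)ᵀ * g⁻¹) ∂(glMeasure m) := by
        rw [← lintegral_mul_const _ hH]
        refine lintegral_congr_ae (hpd.mono fun r hr => ?_)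
        have hi : Measurable fun g : Mat m m => F ((g⁻¹)ᵀ * r * g⁻¹) := by
          have h0 : Measurable fun h : Mat m m => F (hᵀ * r * h) :=
            hF.comp (measurable_of_continuous (by fun_prop))
          exact h0.comp (measurable_inv m)
        simp only
        rw [lintegral_mul_const _ hi, h2 r hr, mul_comm]

/-! ### The polar decomposition -/

theorem continuous_absDet (n m : ℕ) : Continuous fun y : Mat n m => absDet y := by
  unfold absDet
  fun_prop

theorem absDet_nonneg {n m : ℕ} (y : Mat n m) : 0 ≤ absDet y := Real.sqrt_nonneg _

theorem absDet_mul {n m : ℕ} (y : Mat n m) (g : Mat m m) : absDet (y * g) = absDet y * |g.det| := by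
  rw [absDet, absDet, Matrix.transpose_mul, Matrix.mul_assoc, ← Matrix.mul_assoc yᵀ,
    Matrix.det_mul, Matrix.det_mul, Matrix.det_transpose,
    show g.det * ((yᵀ * y).det * g.det) = (yᵀ * y).det * g.det ^ 2 by ring,
    Real.sqrt_mul (gram_posSemidef y).det_nonneg, Real.sqrt_sq_eq_abs]

theorem absDet_pos {n m : ℕ} {y : Mat n m} (hy : (yᵀ * y).PosDef) : 0 < absDet y :=
  Real.sqrt_pos.mpr hy.det_pos

theorem measurable_gram (n m : ℕ) : Measurable fun y : Mat n m => yᵀ * y :=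
  measurable_of_continuous (by fun_prop)

/-- The image of `|y|_m^{-n} dy` under `y ↦ y'y`. -/
def gramMeasure (n m : ℕ) : Measure (Mat m m) :=
  ((volume : Measure (Mat n m)).withDensity fun y => ENNReal.ofReal (absDet y ^ n)⁻¹).map
    fun y => yᵀ * y

instance instSFiniteGram (n m : ℕ) : SFinite (gramMeasure n m) := by
  unfold gramMeasure
  infer_instance

theorem measurable_gramDensity (n m : ℕ) :
    Measurable fun y : Mat n m => ENNReal.ofReal (absDet y ^ n)⁻¹ := by
  have h := measurable_of_continuous (continuous_absDet n m)
  fun_prop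

theorem lintegral_gramMeasure {n m : ℕ} {F : Mat m m → ENNReal} (hF : Measurable F) :
    ∫⁻ r, F r ∂(gramMeasure n m) =
      ∫⁻ y : Mat n m, ENNReal.ofReal (absDet y ^ n)⁻¹ * F (yᵀ * y) := by
  rw [gramMeasure, lintegral_map hF (measurable_gram n m)]
  exact lintegral_withDensity_eq_lintegral_mul _ (measurable_gramDensity n m)
    (hF.comp (measurable_gram n m))

theorem ae_gramMeasure_posDef {n m : ℕ} (hmn : m ≤ n) : ∀ᵐ r ∂(gramMeasure n m), r.PosDef := by
  rw [gramMeasure, ae_map_iff (measurable_gram n m).aemeasurable (measurableSet_posDef m)]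
  exact (withDensity_absolutelyContinuous _ _).ae_le (ae_gram_posDef hmn)

theorem lintegral_gramMeasure_congr {n m : ℕ} {g : Mat m m} (hg : g.det ≠ 0)
    {F : Mat m m → ENNReal} (hF : Measurable F) :
    ∫⁻ r, F (gᵀ * r * g) ∂(gramMeasure n m) = ∫⁻ r, F r ∂(gramMeasure n m) := by
  have hc : Measurable fun r : Mat m m => gᵀ * r * g := measurable_of_continuous (by fun_prop)
  have hpos : 0 < |g.det| ^ n := pow_pos (abs_pos.mpr hg) _
  have h1 := lintegral_mul_right (n := n) hg
    ((measurable_gramDensity n m).mul (hF.comp (measurable_gram n m)))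
  rw [lintegral_gramMeasure hF, lintegral_gramMeasure (F := fun r => F (gᵀ * r * g)) (hF.comp hc)]
  have h2 : ∀ y : Mat n m, ENNReal.ofReal (absDet y ^ n)⁻¹ * F (gᵀ * (yᵀ * y) * g) =
      ENNReal.ofReal (|g.det| ^ n) *
        (ENNReal.ofReal (absDet (y * g) ^ n)⁻¹ * F ((y * g)ᵀ * (y * g))) := by
    intro y
    rw [← mul_assoc, ← ENNReal.ofReal_mul hpos.le]
    congr 2
    · rw [absDet_mul, mul_pow, mul_inv, mul_comm, mul_assoc, inv_mul_cancel₀ hpos.ne', mul_one]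
    · rw [Matrix.transpose_mul, Matrix.mul_assoc, Matrix.mul_assoc, Matrix.mul_assoc]
  rw [lintegral_congr h2, lintegral_const_mul' _ _ ENNReal.ofReal_ne_top]
  refine (congrArg _ h1).trans ?_
  rw [← mul_assoc, ← ENNReal.ofReal_mul hpos.le, mul_inv_cancel₀ hpos.ne', ENNReal.ofReal_one,
    one_mul]
  rfl

theorem lintegral_gaussian (n m : ℕ) :
    ∫⁻ y : Mat n m, ENNReal.ofReal (Real.exp (-(yᵀ * y).trace)) =
      ENNReal.ofReal (Real.pi ^ ((n : ℝ) * m / 2)) := by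
  have h1 := GaussianFourier.integral_rexp_neg_mul_sq_norm (V := EMat n m) one_pos
  have h0 : Integrable fun v : EMat n m => Real.exp (-1 * ‖v‖ ^ 2) := by
    -- A non-integrable function would have Bochner integral `0`, whereas the Gaussian formula gives
    -- a positive value.
    by_contra h
    rw [integral_undef h] at h1
    have : 0 < (Real.pi / 1) ^ ((Module.finrank ℝ (EMat n m) : ℝ) / 2) := by positivity
    exact this.ne h1
  have h2 := ofReal_integral_eq_lintegral_ofReal h0 (Eventually.of_forall fun _ => by positivity)
  rw [h1, ← (measurePreserving_flatEquiv n m).lintegral_comp_emb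
    (flatEquiv n m).measurableEmbedding] at h2
  simp only [flatEquiv_apply, norm_flat_sq, finrank_euclideanSpace, Fintype.card_prod,
    Fintype.card_fin, div_one, neg_mul, one_mul, Nat.cast_mul] at h2
  exact h2.symm

/-- The quadratic form is continuous in the coordinates and positive on the compact unit sphere at
the identity matrix, hence positive on the whole sphere for all nearby coordinates. Homogeneity does
the rest. -/
theorem eventually_posDef_symOf (m : ℕ) :
    ∀ᶠ c in 𝓝 (symCoord m (1 : Mat m m)), (symOf m c).PosDef := by
  have hcont : Continuous (symOf m) := by
    refine continuous_matrix fun i j => ?_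
    simp only [symOf, Matrix.of_apply]
    split_ifs <;> fun_prop
  have h := (isCompact_sphere (0 : Fin m → ℝ) 1).eventually_forall_of_forall_eventually
    (x₀ := symCoord m (1 : Mat m m)) (P := fun c x => 0 < x ⬝ᵥ (symOf m c *ᵥ x)) ?_
  · refine h.mono fun c hc => ?_
    refine Matrix.PosDef.of_dotProduct_mulVec_pos (symOf_transpose c) fun x hx => ?_
    have hx' : ‖x‖ ≠ 0 := norm_ne_zero_iff.mpr hx
    have h1 := hc (‖x‖⁻¹ • x) (by simp [norm_smul, hx'])
    rw [Matrix.mulVec_smul, smul_dotProduct, dotProduct_smul, smul_eq_mul, smul_eq_mul,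
      ← mul_assoc] at h1
    exact pos_of_mul_pos_right h1 (by positivity)
  · intro x hx
    have h1 : 0 < x ⬝ᵥ (symOf m (symCoord m 1) *ᵥ x) := by
      rw [symOf_symCoord Matrix.transpose_one, Matrix.one_mulVec, ← norm_toLp_sq]
      have : WithLp.toLp 2 x ≠ 0 := by
        intro h0
        have : x = 0 := congrArg WithLp.ofLp h0
        simp [this] at hx
      positivity
    have h2 : Continuous fun q : SymCoord m × (Fin m → ℝ) => q.2 ⬝ᵥ (symOf m q.1 *ᵥ q.2) := by
      have h3 : Continuous fun q : SymCoord m × (Fin m → ℝ) => symOf m q.1 :=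
        hcont.comp continuous_fst
      fun_prop
    exact h2.continuousAt.eventually (lt_mem_nhds h1)

/-- The witness is a coordinate ball around the identity, weighted by the inverse of the density of
`d_*r`, so that its integral is the volume of the ball. -/
theorem exists_lintegral_coneInv_pos (m : ℕ) : ∃ F : Mat m m → ENNReal, Measurable F ∧
    ∫⁻ r, F r ∂(coneInvMeasure m) ≠ 0 ∧ ∫⁻ r, F r ∂(coneInvMeasure m) ≠ ⊤ := by
  obtain ⟨ε, hε, hball⟩ := Metric.nhds_basis_closedBall.eventually_iff.mp
    (eventually_posDef_symOf m)
  set c₀ := symCoord m (1 : Mat m m)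
  have hsc : Measurable (symCoord m) := measurable_pi_lambda _ fun q => measurable_entry _ _
  have hB : MeasurableSet (symCoord m ⁻¹' Metric.closedBall c₀ ε) :=
    hsc Metric.isClosed_closedBall.measurableSet
  refine ⟨(symCoord m ⁻¹' Metric.closedBall c₀ ε).indicator
    fun r => ENNReal.ofReal (r.det ^ (((m : ℝ) + 1) / 2)), ?_, ?_⟩
  · exact (measurable_det_rpow _).ennreal_ofReal.indicator hB
  have hm := (measurable_det_rpow (m := m) (((m : ℝ) + 1) / 2)).ennreal_ofReal.indicator hB
  have h1 : ∫⁻ r, (symCoord m ⁻¹' Metric.closedBall c₀ ε).indicator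
      (fun r => ENNReal.ofReal (r.det ^ (((m : ℝ) + 1) / 2))) r ∂(coneInvMeasure m) =
      volume (Metric.closedBall c₀ ε) := by
    rw [lintegral_coneInv hm, lintegral_coneVolume (F := fun r =>
      ENNReal.ofReal (r.det ^ (-((m : ℝ) + 1) / 2)) * _)
      ((measurable_det_rpow _).ennreal_ofReal.mul hm),
      ← lintegral_indicator_one Metric.isClosed_closedBall.measurableSet]
    refine lintegral_congr fun c => ?_
    by_cases hc : c ∈ Metric.closedBall c₀ ε
    · have hp := hball hc
      rw [Set.indicator_of_mem (show symOf m c ∈ {r : Mat m m | r.PosDef} from hp),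
        Set.indicator_of_mem hc, Set.indicator_of_mem (by simpa [symCoord_symOf] using hc),
        ← ENNReal.ofReal_mul (Real.rpow_nonneg hp.det_pos.le _), ← Real.rpow_add hp.det_pos]
      rw [show -((m : ℝ) + 1) / 2 + ((m : ℝ) + 1) / 2 = 0 by ring, Real.rpow_zero]
      simp
    · rw [Set.indicator_of_notMem hc]
      by_cases hp : (symOf m c).PosDef
      · rw [Set.indicator_of_mem (show symOf m c ∈ {r : Mat m m | r.PosDef} from hp),
          Set.indicator_of_notMem (by simpa [symCoord_symOf] using hc), mul_zero]
      · rw [Set.indicator_of_notMem (show symOf m c ∉ {r : Mat m m | r.PosDef} from hp)]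
  rw [h1]
  exact ⟨(Metric.measure_closedBall_pos _ _ hε).ne', measure_closedBall_lt_top.ne⟩

/-- Both measures are invariant under `r ↦ g'rg`, so each is a multiple of the same functional on
`GL_m`. The comparison function is `|r|^{m/2} e^{-tr r}`, whose integral over `GL_m` is a Gaussian
integral and therefore neither zero nor infinite. One further test function for each measure shows
that its own factor is neither zero nor infinite. -/
theorem exists_gramMeasure_eq_smul {n m : ℕ} (hmn : m ≤ n) : ∃ C : ENNReal, C ≠ 0 ∧ C ≠ ⊤ ∧
    ∀ F : Mat m m → ENNReal, Measurable F →
      ∫⁻ r, F r ∂(gramMeasure n m) = C * ∫⁻ r, F r ∂(coneInvMeasure m) := by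
  have hE : ∀ n : ℕ, m ≤ n → ∃ H : Mat m m → ENNReal, Measurable H ∧
      ∫⁻ r, H r ∂(gramMeasure n m) = ENNReal.ofReal (Real.pi ^ ((n : ℝ) * m / 2)) := by
    intro n hmn
    have hd : Measurable fun r : Mat m m => r.det := measurable_of_continuous (by fun_prop)
    have ht : Measurable fun r : Mat m m => r.trace := measurable_of_continuous (by fun_prop)
    have hH : Measurable fun r : Mat m m =>
        ENNReal.ofReal (√r.det ^ n) * ENNReal.ofReal (Real.exp (-r.trace)) := by fun_prop
    refine ⟨_, hH, ?_⟩
    rw [lintegral_gramMeasure hH, ← lintegral_gaussian]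
    refine lintegral_congr_ae ((ae_gram_posDef hmn).mono fun y hy => ?_)
    have hpos : 0 < absDet y ^ n := pow_pos (absDet_pos hy) _
    change ENNReal.ofReal (absDet y ^ n)⁻¹ * (ENNReal.ofReal (absDet y ^ n) * _) = _
    rw [← mul_assoc, ← ENNReal.ofReal_mul (by positivity), inv_mul_cancel₀ hpos.ne',
      ENNReal.ofReal_one, one_mul]
  have hpi : ∀ n : ℕ, ENNReal.ofReal (Real.pi ^ ((n : ℝ) * m / 2)) ≠ 0 := fun n => by
    have : 0 < Real.pi ^ ((n : ℝ) * m / 2) := Real.rpow_pos_of_pos Real.pi_pos _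
    simpa using this
  obtain ⟨H, hH, hHm⟩ := hE m le_rfl
  obtain ⟨F₁, hF₁, hF₁n⟩ := hE n hmn
  obtain ⟨F₂, hF₂, hF₂0, hF₂t⟩ := exists_lintegral_coneInv_pos m
  -- For square matrices `|g|_m = |det g|`, so `glMeasure` is the measure behind `gramMeasure m m`.
  have hν : ∫⁻ g, H (gᵀ * g) ∂(glMeasure m) = ENNReal.ofReal (Real.pi ^ ((m : ℝ) * m / 2)) := by
    rw [← hHm, lintegral_gramMeasure hH, lintegral_gl (F := fun g => H (gᵀ * g))
      (hH.comp (measurable_gram m m))]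
    refine lintegral_congr fun g => ?_
    rw [absDet, Matrix.det_mul, Matrix.det_transpose, Real.sqrt_mul_self_eq_abs]
  set P := ENNReal.ofReal (Real.pi ^ ((m : ℝ) * m / 2)) with hP
  have hP0 : P ≠ 0 := hpi m
  have hPt : P ≠ ⊤ := ENNReal.ofReal_ne_top
  have e1 : ∀ F : Mat m m → ENNReal, Measurable F → ∫⁻ r, F r ∂(gramMeasure n m) =
      (∫⁻ r, H r ∂(gramMeasure n m)) / P * ∫⁻ g, F ((g⁻¹)ᵀ * g⁻¹) ∂(glMeasure m) := fun F hF => by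
    have h := lintegral_mul_lintegral_gl (ae_gramMeasure_posDef hmn)
      (fun g hg F hF => lintegral_gramMeasure_congr hg hF) hF hH
    rw [hν] at h
    rw [ENNReal.mul_comm_div, ← mul_div_assoc, ← h, ENNReal.mul_div_cancel_right hP0 hPt]
  have e2 : ∀ F : Mat m m → ENNReal, Measurable F → ∫⁻ r, F r ∂(coneInvMeasure m) =
      (∫⁻ r, H r ∂(coneInvMeasure m)) / P * ∫⁻ g, F ((g⁻¹)ᵀ * g⁻¹) ∂(glMeasure m) :=
      fun F hF => by
    have h := lintegral_mul_lintegral_gl (ae_coneInv_posDef m)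
      (fun g hg F hF => lintegral_coneInv_congr hg hF) hF hH
    rw [hν] at h
    rw [ENNReal.mul_comm_div, ← mul_div_assoc, ← h, ENNReal.mul_div_cancel_right hP0 hPt]
  have hA : ∀ x A v : ENNReal, x ≠ 0 → x ≠ ⊤ → x = A * v → A ≠ 0 ∧ A ≠ ⊤ := by
    rintro x A v hx hx' rfl
    refine ⟨left_ne_zero_of_mul hx, ?_⟩
    rintro rfl
    exact hx' (ENNReal.top_mul (right_ne_zero_of_mul hx))
  obtain ⟨h1, h1'⟩ := hA _ _ _ (hF₁n ▸ hpi n) (hF₁n ▸ ENNReal.ofReal_ne_top) (e1 F₁ hF₁)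
  obtain ⟨h2, h2'⟩ := hA _ _ _ hF₂0 hF₂t (e2 F₂ hF₂)
  refine ⟨_, (ENNReal.div_pos h1 h2').ne', ENNReal.div_ne_top h1' h2, fun F hF => ?_⟩
  rw [e1 F hF, e2 F hF, ← mul_assoc _ _ (∫⁻ g, F ((g⁻¹)ᵀ * g⁻¹) ∂(glMeasure m)),
    ENNReal.div_mul_cancel h2 h2']

/-- The constant `π^{nm/2} / Γ_m(n/2)` of the polar decomposition. -/
def polarConst (n m : ℕ) : ℝ := Real.pi ^ ((n : ℝ) * m / 2) / siegelGamma m ((n : ℝ) / 2)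

theorem sigma_eq (n m : ℕ) : sigma n m = 2 ^ m * polarConst n m := by
  rw [sigma, polarConst, mul_div_assoc]

theorem lintegral_gram_aux {n m : ℕ} (hmn : m ≤ n) {Φ : Mat m m → ENNReal} (hΦ : Measurable Φ) :
    ∫⁻ y : Mat n m, Φ (yᵀ * y) =
      ∫⁻ r, ENNReal.ofReal (r.det ^ ((n : ℝ) / 2)) * Φ r ∂(gramMeasure n m) := by
  have hm : Measurable fun r : Mat m m => ENNReal.ofReal (r.det ^ ((n : ℝ) / 2)) * Φ r :=
    (measurable_det_rpow _).ennreal_ofReal.mul hΦ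
  rw [lintegral_gramMeasure hm]
  refine lintegral_congr_ae ((ae_gram_posDef hmn).mono fun y hy => ?_)
  have hpos := absDet_pos hy
  have h : (yᵀ * y).det ^ ((n : ℝ) / 2) = absDet y ^ n := by
    rw [absDet, Real.sqrt_eq_rpow, ← Real.rpow_natCast, ← Real.rpow_mul hy.det_pos.le]
    congr 1
    ring
  simp only
  rw [← mul_assoc, ← ENNReal.ofReal_mul (by positivity), h,
    inv_mul_cancel₀ (pow_pos hpos n).ne', ENNReal.ofReal_one, one_mul]

/-- Testing the proportionality on the Gaussian gives `π^{nm/2} = C Γ_m(n/2)`. As `C` is neither `0`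
nor `∞`, this shows that the gamma integral is finite and positive and also identifies `C`. -/
theorem siegelGamma_pos_and_gramMeasure {n m : ℕ} (hmn : m ≤ n) :
    0 < siegelGamma m ((n : ℝ) / 2) ∧ ∀ F : Mat m m → ENNReal, Measurable F →
      ∫⁻ r, F r ∂(gramMeasure n m) =
        ENNReal.ofReal (polarConst n m) * ∫⁻ r, F r ∂(coneInvMeasure m) := by
  obtain ⟨C, hC0, hCt, hC⟩ := exists_gramMeasure_eq_smul hmn
  have ht : Measurable fun r : Mat m m => r.trace := measurable_of_continuous (by fun_prop)
  have hd := fun s => measurable_det_rpow (m := m) s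
  have h1 := lintegral_gram_aux hmn (Φ := fun r => ENNReal.ofReal (Real.exp (-r.trace)))
    (by fun_prop)
  have hint : ∫⁻ r : Mat m m, ENNReal.ofReal (r.det ^ ((n : ℝ) / 2)) *
      ENNReal.ofReal (Real.exp (-r.trace)) ∂(coneInvMeasure m) =
      ∫⁻ r : Mat m m, ENNReal.ofReal
        (Real.exp (-r.trace) * r.det ^ ((n : ℝ) / 2 - ((m : ℝ) + 1) / 2)) ∂(coneVolume m) := by
    rw [lintegral_coneInv (F := fun r => ENNReal.ofReal (r.det ^ ((n : ℝ) / 2)) *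
      ENNReal.ofReal (Real.exp (-r.trace)))
      ((hd _).ennreal_ofReal.mul (by fun_prop))]
    refine lintegral_congr_ae ((ae_coneVolume_posDef m).mono fun r hr => ?_)
    have hdet := hr.det_pos
    simp only
    rw [← ENNReal.ofReal_mul (by positivity), ← ENNReal.ofReal_mul (by positivity), mul_comm,
      mul_comm (r.det ^ ((n : ℝ) / 2)), mul_assoc, ← Real.rpow_add hdet]
    congr 3
    ring
  rw [lintegral_gaussian, hC (fun r => ENNReal.ofReal (r.det ^ ((n : ℝ) / 2)) *
    ENNReal.ofReal (Real.exp (-r.trace))) (((hd _).ennreal_ofReal).mul (by fun_prop)), hint] at h1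
  have hpi : 0 < Real.pi ^ ((n : ℝ) * m / 2) := Real.rpow_pos_of_pos Real.pi_pos _
  have hI : siegelGamma m ((n : ℝ) / 2) = (∫⁻ r : Mat m m, ENNReal.ofReal
        (Real.exp (-r.trace) * r.det ^ ((n : ℝ) / 2 - ((m : ℝ) + 1) / 2)) ∂(coneVolume m)).toReal :=
    integral_eq_lintegral_of_nonneg_ae
      ((ae_coneVolume_posDef m).mono fun r hr => by
        have := hr.det_pos
        change 0 ≤ Real.exp (-r.trace) * r.det ^ ((n : ℝ) / 2 - ((m : ℝ) + 1) / 2)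
        positivity)
      (Measurable.aestronglyMeasurable ((by fun_prop : Measurable fun r : Mat m m =>
        Real.exp (-r.trace)).mul (hd _)))
  set I := ∫⁻ r : Mat m m, ENNReal.ofReal
        (Real.exp (-r.trace) * r.det ^ ((n : ℝ) / 2 - ((m : ℝ) + 1) / 2)) ∂(coneVolume m) with hIdef
  have hIt : I ≠ ⊤ := fun h => by
    rw [h, ENNReal.mul_top hC0] at h1
    exact ENNReal.ofReal_ne_top h1
  have hI0 : I ≠ 0 := fun h => by
    rw [h, mul_zero] at h1
    simp only [ENNReal.ofReal_eq_zero] at h1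
    exact absurd hpi (not_lt.mpr h1)
  have hpos : 0 < siegelGamma m ((n : ℝ) / 2) := by
    rw [hI]
    exact ENNReal.toReal_pos hI0 hIt
  refine ⟨hpos, fun F hF => ?_⟩
  rw [hC F hF, polarConst, ENNReal.ofReal_div_of_pos hpos, hI, ENNReal.ofReal_toReal hIt, h1,
    ENNReal.mul_div_cancel_right hI0 hIt]

theorem siegelGamma_pos {n m : ℕ} (hmn : m ≤ n) : 0 < siegelGamma m ((n : ℝ) / 2) :=
  (siegelGamma_pos_and_gramMeasure hmn).1

theorem polarConst_pos {n m : ℕ} (hmn : m ≤ n) : 0 < polarConst n m :=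
  div_pos (Real.rpow_pos_of_pos Real.pi_pos _) (siegelGamma_pos hmn)

/-- The polar decomposition, in terms of the Gram matrix. -/
theorem lintegral_gram {n m : ℕ} (hmn : m ≤ n) {Φ : Mat m m → ENNReal} (hΦ : Measurable Φ) :
    ∫⁻ y : Mat n m, Φ (yᵀ * y) = ENNReal.ofReal (polarConst n m) *
      ∫⁻ r, ENNReal.ofReal (r.det ^ ((n : ℝ) / 2)) * Φ r ∂(coneInvMeasure m) := by
  rw [lintegral_gram_aux hmn hΦ, (siegelGamma_pos_and_gramMeasure hmn).2
    (fun r => ENNReal.ofReal (r.det ^ ((n : ℝ) / 2)) * Φ r)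
    ((measurable_det_rpow _).ennreal_ofReal.mul hΦ)]

/-! ### Averages over rotated coordinate subspaces -/

theorem measurable_matMul {α : Type*} [MeasurableSpace α] {a b c : ℕ} {f : α → Mat a b}
    {g : α → Mat b c} (hf : Measurable f) (hg : Measurable g) : Measurable fun x => f x * g x := by
  refine measurable_of_entries fun i j => ?_
  simp only [Matrix.mul_apply]
  exact Finset.measurable_sum _ fun l _ =>
    ((measurable_entry i l).comp hf).mul ((measurable_entry l j).comp hg)

theorem measurable_coe_orthogonal (n : ℕ) :
    Measurable fun γ : Matrix.orthogonalGroup (Fin n) ℝ => (γ : Mat n n) := measurable_subtype_coe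

theorem measurePreserving_orthogonal {n : ℕ} (m : ℕ) (γ : Matrix.orthogonalGroup (Fin n) ℝ) :
    MeasurePreserving (fun y : Mat n m => (γ : Mat n n) * y) :=
  measurePreserving_mul_left m (abs_det_orthogonal γ)

theorem gram_orthogonal_mul {n m : ℕ} (γ : Matrix.orthogonalGroup (Fin n) ℝ) (y : Mat n m) :
    ((γ : Mat n n) * y)ᵀ * ((γ : Mat n n) * y) = yᵀ * y := by
  rw [Matrix.transpose_mul, Matrix.mul_assoc, ← Matrix.mul_assoc _ _ y,
    orthogonal_transpose_mul, Matrix.one_mul]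

/-- A matrix whose Gram matrix is `r`. -/
def gramSection (n : ℕ) {m : ℕ} (r : Mat m m) : Mat n m :=
  (stack (1 : Mat m m) (0 : Mat (n - m) m) : Mat n m) * CFC.sqrt r

theorem gram_gramSection {n m : ℕ} (hmn : m ≤ n) {r : Mat m m} (hr : r.PosSemidef) :
    (gramSection n r)ᵀ * gramSection n r = r := by
  rw [gramSection, Matrix.transpose_mul, Matrix.mul_assoc, ← Matrix.mul_assoc _ _ (CFC.sqrt r),
    gram_stack hmn]
  simp [sqrt_transpose, sqrt_mul_sqrt hr]

theorem measurable_gramSection (n m : ℕ) : Measurable (gramSection n (m := m)) :=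
  measurable_matMul measurable_const (measurable_sqrt m)

/-- The average of `φ` over the matrices with a given Gram matrix. -/
def orbitMean (n : ℕ) {m : ℕ} (φ : Mat n m → ENNReal) (r : Mat m m) : ENNReal :=
  ∫⁻ γ, φ ((γ : Mat n n) * gramSection n r) ∂(haarO n)

theorem measurable_orbitMean {n m : ℕ} {φ : Mat n m → ENNReal} (hφ : Measurable φ) :
    Measurable (orbitMean n φ) := by
  have h : Measurable fun q : Mat m m × Matrix.orthogonalGroup (Fin n) ℝ =>
      φ ((q.2 : Mat n n) * gramSection n q.1) :=
    hφ.comp (measurable_matMul ((measurable_coe_orthogonal n).comp measurable_snd)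
      ((measurable_gramSection n m).comp measurable_fst))
  exact h.lintegral_prod_right'

theorem lintegral_haarO_eq_orbitMean {n m : ℕ} (hmn : m ≤ n) {φ : Mat n m → ENNReal}
    (hφ : Measurable φ) (y : Mat n m) :
    ∫⁻ γ, φ ((γ : Mat n n) * y) ∂(haarO n) = orbitMean n φ (yᵀ * y) :=
  lintegral_haarO_congr (gram_gramSection hmn (gram_posSemidef y)).symm hφ

theorem measurable_orthogonal_mul {n m : ℕ} {φ : Mat n m → ENNReal} (hφ : Measurable φ)
    {α : Type*} [MeasurableSpace α] {z : α → Mat n m} (hz : Measurable z) :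
    Measurable fun q : Matrix.orthogonalGroup (Fin n) ℝ × α => φ ((q.1 : Mat n n) * z q.2) :=
  hφ.comp (measurable_matMul ((measurable_coe_orthogonal n).comp measurable_fst)
    (hz.comp measurable_snd))

/-- Lebesgue measure and the weight `ρ(y'y)` are both invariant under `y ↦ γy`, so the integral
equals its average over `O(n)`, and the average depends only on `y'y`. -/
theorem lintegral_eq_lintegral_orbitMean {n m : ℕ} (hmn : m ≤ n) {φ : Mat n m → ENNReal}
    (hφ : Measurable φ) {ρ : Mat m m → ENNReal} (hρ : Measurable ρ) :
    ∫⁻ y : Mat n m, ρ (yᵀ * y) * φ y = ∫⁻ y : Mat n m, ρ (yᵀ * y) * orbitMean n φ (yᵀ * y) := by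
  have hF : Measurable fun y : Mat n m => ρ (yᵀ * y) * φ y :=
    (hρ.comp (measurable_gram n m)).mul hφ
  calc ∫⁻ y : Mat n m, ρ (yᵀ * y) * φ y
      = ∫⁻ _γ, (∫⁻ y : Mat n m, ρ (yᵀ * y) * φ y) ∂(haarO n) := by simp
    _ = ∫⁻ γ, (∫⁻ y : Mat n m, ρ (yᵀ * y) * φ ((γ : Mat n n) * y)) ∂(haarO n) := by
        refine lintegral_congr fun γ => ?_
        rw [← (measurePreserving_orthogonal m γ).lintegral_comp hF]
        simp only [gram_orthogonal_mul]
    _ = ∫⁻ y : Mat n m, ∫⁻ γ, ρ (yᵀ * y) * φ ((γ : Mat n n) * y) ∂(haarO n) := by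
        refine lintegral_lintegral_swap (Measurable.aemeasurable ?_)
        exact ((hρ.comp (measurable_gram n m)).comp measurable_snd).mul
          (measurable_orthogonal_mul hφ measurable_id)
    _ = ∫⁻ y : Mat n m, ρ (yᵀ * y) * orbitMean n φ (yᵀ * y) := by
        refine lintegral_congr fun y => ?_
        rw [lintegral_const_mul, lintegral_haarO_eq_orbitMean hmn hφ]
        exact (measurable_orthogonal_mul hφ measurable_const).comp
          (measurable_id.prodMk (measurable_const (a := ())))

theorem measurable_stack_zero {n k : ℕ} (hk : k ≤ n) (m : ℕ) :
    Measurable fun t : Mat (n - k) m => (stack (0 : Mat k m) t : Mat n m) :=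
  (stackEquiv hk m).measurable.comp (measurable_const.prodMk measurable_id)

theorem measurable_stack_zero_right {n k : ℕ} (hk : k ≤ n) (m : ℕ) :
    Measurable fun ω : Mat k m => (stack ω (0 : Mat (n - k) m) : Mat n m) :=
  (stackEquiv hk m).measurable.comp (measurable_id.prodMk measurable_const)

/-- Averaging the integrals over the rotated copies of an `(n-k)`-dimensional coordinate subspace
gives the weight `|y|_m^{-k}`. -/
theorem lintegral_haarO_lintegral_stack {n m k : ℕ} (hkn : k + m ≤ n) {φ : Mat n m → ENNReal}
    (hφ : Measurable φ) :
    ∫⁻ γ, (∫⁻ t : Mat (n - k) m, φ ((γ : Mat n n) * stack (0 : Mat k m) t)) ∂(haarO n) =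
      ENNReal.ofReal (polarConst (n - k) m / polarConst n m) *
        ∫⁻ y : Mat n m, ENNReal.ofReal (absDet y ^ k)⁻¹ * φ y := by
  have hk : k ≤ n := by omega
  have hmn : m ≤ n := by omega
  have hml : m ≤ n - k := by omega
  have hd : Measurable fun r : Mat m m => r.det := measurable_of_continuous (by fun_prop)
  have hρ : Measurable fun r : Mat m m => ENNReal.ofReal (√r.det ^ k)⁻¹ := by fun_prop
  -- The Gram matrix of `[0; t]` is `t't`, so the rotation average is the same orbit mean, now
  -- evaluated on `(n-k) × m` matrices. Polar decomposition in dimensions `n - k` and `n` then gives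
  -- the weights `|r|^{(n-k)/2}` and `|r|^{n/2} |r|^{-k/2}`, which agree.
  have h1 : ∫⁻ γ, (∫⁻ t : Mat (n - k) m, φ ((γ : Mat n n) * stack (0 : Mat k m) t)) ∂(haarO n) =
      ∫⁻ t : Mat (n - k) m, orbitMean n φ (tᵀ * t) := by
    rw [lintegral_lintegral_swap
      (measurable_orthogonal_mul hφ (measurable_stack_zero hk m)).aemeasurable]
    refine lintegral_congr fun t => ?_
    rw [lintegral_haarO_eq_orbitMean hmn hφ, gram_stack hk]
    simp
  have h2 : ∫⁻ y : Mat n m, ENNReal.ofReal (absDet y ^ k)⁻¹ * φ y =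
      ∫⁻ y : Mat n m, ENNReal.ofReal (√(yᵀ * y).det ^ k)⁻¹ * orbitMean n φ (yᵀ * y) :=
    lintegral_eq_lintegral_orbitMean hmn hφ hρ
  rw [h1, h2, lintegral_gram hml (measurable_orbitMean hφ),
    lintegral_gram hmn (Φ := fun r => ENNReal.ofReal (√r.det ^ k)⁻¹ * orbitMean n φ r)
      (hρ.mul (measurable_orbitMean hφ)), ← mul_assoc,
    ← ENNReal.ofReal_mul (div_pos (polarConst_pos hml) (polarConst_pos hmn)).le,
    div_mul_cancel₀ _ (polarConst_pos hmn).ne']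
  congr 1
  refine lintegral_congr_ae ((ae_coneInv_posDef m).mono fun r hr => ?_)
  have hdet := hr.det_pos
  simp only
  rw [← mul_assoc, ← ENNReal.ofReal_mul (by positivity)]
  congr 2
  rw [Real.sqrt_eq_rpow, ← Real.rpow_natCast, ← Real.rpow_mul hdet.le, ← Real.rpow_neg hdet.le,
    ← Real.rpow_add hdet, Nat.cast_sub hk]
  congr 1
  ring

/-! ### Determinantal weights -/

theorem gram_trace_nonneg {n m : ℕ} (x : Mat n m) : 0 ≤ (xᵀ * x).trace := by
  rw [← norm_flat_sq]
  positivity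

theorem one_add_gram_posDef {n m : ℕ} (x : Mat n m) : (1 + xᵀ * x).PosDef :=
  Matrix.PosDef.one.add_posSemidef (gram_posSemidef x)

theorem det_one_add_gram_pos {n m : ℕ} (x : Mat n m) : 0 < (1 + xᵀ * x).det :=
  (one_add_gram_posDef x).det_pos

theorem lintegral_det_one_add_row_lt_top {m : ℕ} {s : ℝ} (hs : (m : ℝ) < s) :
    ∫⁻ u : Mat 1 m, ENNReal.ofReal ((1 + uᵀ * u).det ^ (-s / 2)) < ⊤ := by
  have h1 : Integrable fun v : EMat 1 m => ((1 : ℝ) + ‖v‖ ^ 2) ^ (-s / 2) :=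
    integrable_rpow_neg_one_add_norm_sq (by simpa using hs)
  have h2 := h1.lintegral_lt_top
  rw [← (measurePreserving_flatEquiv 1 m).lintegral_comp_emb
    (flatEquiv 1 m).measurableEmbedding] at h2
  refine lt_of_eq_of_lt (lintegral_congr fun u => ?_) h2
  rw [flatEquiv_apply, norm_flat_sq, Matrix.det_one_add_mul_comm, Matrix.trace_mul_comm]
  simp [Matrix.trace]

/-- Substitute `v = u A^{1/2}`: the determinant factors as `|A| · |1 + u'u|`, and the Jacobian
`|A|^{1/2}` lowers the exponent from `s` to `s - 1`. -/
theorem lintegral_det_add_row {m : ℕ} {A : Mat m m} (hA : A.PosDef) (s : ℝ) :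
    ∫⁻ v : Mat 1 m, ENNReal.ofReal ((A + vᵀ * v).det ^ (-s / 2)) =
      ENNReal.ofReal (A.det ^ (-(s - 1) / 2)) *
        ∫⁻ u : Mat 1 m, ENNReal.ofReal ((1 + uᵀ * u).det ^ (-s / 2)) := by
  have hF : Measurable fun v : Mat 1 m => ENNReal.ofReal ((A + vᵀ * v).det ^ (-s / 2)) :=
    ((measurable_of_continuous (by fun_prop : Continuous fun v : Mat 1 m =>
      (A + vᵀ * v).det)).pow_const _).ennreal_ofReal
  have hS := det_sqrt_ne_zero hA
  have h := lintegral_mul_right (n := 1) hS hF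
  have hdet := hA.det_pos
  have h1 : ∀ u : Mat 1 m, (A + (u * CFC.sqrt A)ᵀ * (u * CFC.sqrt A)).det =
      A.det * (1 + uᵀ * u).det := fun u => by
    have h2 : A + (u * CFC.sqrt A)ᵀ * (u * CFC.sqrt A) =
        CFC.sqrt A * (1 + uᵀ * u) * CFC.sqrt A := by
      rw [Matrix.transpose_mul, sqrt_transpose, Matrix.mul_add, Matrix.add_mul, Matrix.mul_one,
        sqrt_mul_sqrt hA.posSemidef]
      simp only [Matrix.mul_assoc]
    have h3 : (CFC.sqrt A).det * (CFC.sqrt A).det = A.det := by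
      rw [← Matrix.det_mul, sqrt_mul_sqrt hA.posSemidef]
    rw [h2, Matrix.det_mul, Matrix.det_mul, ← h3]
    ring
  have h4 : ∀ u : Mat 1 m, ENNReal.ofReal ((A.det * (1 + uᵀ * u).det) ^ (-s / 2)) =
      ENNReal.ofReal (A.det ^ (-s / 2)) * ENNReal.ofReal ((1 + uᵀ * u).det ^ (-s / 2)) := fun u => by
    rw [Real.mul_rpow hdet.le (det_one_add_gram_pos u).le, ENNReal.ofReal_mul (by positivity)]
  simp only [h1, h4] at h
  rw [lintegral_const_mul' _ _ ENNReal.ofReal_ne_top, pow_one, det_sqrt hA.posSemidef,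
    abs_of_nonneg (Real.sqrt_nonneg _)] at h
  have hq : 0 < √A.det := Real.sqrt_pos.mpr hdet
  have h5 : A.det ^ (-(s - 1) / 2) = √A.det * A.det ^ (-s / 2) := by
    rw [Real.sqrt_eq_rpow, ← Real.rpow_add hdet]
    congr 1
    ring
  rw [h5, ENNReal.ofReal_mul hq.le, mul_assoc, h, ← mul_assoc, ← ENNReal.ofReal_mul hq.le,
    mul_inv_cancel₀ hq.ne', ENNReal.ofReal_one, one_mul]

/-- Induction on the number of rows. Integrating out one row costs a factor that is finite for `s >
m` and replaces `s` by `s - 1`, so the condition `s > n + m - 1` propagates. -/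
theorem lintegral_det_one_add_gram_lt_top (n : ℕ) : ∀ {m : ℕ} {s : ℝ}, (n : ℝ) + m - 1 < s →
    ∫⁻ x : Mat n m, ENNReal.ofReal ((1 + xᵀ * x).det ^ (-s / 2)) < ⊤ := by
  induction n with
  | zero =>
    intro m s _
    have h : ∀ x : Mat 0 m, ENNReal.ofReal ((1 + xᵀ * x).det ^ (-s / 2)) = 1 := fun x => by
      have : xᵀ * x = 0 := by
        ext i j
        simp [Matrix.mul_apply]
      rw [this, add_zero, Matrix.det_one, Real.one_rpow, ENNReal.ofReal_one]
    rw [lintegral_congr h, lintegral_one]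
    have h2 := volume_rows (n := 0) (m := m) fun i => i.elim0
    simp only [IsEmpty.forall_iff, Finset.univ_eq_empty, Finset.prod_empty] at h2
    exact lt_of_eq_of_lt h2 ENNReal.one_lt_top
  | succ n ih =>
    intro m s hs
    push_cast at hs
    have hd : Measurable fun x : Mat (n + 1) m => ENNReal.ofReal ((1 + xᵀ * x).det ^ (-s / 2)) :=
      ((measurable_of_continuous (by fun_prop : Continuous fun x : Mat (n + 1) m =>
        (1 + xᵀ * x).det)).pow_const _).ennreal_ofReal
    have hk : 1 ≤ n + 1 := by omega
    rw [← (measurePreserving_stackEquiv hk m).lintegral_comp hd, Measure.volume_eq_prod]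
    refine lt_of_eq_of_lt
      (lintegral_prod_symm _ (hd.comp (stackEquiv hk m).measurable).aemeasurable) ?_
    have h1 : ∀ y : Mat n m, ∫⁻ v : Mat 1 m, ENNReal.ofReal
        ((1 + (stackEquiv hk m (v, y))ᵀ * stackEquiv hk m (v, y)).det ^ (-s / 2)) =
        ENNReal.ofReal ((1 + yᵀ * y).det ^ (-(s - 1) / 2)) *
        ∫⁻ u : Mat 1 m, ENNReal.ofReal ((1 + uᵀ * u).det ^ (-s / 2)) := fun y => by
      rw [← lintegral_det_add_row (one_add_gram_posDef y)]
      refine lintegral_congr fun v => ?_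
      rw [stackEquiv_apply, gram_stack hk]
      congr 3
      change 1 + (vᵀ * v + yᵀ * y) = 1 + yᵀ * y + vᵀ * v
      abel
    refine lt_of_eq_of_lt (lintegral_congr h1) ?_
    have hn : (0 : ℝ) ≤ n := n.cast_nonneg
    have hfin := lintegral_det_one_add_row_lt_top (m := m) (s := s) (by linarith)
    rw [lintegral_mul_const' _ _ hfin.ne]
    exact ENNReal.mul_lt_top (ih (by linarith)) hfin

theorem lintegral_gaussian_right {n m : ℕ} {B : Mat m m} (hB : B.PosDef) :
    ∫⁻ X : Mat n m, ENNReal.ofReal (Real.exp (-(B * (Xᵀ * X)).trace)) =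
      ENNReal.ofReal (B.det ^ (-(n : ℝ) / 2)) * ENNReal.ofReal (Real.pi ^ ((n : ℝ) * m / 2)) := by
  have hF : Measurable fun X : Mat n m => ENNReal.ofReal (Real.exp (-(Xᵀ * X).trace)) :=
    (measurable_of_continuous (by fun_prop : Continuous fun X : Mat n m =>
      Real.exp (-(Xᵀ * X).trace))).ennreal_ofReal
  have h := lintegral_mul_right (n := n) (det_sqrt_ne_zero hB) hF
  rw [lintegral_gaussian] at h
  have h1 : ∀ X : Mat n m, ((X * CFC.sqrt B)ᵀ * (X * CFC.sqrt B)).trace = (B * (Xᵀ * X)).trace :=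
    fun X => by
    rw [Matrix.transpose_mul, sqrt_transpose, Matrix.mul_assoc, Matrix.trace_mul_comm,
      Matrix.mul_assoc, Matrix.mul_assoc, sqrt_mul_sqrt hB.posSemidef, ← Matrix.mul_assoc,
      Matrix.trace_mul_comm]
  simp only [h1] at h
  rw [h]
  congr 2
  have hd := hB.det_pos
  rw [det_sqrt hB.posSemidef, abs_of_nonneg (Real.sqrt_nonneg _), Real.sqrt_eq_rpow,
    ← Real.rpow_natCast, ← Real.rpow_mul hd.le, ← Real.rpow_neg hd.le]
  congr 1
  ring

theorem lintegral_gaussian_left {n m : ℕ} {A : Mat n n} (hA : A.PosDef) :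
    ∫⁻ X : Mat n m, ENNReal.ofReal (Real.exp (-(Xᵀ * A * X).trace)) =
      ENNReal.ofReal (A.det ^ (-(m : ℝ) / 2)) * ENNReal.ofReal (Real.pi ^ ((n : ℝ) * m / 2)) := by
  have hF : Measurable fun X : Mat n m => ENNReal.ofReal (Real.exp (-(Xᵀ * X).trace)) :=
    (measurable_of_continuous (by fun_prop : Continuous fun X : Mat n m =>
      Real.exp (-(Xᵀ * X).trace))).ennreal_ofReal
  have h := lintegral_comp_linearMap (L := mulLeftLinearMap (Fin m) ℝ (CFC.sqrt A))
    (by rw [det_mulLeftLinearMap]; exact pow_ne_zero _ (det_sqrt_ne_zero hA)) hF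
  rw [lintegral_gaussian, det_mulLeftLinearMap] at h
  have h1 : ∀ X : Mat n m, ((CFC.sqrt A * X)ᵀ * (CFC.sqrt A * X)).trace = (Xᵀ * A * X).trace :=
    fun X => by
    rw [Matrix.transpose_mul, sqrt_transpose, Matrix.mul_assoc, ← Matrix.mul_assoc _ _ X,
      sqrt_mul_sqrt hA.posSemidef, Matrix.mul_assoc]
  simp only [mulLeftLinearMap_apply, h1] at h
  rw [h]
  congr 2
  have hd := hA.det_pos
  rw [det_sqrt hA.posSemidef, abs_inv, abs_of_nonneg (pow_nonneg (Real.sqrt_nonneg _) _),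
    Real.sqrt_eq_rpow, ← Real.rpow_natCast, ← Real.rpow_mul hd.le, ← Real.rpow_neg hd.le]
  congr 1
  ring

theorem frame_transpose_mul {n k : ℕ} (γ : Matrix.orthogonalGroup (Fin n) ℝ) :
    ((γ : Mat n n) * xi0 n k)ᵀ * ((γ : Mat n n) * xi0 n k) = 1 :=
  orthogonal_mul_xi0_mem n k γ

theorem mulVec_injective_of_transpose_mul {n l : ℕ} {G : Mat n l} (hG : Gᵀ * G = 1) :
    Function.Injective G.mulVec := by
  intro u v huv
  have h : Gᵀ *ᵥ (G *ᵥ u) = Gᵀ *ᵥ (G *ᵥ v) := congrArg _ huv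
  rwa [Matrix.mulVec_mulVec, Matrix.mulVec_mulVec, hG, Matrix.one_mulVec, Matrix.one_mulVec] at h

theorem det_one_add_frame {n l m : ℕ} {G : Mat n l} (hG : Gᵀ * G = 1) (x : Mat n m) :
    (1 + (Gᵀ * x)ᵀ * (Gᵀ * x)).det = (Gᵀ * (1 + x * xᵀ) * G).det := by
  rw [Matrix.det_one_add_mul_comm, Matrix.transpose_mul, Matrix.transpose_transpose,
    Matrix.mul_add, Matrix.add_mul, Matrix.mul_one, hG]
  simp only [Matrix.mul_assoc]

/-- The Gaussian `exp(-tr X'AX)` on `n × (n-k)` matrices is integrated in two ways. Directly it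
gives `|A|^{-(n-k)/2}`. After replacing `X` by `γ ξ₀ (X'X)^{1/2}` and averaging over `γ`, the
exponent becomes `-tr(G'AG · X'X)` with `G = γξ₀`, and the integral over `X` gives `|G'AG|^{-n/2}`.
The power of `π` is the same on both sides. -/
theorem lintegral_haarO_det_frame {n k : ℕ} {A : Mat n n} (hA : A.PosDef) :
    ∫⁻ γ : Matrix.orthogonalGroup (Fin n) ℝ, ENNReal.ofReal ((((γ : Mat n n) * xi0 n k)ᵀ * A *
      ((γ : Mat n n) * xi0 n k)).det ^ (-(n : ℝ) / 2)) ∂(haarO n) =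
      ENNReal.ofReal (A.det ^ (-((n - k : ℕ) : ℝ) / 2)) := by
  set l := n - k with hl
  set φ : Mat n l → ENNReal := fun X => ENNReal.ofReal (Real.exp (-(Xᵀ * A * X).trace)) with hφd
  have hφ : Measurable φ := (measurable_of_continuous (by fun_prop : Continuous fun X : Mat n l =>
      Real.exp (-(Xᵀ * A * X).trace))).ennreal_ofReal
  have hB : ∀ γ : Matrix.orthogonalGroup (Fin n) ℝ,
      (((γ : Mat n n) * xi0 n k)ᵀ * A * ((γ : Mat n n) * xi0 n k)).PosDef := fun γ => by
    refine Matrix.PosDef.conjTranspose_mul_mul_same hA ?_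
    exact mulVec_injective_of_transpose_mul (frame_transpose_mul γ)
  have h1 : ∫⁻ X : Mat n l, φ X = ∫⁻ γ, ENNReal.ofReal ((((γ : Mat n n) * xi0 n k)ᵀ * A *
      ((γ : Mat n n) * xi0 n k)).det ^ (-(n : ℝ) / 2)) *
        ENNReal.ofReal (Real.pi ^ ((n : ℝ) * l / 2)) ∂(haarO n) := by
    have h2 := lintegral_eq_lintegral_orbitMean (Nat.sub_le n k) hφ
      (measurable_const (a := (1 : ENNReal)))
    simp only [one_mul] at h2
    -- The section of the Gram map is exchanged for `ξ₀ (X'X)^{1/2}`, which has the same Gram matrix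
    -- and displays the frame.
    have h3 : ∀ X : Mat n l, orbitMean n φ (Xᵀ * X) =
        ∫⁻ γ, φ ((γ : Mat n n) * (xi0 n k * CFC.sqrt (Xᵀ * X))) ∂(haarO n) := fun X => by
      refine lintegral_haarO_congr ?_ hφ
      rw [gram_gramSection (Nat.sub_le n k) (gram_posSemidef X), Matrix.transpose_mul,
        Matrix.mul_assoc, ← Matrix.mul_assoc _ _ (CFC.sqrt _), xi0_mem, Matrix.one_mul,
        sqrt_transpose_mul (gram_posSemidef X)]
    rw [h2, lintegral_congr h3, lintegral_lintegral_swap]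
    · refine lintegral_congr fun γ => ?_
      rw [← lintegral_gaussian_right (hB γ)]
      refine lintegral_congr fun X => ?_
      simp only [hφd]
      congr 3
      conv_rhs => rw [← sqrt_mul_sqrt (gram_posSemidef X)]
      rw [← Matrix.mul_assoc (γ : Mat n n), Matrix.transpose_mul, sqrt_transpose]
      simp only [Matrix.mul_assoc]
      rw [Matrix.trace_mul_comm (CFC.sqrt _)]
      simp only [Matrix.mul_assoc]
    · have h4 := measurable_orthogonal_mul hφ (z := fun X : Mat n l => xi0 n k * CFC.sqrt (Xᵀ * X))
        (measurable_matMul measurable_const ((measurable_sqrt l).comp (measurable_gram n l)))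
      exact (h4.comp measurable_swap).aemeasurable
  rw [lintegral_gaussian_left hA, lintegral_mul_const' _ _ ENNReal.ofReal_ne_top] at h1
  have hpi : 0 < Real.pi ^ ((n : ℝ) * l / 2) := Real.rpow_pos_of_pos Real.pi_pos _
  exact ((ENNReal.mul_left_inj (by simpa using hpi) ENNReal.ofReal_ne_top).mp h1).symm

/-- The dual Radon transform of `|1 + t't|^{-n/2}` is `|1 + x'x|^{-(n-k)/2}`. -/
theorem lintegral_haarO_det_one_add {n k m : ℕ} (x : Mat n m) :
    ∫⁻ γ : Matrix.orthogonalGroup (Fin n) ℝ, ENNReal.ofReal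
      ((1 + (((γ : Mat n n) * xi0 n k)ᵀ * x)ᵀ * (((γ : Mat n n) * xi0 n k)ᵀ * x)).det ^
        (-(n : ℝ) / 2)) ∂(haarO n) =
      ENNReal.ofReal ((1 + xᵀ * x).det ^ (-((n - k : ℕ) : ℝ) / 2)) := by
  have hA : (1 + x * xᵀ).PosDef := by
    simpa using one_add_gram_posDef xᵀ
  rw [Matrix.det_one_add_mul_comm xᵀ x, ← lintegral_haarO_det_frame hA]
  refine lintegral_congr fun γ => ?_
  rw [det_one_add_frame (frame_transpose_mul γ)]

/-! ### Polynomial weights -/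

/-- The weight `(1 + tr x'x)^{-N}`. -/
def wt {n m : ℕ} (N : ℕ) (x : Mat n m) : ℝ := ((1 + (xᵀ * x).trace) ^ N)⁻¹

theorem wt_pos {n m : ℕ} (N : ℕ) (x : Mat n m) : 0 < wt N x := by
  have := gram_trace_nonneg x
  unfold wt
  positivity

theorem continuous_wt {n m : ℕ} (N : ℕ) : Continuous (wt (n := n) (m := m) N) := by
  unfold wt
  refine Continuous.inv₀ (by fun_prop) fun x => ?_
  have := gram_trace_nonneg x
  positivity

theorem integrable_wt {n m N : ℕ} (hN : n * m < 2 * N) : Integrable (wt (n := n) (m := m) N) := by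
  have h1 : Integrable fun v : EMat n m => ((1 : ℝ) + ‖v‖ ^ 2) ^ (-((2 * N : ℕ) : ℝ) / 2) := by
    refine integrable_rpow_neg_one_add_norm_sq ?_
    simp only [finrank_euclideanSpace, Fintype.card_prod, Fintype.card_fin]
    exact_mod_cast hN
  rw [← (measurePreserving_flatEquiv n m).integrable_comp_emb
    (flatEquiv n m).measurableEmbedding] at h1
  refine h1.congr (Eventually.of_forall fun x => ?_)
  simp only [Function.comp_apply, flatEquiv_apply, norm_flat_sq, wt]
  have := gram_trace_nonneg x
  rw [show -((2 * N : ℕ) : ℝ) / 2 = -(N : ℝ) by push_cast; ring, Real.rpow_neg (by positivity),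
    Real.rpow_natCast]

/-- With `a` and `b` the two traces, `(1 + a)(1 + b) ≤ (1 + a + b)²`; this is why the exponent is
doubled. -/
theorem wt_stack_le {n k m : ℕ} (hk : k ≤ n) (N : ℕ) (ω : Mat k m) (t : Mat (n - k) m) :
    wt (2 * N) (stack ω t : Mat n m) ≤ wt N ω * wt N t := by
  have h1 := gram_trace_nonneg ω
  have h2 := gram_trace_nonneg t
  unfold wt
  rw [gram_stack hk, Matrix.trace_add, ← mul_inv, ← mul_pow, pow_mul]
  gcongr
  nlinarith

theorem abs_gram_apply_le {n m : ℕ} (x : Mat n m) (i j : Fin m) :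
    |(xᵀ * x) i j| ≤ (xᵀ * x).trace := by
  have hd : ∀ i, (xᵀ * x) i i ≤ (xᵀ * x).trace := fun i => by
    refine Finset.single_le_sum (f := fun i => (xᵀ * x) i i) (fun j _ => ?_) (Finset.mem_univ i)
    simp only [Matrix.mul_apply, Matrix.transpose_apply]
    exact Finset.sum_nonneg fun l _ => mul_self_nonneg _
  have h : |(xᵀ * x) i j| ≤ ((xᵀ * x) i i + (xᵀ * x) j j) / 2 := by
    simp only [Matrix.mul_apply, Matrix.transpose_apply]
    rw [← Finset.sum_add_distrib, Finset.sum_div]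
    refine (Finset.abs_sum_le_sum_abs _ _).trans (Finset.sum_le_sum fun l _ => ?_)
    rw [abs_mul]
    have h1 := sq_abs (x l i)
    have h2 := sq_abs (x l j)
    nlinarith [sq_nonneg (|x l i| - |x l j|)]
  linarith [hd i, hd j]

theorem det_one_add_gram_le {n m : ℕ} (x : Mat n m) :
    (1 + xᵀ * x).det ≤ m.factorial * (1 + (xᵀ * x).trace) ^ m := by
  have h := Matrix.det_le (A := 1 + xᵀ * x) (abv := AbsoluteValue.abs)
    (x := 1 + (xᵀ * x).trace) fun i j => by
      refine (abs_add_le _ _).trans (add_le_add ?_ (abs_gram_apply_le x i j))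
      rw [Matrix.one_apply]
      split_ifs <;> simp
  simp only [AbsoluteValue.abs_apply, Fintype.card_fin, nsmul_eq_mul] at h
  exact (le_abs_self _).trans h

/-- The Leibniz formula bounds `|1 + x'x|` by `m! (1 + tr x'x)^m`, since no entry exceeds `1 + tr
x'x` in absolute value. Thus the isotropic weight is dominated by a determinantal one, whose dual
Radon transform is explicit. -/
theorem wt_le_det_rpow {n m N : ℕ} {s : ℝ} (hs : 0 ≤ s) (hN : (m : ℝ) * s ≤ N) (x : Mat n m) :
    wt N x ≤ (m.factorial : ℝ) ^ s * (1 + xᵀ * x).det ^ (-s) := by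
  have h0 := gram_trace_nonneg x
  have hd := det_one_add_gram_pos x
  have h1 : (1 + xᵀ * x).det ^ s ≤ (m.factorial : ℝ) ^ s * (1 + (xᵀ * x).trace) ^ N := by
    refine (Real.rpow_le_rpow hd.le (det_one_add_gram_le x) hs).trans ?_
    rw [Real.mul_rpow (by positivity) (by positivity)]
    gcongr
    rw [← Real.rpow_natCast, ← Real.rpow_natCast, ← Real.rpow_mul (by positivity)]
    exact Real.rpow_le_rpow_of_exponent_le (by linarith) hN
  unfold wt
  rw [Real.rpow_neg hd.le, ← div_eq_mul_inv, le_div_iff₀ (by positivity), inv_mul_le_iff₀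
    (by positivity), mul_comm]
  exact h1

/-! ### The plane measures -/

instance instPolishMat (n m : ℕ) : PolishSpace (Mat n m) :=
  inferInstanceAs (PolishSpace (Fin n → Fin m → ℝ))

theorem stack_add {n k m : ℕ} (a b : Mat k m) (c d : Mat (n - k) m) :
    (stack (a + b) (c + d) : Mat n m) = stack a c + stack b d := by
  ext i j
  simp only [stack, Matrix.of_apply, Matrix.add_apply]
  split_ifs <;> rfl

theorem continuous_stack {n k : ℕ} (m : ℕ) :
    Continuous fun p : Mat k m × Mat (n - k) m => (stack p.1 p.2 : Mat n m) := by
  refine continuous_matrix fun i j => ?_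
  simp only [stack, Matrix.of_apply]
  split_ifs
  · exact (continuous_fst.matrix_elem _ _)
  · exact (continuous_snd.matrix_elem _ _)

theorem xi0_transpose_mul_stack {n k m : ℕ} (ω : Mat k m) (t : Mat (n - k) m) :
    (xi0 n k)ᵀ * (stack ω t : Mat n m) = t := by
  ext a j
  have ha : k + (a : ℕ) < n := by omega
  have h := mul_xi0_apply (stack ω t : Mat n m)ᵀ j a ha
  rw [← Matrix.transpose_apply ((stack ω t : Mat n m)ᵀ * xi0 n k), Matrix.transpose_mul,
    Matrix.transpose_transpose] at h
  rw [h]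
  simp [stack]

theorem xi0_mul {n k m : ℕ} (t : Mat (n - k) m) :
    xi0 n k * t = (stack (0 : Mat k m) t : Mat n m) := by
  ext i j
  rw [Matrix.mul_apply]
  simp only [stack, xi0_apply, Matrix.of_apply]
  split_ifs with h
  · refine Finset.sum_eq_zero fun a _ => ?_
    rw [if_neg (by omega), zero_mul]
  · rw [Finset.sum_eq_single (⟨(i : ℕ) - k, by omega⟩ : Fin (n - k))]
    · rw [if_pos (by simp only; omega), one_mul]
    · intro a _ ha
      rw [if_neg, zero_mul]
      intro h2
      exact ha (Fin.ext (by simp only; omega))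
    · simp

/-- The frame `γ ξ₀`. -/
def frame {n : ℕ} (k : ℕ) (γ : Matrix.orthogonalGroup (Fin n) ℝ) : Stiefel n (n - k) :=
  ⟨(γ : Mat n n) * xi0 n k, orthogonal_mul_xi0_mem n k γ⟩

theorem measurable_frame (n k : ℕ) : Measurable (frame (n := n) k) :=
  Measurable.subtype_mk (measurable_matMul (measurable_coe_orthogonal n) measurable_const)

theorem stiefelMeasure_eq (n k : ℕ) : stiefelMeasure n k = (haarO n).map (frame k) := rfl

theorem exists_frame_eq {n k : ℕ} (hk : 1 ≤ k) (hkn : k ≤ n) (ξ : Stiefel n (n - k)) :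
    ∃ γ : Matrix.orthogonalGroup (Fin n) ℝ, (γ : Mat n n) = rotationTo ξ ∧ frame k γ = ξ := by
  obtain ⟨h1, h2⟩ := rotationTo_spec hk hkn ξ
  exact ⟨⟨rotationTo ξ, (Matrix.mem_specialOrthogonalGroup_iff.mp h1).1⟩, rfl, Subtype.ext h2⟩

/-- The unit cube. -/
def unitCube (l m : ℕ) : Set (Mat l m) := {t | ∀ i, (fun j => t i j) ∈ Set.univ.pi fun _ => Set.Icc 0 1}

theorem measurableSet_unitCube (l m : ℕ) : MeasurableSet (unitCube l m) :=
  measurableSet_rows fun _ => MeasurableSet.univ_pi fun _ => measurableSet_Icc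

theorem volume_unitCube (l m : ℕ) : volume (unitCube l m) = 1 := by
  have h : (volume : Measure (Fin m → ℝ)) (Set.univ.pi fun _ => Set.Icc 0 1) = 1 := by
    rw [volume_pi, Measure.pi_pi]
    simp only [Real.volume_Icc, sub_zero, ENNReal.ofReal_one, Finset.prod_const_one]
  rw [unitCube, volume_rows]
  simp only [h, Finset.prod_const_one]

/-- The parallel projection along a frame. -/
def planeMap {n l m : ℕ} (ξ : Stiefel n l) (v : Mat n m) : Mat n m := v - ξ.1 * (ξ.1ᵀ * v)

/-- The Lebesgue measure of the plane `{z : ξ'z = 0}`. -/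
def planeMeasure {n l : ℕ} (m : ℕ) (ξ : Stiefel n l) : Measure (Mat n m) :=
  (volume.restrict {v : Mat n m | ξ.1ᵀ * v ∈ unitCube l m}).map (planeMap ξ)

theorem continuous_planeMap {n l m : ℕ} (ξ : Stiefel n l) :
    Continuous (planeMap ξ : Mat n m → Mat n m) := by
  unfold planeMap
  fun_prop

/-- The parametrization `ω ↦ γ [ω; 0]` of a plane. -/
def planeParam {n k m : ℕ} (γ : Matrix.orthogonalGroup (Fin n) ℝ) (ω : Mat k m) : Mat n m :=
  (γ : Mat n n) * stack ω (0 : Mat (n - k) m)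

theorem continuous_planeParam {n k m : ℕ} (γ : Matrix.orthogonalGroup (Fin n) ℝ) :
    Continuous (planeParam γ : Mat k m → Mat n m) :=
  continuous_const.matrix_mul ((continuous_stack m).comp (continuous_id.prodMk continuous_const))

theorem orthogonal_mul_injective {n m : ℕ} (γ : Matrix.orthogonalGroup (Fin n) ℝ) :
    Function.Injective fun y : Mat n m => (γ : Mat n n) * y := by
  intro y z h
  have h2 : (γ : Mat n n)ᵀ * ((γ : Mat n n) * y) = (γ : Mat n n)ᵀ * ((γ : Mat n n) * z) :=
    congrArg _ h
  rwa [← Matrix.mul_assoc, ← Matrix.mul_assoc, orthogonal_transpose_mul, Matrix.one_mul,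
    Matrix.one_mul] at h2

theorem measurableEmbedding_planeParam {n k m : ℕ} (hk : k ≤ n)
    (γ : Matrix.orthogonalGroup (Fin n) ℝ) :
    MeasurableEmbedding (planeParam γ : Mat k m → Mat n m) := by
  refine (continuous_planeParam γ).measurableEmbedding fun a b h => ?_
  have h2 := (stackEquiv hk m).injective (a₁ := (a, 0)) (a₂ := (b, 0))
    (orthogonal_mul_injective γ h)
  exact congrArg Prod.fst h2

theorem frame_transpose_mul_stack {n k m : ℕ} (γ : Matrix.orthogonalGroup (Fin n) ℝ)
    (ω : Mat k m) (t : Mat (n - k) m) :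
    (frame k γ).1ᵀ * ((γ : Mat n n) * stack ω t) = t := by
  rw [frame, Matrix.transpose_mul, Matrix.mul_assoc, ← Matrix.mul_assoc _ (γ : Mat n n),
    orthogonal_transpose_mul, Matrix.one_mul, xi0_transpose_mul_stack]

theorem frame_mul_add_planeParam {n k m : ℕ} (γ : Matrix.orthogonalGroup (Fin n) ℝ)
    (ω : Mat k m) (t : Mat (n - k) m) :
    (frame k γ).1 * t + planeParam γ ω = (γ : Mat n n) * stack ω t := by
  rw [frame, Matrix.mul_assoc, xi0_mul, planeParam, ← Matrix.mul_add, ← stack_add, zero_add,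
    add_zero]

theorem planeMap_stack {n k m : ℕ} (γ : Matrix.orthogonalGroup (Fin n) ℝ)
    (ω : Mat k m) (t : Mat (n - k) m) :
    planeMap (frame k γ) ((γ : Mat n n) * stack ω t) = planeParam γ ω := by
  rw [planeMap, frame_transpose_mul_stack, ← frame_mul_add_planeParam, add_sub_cancel_left]

/-- In the coordinates `γ[ω; t]` the slab is the product of the space of all `ω` with the unit cube
in `t`, and the projection forgets `t`. As the cube has volume one, Lebesgue measure in `ω` remains.
-/
theorem planeMeasure_frame {n k m : ℕ} (hk : k ≤ n) (γ : Matrix.orthogonalGroup (Fin n) ℝ) :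
    planeMeasure m (frame k γ) = (volume : Measure (Mat k m)).map (planeParam γ) := by
  ext s hs
  have hm1 : Measurable (planeMap (frame k γ) : Mat n m → Mat n m) :=
    (continuous_planeMap _).measurable
  have hm2 : Measurable fun v : Mat n m => (frame k γ).1ᵀ * v :=
    measurable_of_continuous (by fun_prop)
  rw [planeMeasure, Measure.map_apply hm1 hs, Measure.restrict_apply (hm1 hs),
    Measure.map_apply (continuous_planeParam γ).measurable hs]
  have hmp := (measurePreserving_orthogonal m γ).comp (measurePreserving_stackEquiv hk m)
  have hS : MeasurableSet (planeMap (frame k γ) ⁻¹' s ∩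
      {v | (frame k γ).1ᵀ * v ∈ unitCube (n - k) m}) :=
    (hm1 hs).inter (hm2 (measurableSet_unitCube _ _))
  refine (hmp.measure_preimage hS.nullMeasurableSet).symm.trans ?_
  have h : ((fun y : Mat n m => (γ : Mat n n) * y) ∘ (stackEquiv hk m)) ⁻¹'
      (planeMap (frame k γ) ⁻¹' s ∩ {v | (frame k γ).1ᵀ * v ∈ unitCube (n - k) m}) =
      (planeParam γ ⁻¹' s) ×ˢ unitCube (n - k) m := by
    ext p
    simp only [Set.mem_preimage, Function.comp_apply, stackEquiv_apply, Set.mem_inter_iff,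
      Set.mem_ofPred_eq, planeMap_stack, frame_transpose_mul_stack, Set.mem_prod]
  refine (congrArg _ h).trans ?_
  rw [Measure.volume_eq_prod, Measure.prod_prod, volume_unitCube, mul_one]

theorem integral_planeMeasure {n k m : ℕ} (hk : k ≤ n) (γ : Matrix.orthogonalGroup (Fin n) ℝ)
    (f : Mat n m → ℂ) :
    ∫ z, f z ∂(planeMeasure m (frame k γ)) = ∫ ω : Mat k m, f (planeParam γ ω) := by
  rw [planeMeasure_frame hk, (measurableEmbedding_planeParam hk γ).integral_map]

theorem lintegral_planeMeasure {n k m : ℕ} (hk : k ≤ n) (γ : Matrix.orthogonalGroup (Fin n) ℝ)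
    (F : Mat n m → ENNReal) :
    ∫⁻ z, F z ∂(planeMeasure m (frame k γ)) = ∫⁻ ω : Mat k m, F (planeParam γ ω) := by
  rw [planeMeasure_frame hk, (measurableEmbedding_planeParam hk γ).lintegral_map]

theorem integrable_planeMeasure {n k m : ℕ} (hk : k ≤ n) (γ : Matrix.orthogonalGroup (Fin n) ℝ)
    (f : Mat n m → ℂ) :
    Integrable f (planeMeasure m (frame k γ)) ↔
      Integrable fun ω : Mat k m => f (planeParam γ ω) := by
  rw [planeMeasure_frame hk, (measurableEmbedding_planeParam hk γ).integrable_map_iff]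
  rfl

/-- `rotationTo` is an arbitrary choice with no measurability in `ξ`. Rewriting the transform with
`planeMeasure`, which depends on `ξ` alone, makes Fubini arguments in `ξ` possible. -/
theorem radon_eq {n k m : ℕ} (hk : 1 ≤ k) (hkn : k ≤ n) (f : Mat n m → ℂ) (ξ : Stiefel n (n - k))
    (t : Mat (n - k) m) : radon f ξ t = ∫ z, f (ξ.1 * t + z) ∂(planeMeasure m ξ) := by
  obtain ⟨γ, hγ, rfl⟩ := exists_frame_eq hk hkn ξ
  rw [integral_planeMeasure hkn γ fun z => f ((frame k γ).1 * t + z)]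
  simp only [frame_mul_add_planeParam, radon, hγ]

theorem integrable_radon_iff {n k m : ℕ} (hk : 1 ≤ k) (hkn : k ≤ n) (f : Mat n m → ℂ)
    (ξ : Stiefel n (n - k)) (t : Mat (n - k) m) :
    Integrable (fun ω : Mat k m => f (rotationTo ξ * stack ω t)) ↔
      Integrable (fun z => f (ξ.1 * t + z)) (planeMeasure m ξ) := by
  obtain ⟨γ, hγ, rfl⟩ := exists_frame_eq hk hkn ξ
  rw [integrable_planeMeasure hkn γ fun z => f ((frame k γ).1 * t + z)]
  simp only [frame_mul_add_planeParam, ← hγ]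

theorem measurable_planeMap {n l m : ℕ} :
    Measurable fun q : Stiefel n l × Mat n m => planeMap q.1 q.2 := by
  have h1 : Measurable fun q : Stiefel n l × Mat n m => (q.1.1 : Mat n l) :=
    measurable_subtype_coe.comp measurable_fst
  have h2 : Measurable fun q : Stiefel n l × Mat n m => (q.1.1 : Mat n l)ᵀ :=
    (measurable_of_continuous (f := fun y : Mat n l => yᵀ) (by fun_prop)).comp h1
  exact measurable_snd.sub (measurable_matMul h1 (measurable_matMul h2 measurable_snd))

theorem measurableSet_planeCube {n l m : ℕ} :
    MeasurableSet {q : Stiefel n l × Mat n m | q.1.1ᵀ * q.2 ∈ unitCube l m} := by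
  have h1 : Measurable fun q : Stiefel n l × Mat n m => (q.1.1 : Mat n l) :=
    measurable_subtype_coe.comp measurable_fst
  have h2 : Measurable fun q : Stiefel n l × Mat n m => (q.1.1 : Mat n l)ᵀ :=
    (measurable_of_continuous (f := fun y : Mat n l => yᵀ) (by fun_prop)).comp h1
  exact (measurable_matMul h2 measurable_snd) (measurableSet_unitCube l m)

theorem measurableSet_planeCube_left {n l m : ℕ} (ξ : Stiefel n l) :
    MeasurableSet {v : Mat n m | ξ.1ᵀ * v ∈ unitCube l m} :=
  (measurable_of_continuous (f := fun v : Mat n m => ξ.1ᵀ * v) (by fun_prop))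
    (measurableSet_unitCube l m)

/-- Plane integrals depend measurably on the plane. -/
theorem measurable_lintegral_planeMeasure {α : Type*} [MeasurableSpace α] {n l m : ℕ}
    {ξ : α → Stiefel n l} (hξ : Measurable ξ) {F : α → Mat n m → ENNReal}
    (hF : Measurable (Function.uncurry F)) :
    Measurable fun a => ∫⁻ z, F a z ∂(planeMeasure m (ξ a)) := by
  have h : ∀ a, ∫⁻ z, F a z ∂(planeMeasure m (ξ a)) =
      ∫⁻ v, {q : Stiefel n l × Mat n m | q.1.1ᵀ * q.2 ∈ unitCube l m}.indicator
        (fun q => F a (planeMap q.1 q.2)) (ξ a, v) := fun a => by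
    have hFa : Measurable fun z => F a z := hF.comp (measurable_const.prodMk measurable_id)
    rw [planeMeasure, lintegral_map hFa (continuous_planeMap (ξ a)).measurable,
      ← lintegral_indicator (measurableSet_planeCube_left (ξ a))]
    rfl
  simp only [h]
  have h1 : Measurable fun p : α × Mat n m => (ξ p.1, p.2) :=
    (hξ.comp measurable_fst).prodMk measurable_snd
  have h2 : Measurable fun p : α × Mat n m => F p.1 (planeMap (ξ p.1) p.2) :=
    hF.comp (measurable_fst.prodMk (measurable_planeMap.comp h1))
  have h3 := h2.indicator (h1 measurableSet_planeCube)
  exact h3.lintegral_prod_right'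

theorem stronglyMeasurable_integral_planeMeasure {α : Type*} [MeasurableSpace α] {n l m : ℕ}
    {ξ : α → Stiefel n l} (hξ : Measurable ξ) {F : α → Mat n m → ℂ}
    (hF : Measurable (Function.uncurry F)) :
    StronglyMeasurable fun a => ∫ z, F a z ∂(planeMeasure m (ξ a)) := by
  have h : ∀ a, ∫ z, F a z ∂(planeMeasure m (ξ a)) =
      ∫ v, {q : Stiefel n l × Mat n m | q.1.1ᵀ * q.2 ∈ unitCube l m}.indicator
        (fun q => F a (planeMap q.1 q.2)) (ξ a, v) := fun a => by
    have hFa : Measurable fun z => F a z := hF.comp (measurable_const.prodMk measurable_id)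
    rw [planeMeasure, integral_map (continuous_planeMap (ξ a)).measurable.aemeasurable
      hFa.aestronglyMeasurable,
      ← integral_indicator (measurableSet_planeCube_left (ξ a))]
    rfl
  simp only [h]
  have h1 : Measurable fun p : α × Mat n m => (ξ p.1, p.2) :=
    (hξ.comp measurable_fst).prodMk measurable_snd
  have h2 : Measurable fun p : α × Mat n m => F p.1 (planeMap (ξ p.1) p.2) :=
    hF.comp (measurable_fst.prodMk (measurable_planeMap.comp h1))
  have h3 := h2.indicator (h1 measurableSet_planeCube)
  exact h3.stronglyMeasurable.integral_prod_right'

/-- The component of `x` along the plane is a translation of the parameter `ω`, invisible to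
Lebesgue measure; only `ξ'x` matters. -/
theorem frame_shift {n k m : ℕ} (hk : k ≤ n) (γ : Matrix.orthogonalGroup (Fin n) ℝ)
    (x : Mat n m) : ∃ ω₀ : Mat k m, ∀ ω, x + planeParam γ ω =
      (frame k γ).1 * ((frame k γ).1ᵀ * x) + planeParam γ (ω₀ + ω) := by
  obtain ⟨⟨ω₀, t⟩, h⟩ := (stackEquiv hk m).surjective ((γ : Mat n n)ᵀ * x)
  have hx : x = (γ : Mat n n) * stack ω₀ t := by
    rw [← stackEquiv_apply hk (ω₀, t), h, ← Matrix.mul_assoc, orthogonal_mul_transpose,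
      Matrix.one_mul]
  refine ⟨ω₀, fun ω => ?_⟩
  rw [hx, frame_transpose_mul_stack, frame_mul_add_planeParam, planeParam, ← Matrix.mul_add,
    ← stack_add, add_zero]

theorem integral_planeMeasure_shift {n k m : ℕ} (hk : k ≤ n)
    (γ : Matrix.orthogonalGroup (Fin n) ℝ) (f : Mat n m → ℂ) (x : Mat n m) :
    ∫ z, f ((frame k γ).1 * ((frame k γ).1ᵀ * x) + z) ∂(planeMeasure m (frame k γ)) =
      ∫ ω : Mat k m, f (x + planeParam γ ω) := by
  obtain ⟨ω₀, h⟩ := frame_shift (m := m) hk γ x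
  rw [integral_planeMeasure hk γ fun z => f ((frame k γ).1 * ((frame k γ).1ᵀ * x) + z)]
  simp only [h]
  rw [integral_add_left_eq_self (fun ω : Mat k m =>
    f ((frame k γ).1 * ((frame k γ).1ᵀ * x) + planeParam γ ω)) ω₀]

theorem lintegral_planeMeasure_shift {n k m : ℕ} (hk : k ≤ n)
    (γ : Matrix.orthogonalGroup (Fin n) ℝ) (F : Mat n m → ENNReal) (x : Mat n m) :
    ∫⁻ z, F ((frame k γ).1 * ((frame k γ).1ᵀ * x) + z) ∂(planeMeasure m (frame k γ)) =
      ∫⁻ ω : Mat k m, F (x + planeParam γ ω) := by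
  obtain ⟨ω₀, h⟩ := frame_shift (m := m) hk γ x
  rw [lintegral_planeMeasure hk γ fun z => F ((frame k γ).1 * ((frame k γ).1ᵀ * x) + z)]
  simp only [h]
  rw [lintegral_add_left_eq_self (fun ω : Mat k m =>
    F ((frame k γ).1 * ((frame k γ).1ᵀ * x) + planeParam γ ω)) ω₀]

theorem measurable_planeParam {n k : ℕ} (hk : k ≤ n) (m : ℕ) :
    Measurable fun q : Matrix.orthogonalGroup (Fin n) ℝ × Mat k m => (planeParam q.1 q.2 : Mat n m) :=
  measurable_matMul ((measurable_coe_orthogonal n).comp measurable_fst)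
    ((measurable_stack_zero_right hk m).comp measurable_snd)

/-! ### The mean plane measure and the weighted estimates for plane integrals -/

/-- The average over all rotations of the Lebesgue measures of the planes `γ [ω; 0]`. The operator
`f ↦ (f̂)^∨` is the convolution with this measure. -/
def meanPlaneMeasure (n m k : ℕ) : Measure (Mat n m) :=
  ((haarO n).prod (volume : Measure (Mat k m))).map fun q => planeParam q.1 q.2

instance instSFiniteMeanPlane (n m k : ℕ) : SFinite (meanPlaneMeasure n m k) := by
  unfold meanPlaneMeasure
  infer_instance

theorem lintegral_meanPlane {n m k : ℕ} (hk : k ≤ n) {F : Mat n m → ENNReal} (hF : Measurable F) :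
    ∫⁻ z, F z ∂(meanPlaneMeasure n m k) =
      ∫⁻ γ, (∫⁻ ω : Mat k m, F (planeParam γ ω)) ∂(haarO n) := by
  rw [meanPlaneMeasure, lintegral_map hF (measurable_planeParam hk m)]
  exact lintegral_prod _ (hF.comp (measurable_planeParam hk m)).aemeasurable

/-- For each fixed second coordinate the map is a translation, which preserves null sets; Fubini
concludes. This lets almost everywhere identities survive convolution with `ν`. -/
theorem quasiMeasurePreserving_add {n m : ℕ} {α : Type*} [MeasurableSpace α] (ν : Measure α)
    [SFinite ν] {u : α → Mat n m} (hu : Measurable u) :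
    Measure.QuasiMeasurePreserving (fun q : Mat n m × α => q.1 + u q.2)
      (volume.prod ν) volume := by
  have hm : Measurable fun q : Mat n m × α => q.1 + u q.2 :=
    measurable_fst.add (hu.comp measurable_snd)
  refine ⟨hm, Measure.AbsolutelyContinuous.mk fun s hs h0 => ?_⟩
  rw [Measure.map_apply hm hs, Measure.prod_apply_symm (hm hs)]
  refine (lintegral_congr fun z => ?_).trans lintegral_zero
  have : (fun x : Mat n m => (x, z)) ⁻¹' ((fun q : Mat n m × α => q.1 + u q.2) ⁻¹' s) =
      (fun x => x + u z) ⁻¹' s := rfl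
  rw [this, measure_preimage_add_right, h0]

theorem measurable_wt {n m : ℕ} (N : ℕ) : Measurable (wt (n := n) (m := m) N) :=
  measurable_of_continuous (continuous_wt N)

theorem wt_orthogonal_mul {n m : ℕ} (N : ℕ) (γ : Matrix.orthogonalGroup (Fin n) ℝ) (y : Mat n m) :
    wt N ((γ : Mat n n) * y) = wt N y := by
  rw [wt, gram_orthogonal_mul, wt]

theorem wt_le_one {n m : ℕ} (N : ℕ) (x : Mat n m) : wt N x ≤ 1 := by
  have := gram_trace_nonneg x
  unfold wt
  exact inv_le_one_of_one_le₀ (one_le_pow₀ (by linarith))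

/-- Integration over all planes parallel to a fixed direction exhausts the space. -/
theorem lintegral_lintegral_stack {n m k : ℕ} (hk : k ≤ n) (γ : Matrix.orthogonalGroup (Fin n) ℝ)
    {F : Mat n m → ENNReal} (hF : Measurable F) :
    ∫⁻ t : Mat (n - k) m, ∫⁻ ω : Mat k m, F ((γ : Mat n n) * stack ω t) = ∫⁻ y, F y := by
  have hmp := (measurePreserving_orthogonal m γ).comp (measurePreserving_stackEquiv hk m)
  rw [← hmp.lintegral_comp hF]
  exact (lintegral_prod_symm _ (hF.comp hmp.measurable).aemeasurable).symm

theorem measurable_stack_prod {n k : ℕ} (hk : k ≤ n) (m : ℕ) :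
    Measurable fun p : Mat k m × Mat (n - k) m => (stack p.1 p.2 : Mat n m) :=
  (stackEquiv hk m).measurable

theorem frame_transpose_mul_stack' {n k m : ℕ} (γ : Matrix.orthogonalGroup (Fin n) ℝ)
    (ω : Mat k m) (t : Mat (n - k) m) :
    ((γ : Mat n n) * xi0 n k)ᵀ * ((γ : Mat n n) * stack ω t) = t :=
  frame_transpose_mul_stack γ ω t

/-- The weight in `t` is dominated by a multiple of `|1 + t't|^{-n/2}`, whose dual Radon transform
is known exactly. -/
theorem lintegral_wt_frame_le {n m k N : ℕ} (hN : m * n ≤ 2 * N) (y : Mat n m) :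
    ∫⁻ γ : Matrix.orthogonalGroup (Fin n) ℝ,
      ENNReal.ofReal (wt N (((γ : Mat n n) * xi0 n k)ᵀ * y)) ∂(haarO n) ≤
      ENNReal.ofReal ((m.factorial : ℝ) ^ ((n : ℝ) / 2)) *
        ENNReal.ofReal ((1 + yᵀ * y).det ^ (-((n - k : ℕ) : ℝ) / 2)) := by
  rw [← lintegral_haarO_det_one_add, ← lintegral_const_mul' _ _ ENNReal.ofReal_ne_top]
  refine lintegral_mono fun γ => ?_
  rw [← ENNReal.ofReal_mul (by positivity)]
  refine ENNReal.ofReal_le_ofReal ?_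
  have hN' : (m : ℝ) * ((n : ℝ) / 2) ≤ N := by
    have : ((m * n : ℕ) : ℝ) ≤ ((2 * N : ℕ) : ℝ) := by exact_mod_cast hN
    push_cast at this
    linarith
  have := wt_le_det_rpow (by positivity) hN' (((γ : Mat n n) * xi0 n k)ᵀ * y)
  rwa [show -(n : ℝ) / 2 = -((n : ℝ) / 2) by ring]

/-- The weighted Hölder estimate behind the existence of the Radon transform. -/
theorem lintegral_mul_wt_frame_lt_top {n m k N : ℕ} (hm : 1 ≤ m) (hk : 1 ≤ k) (hkn : k + m ≤ n)
    {p : ℝ} (hp1 : 1 ≤ p) (hp : p < (n : ℝ) / ((k : ℝ) + m - 1)) {f : Mat n m → ℂ}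
    (hf : MemLp f (ENNReal.ofReal p) volume) (hN : m * n ≤ 2 * N) :
    ∫⁻ y : Mat n m, ‖f y‖ₑ * ∫⁻ γ : Matrix.orthogonalGroup (Fin n) ℝ,
      ENNReal.ofReal (wt N (((γ : Mat n n) * xi0 n k)ᵀ * y)) ∂(haarO n) < ⊤ := by
  have hp0 : ENNReal.ofReal p ≠ 0 := by
    rw [Ne, ENNReal.ofReal_eq_zero]; linarith
  have hfin : ∫⁻ y, ‖f y‖ₑ ^ p < ⊤ := by
    have := lintegral_rpow_enorm_lt_top_of_eLpNorm_lt_top hp0 ENNReal.ofReal_ne_top hf.2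
    rwa [ENNReal.toReal_ofReal (by linarith)] at this
  have hnk : ((n - k : ℕ) : ℝ) = n - k := by
    rw [Nat.cast_sub (by omega)]
  rcases hp1.eq_or_lt with rfl | hp1'
  -- For `p = 1` the conjugate exponent is infinite, and the bound of the averaged weight by `1`
  -- suffices.
  · refine lt_of_le_of_lt (lintegral_mono fun y => ?_) hfin
    rw [ENNReal.rpow_one]
    refine mul_le_of_le_one_right' ((lintegral_mono fun γ =>
      ENNReal.ofReal_le_one.mpr (wt_le_one N _)).trans ?_)
    rw [lintegral_const, one_mul, measure_univ]
  · have h1 : ∫⁻ y : Mat n m, ‖f y‖ₑ *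
        ENNReal.ofReal ((1 + yᵀ * y).det ^ (-((n - k : ℕ) : ℝ) / 2)) < ⊤ := by
      have hpq := Real.HolderConjugate.conjExponent hp1'
      set q := p.conjExponent with hq
      have hmeas : Measurable fun y : Mat n m =>
          ENNReal.ofReal ((1 + yᵀ * y).det ^ (-((n - k : ℕ) : ℝ) / 2)) :=
        ((measurable_of_continuous (by fun_prop : Continuous fun y : Mat n m =>
          (1 + yᵀ * y).det)).pow_const _).ennreal_ofReal
      refine lt_of_le_of_lt (ENNReal.lintegral_mul_le_Lp_mul_Lq volume hpq hf.1.enorm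
        hmeas.aemeasurable) ?_
      refine ENNReal.mul_lt_top (ENNReal.rpow_lt_top_of_nonneg (by positivity) hfin.ne) ?_
      refine ENNReal.rpow_lt_top_of_nonneg (by have := hpq.symm.pos; positivity) ?_
      -- In terms of `p` this condition reads `p(k + m - 1) < n + m - 1`, which follows from `p(k +
      -- m - 1) < n` since `m ≥ 1`.
      have hs : (n : ℝ) + m - 1 < ((n - k : ℕ) : ℝ) * q := by
        have hk1 : (1 : ℝ) ≤ k := by exact_mod_cast hk
        have hm1 : (1 : ℝ) ≤ m := by exact_mod_cast hm
        have hkm : (0 : ℝ) < (k : ℝ) + m - 1 := by linarith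
        rw [lt_div_iff₀ hkm] at hp
        rw [hnk, hq, Real.conjExponent, ← mul_div_assoc, lt_div_iff₀ (by linarith)]
        nlinarith
      have := lintegral_det_one_add_gram_lt_top (m := m) n hs
      refine ne_of_lt (lt_of_le_of_lt (le_of_eq ?_) this)
      refine lintegral_congr fun y => ?_
      have hd := det_one_add_gram_pos y
      rw [ENNReal.ofReal_rpow_of_pos (by positivity), ← Real.rpow_mul hd.le]
      congr 2
      ring
    refine lt_of_le_of_lt (lintegral_mono (g := fun y : Mat n m =>
      ENNReal.ofReal ((m.factorial : ℝ) ^ ((n : ℝ) / 2)) * (‖f y‖ₑ *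
        ENNReal.ofReal ((1 + yᵀ * y).det ^ (-((n - k : ℕ) : ℝ) / 2)))) fun y => ?_) ?_
    · refine (mul_le_mul_right (lintegral_wt_frame_le hN y) _).trans (le_of_eq (by ring))
    · rw [lintegral_const_mul' _ _ ENNReal.ofReal_ne_top]
      exact ENNReal.mul_lt_top ENNReal.ofReal_lt_top h1

/-- Local integrability of the Radon transform in `t`. -/
theorem lintegral_wt_radon_lt_top {n m k N : ℕ} (hm : 1 ≤ m) (hk : 1 ≤ k) (hkn : k + m ≤ n) {p : ℝ}
    (hp1 : 1 ≤ p) (hp : p < (n : ℝ) / ((k : ℝ) + m - 1)) {f : Mat n m → ℂ} (hfm : Measurable f)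
    (hf : MemLp f (ENNReal.ofReal p) volume) (hN : m * n ≤ 2 * N) :
    ∫⁻ γ : Matrix.orthogonalGroup (Fin n) ℝ, (∫⁻ t : Mat (n - k) m, ENNReal.ofReal (wt N t) *
      ∫⁻ ω : Mat k m, ‖f ((γ : Mat n n) * stack ω t)‖ₑ) ∂(haarO n) < ⊤ := by
  have hk' : k ≤ n := by omega
  have hfr : Measurable fun q : Matrix.orthogonalGroup (Fin n) ℝ × Mat n m =>
      ((q.1 : Mat n n) * xi0 n k)ᵀ * q.2 :=
    measurable_matMul ((measurable_of_continuous (f := fun y : Mat n (n - k) => yᵀ)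
      (by fun_prop)).comp ((measurable_matMul (measurable_coe_orthogonal n)
        measurable_const).comp measurable_fst)) measurable_snd
  have hG : Measurable fun q : Matrix.orthogonalGroup (Fin n) ℝ × Mat n m =>
      ‖f q.2‖ₑ * ENNReal.ofReal (wt N (((q.1 : Mat n n) * xi0 n k)ᵀ * q.2)) :=
    (hfm.comp measurable_snd).enorm.mul ((measurable_wt N).comp hfr).ennreal_ofReal
  have h1 : ∀ γ : Matrix.orthogonalGroup (Fin n) ℝ,
      ∫⁻ t : Mat (n - k) m, ENNReal.ofReal (wt N t) *
        ∫⁻ ω : Mat k m, ‖f ((γ : Mat n n) * stack ω t)‖ₑ =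
      ∫⁻ y : Mat n m, ‖f y‖ₑ * ENNReal.ofReal (wt N (((γ : Mat n n) * xi0 n k)ᵀ * y)) := fun γ => by
    have hGγ : Measurable fun y : Mat n m =>
        ‖f y‖ₑ * ENNReal.ofReal (wt N (((γ : Mat n n) * xi0 n k)ᵀ * y)) :=
      hG.comp (measurable_const.prodMk measurable_id)
    rw [← lintegral_lintegral_stack hk' γ hGγ]
    refine lintegral_congr fun t => ?_
    rw [← lintegral_const_mul' _ _ ENNReal.ofReal_ne_top]
    refine lintegral_congr fun ω => ?_
    rw [frame_transpose_mul_stack', mul_comm]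
  simp only [h1]
  rw [lintegral_lintegral_swap hG.aemeasurable]
  refine lt_of_le_of_lt (le_of_eq (lintegral_congr fun y => ?_))
    (lintegral_mul_wt_frame_lt_top hm hk hkn hp1 hp hf hN)
  exact lintegral_const_mul' _ _ enorm_ne_top

/-- In the coordinates `x = γ[ω₀; t]` the inner integral does not depend on `ω₀`, by translation.
The doubled weight splits into a factor integrable in `ω₀` and a factor left in `t`. -/
theorem lintegral_wt_plane_le {n m k N : ℕ} (hk : k ≤ n) (hN1 : k * m < 2 * N)
    {F : Mat n m → ENNReal} (hF : Measurable F) (γ : Matrix.orthogonalGroup (Fin n) ℝ) :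
    ∫⁻ x : Mat n m, ∫⁻ ω : Mat k m, ENNReal.ofReal (wt (2 * N) x) * F (x + planeParam γ ω) ≤
      (∫⁻ ω : Mat k m, ENNReal.ofReal (wt N ω)) *
        ∫⁻ t : Mat (n - k) m, ENNReal.ofReal (wt N t) *
          ∫⁻ ω : Mat k m, F ((γ : Mat n n) * stack ω t) := by
  have hB : ∫⁻ ω : Mat k m, ENNReal.ofReal (wt N ω) < ⊤ :=
    (integrable_wt hN1).lintegral_lt_top
  have h : Measurable fun q : Mat n m × Mat k m =>
      ENNReal.ofReal (wt (2 * N) q.1) * F (q.1 + planeParam γ q.2) :=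
    ((measurable_wt (2 * N)).comp measurable_fst).ennreal_ofReal.mul
      (hF.comp (measurable_fst.add ((continuous_planeParam γ).measurable.comp measurable_snd)))
  have hFγ : Measurable fun x : Mat n m =>
      ∫⁻ ω : Mat k m, ENNReal.ofReal (wt (2 * N) x) * F (x + planeParam γ ω) :=
    h.lintegral_prod_right'
  rw [← lintegral_lintegral_stack hk γ hFγ, ← lintegral_const_mul' _ _ hB.ne]
  refine lintegral_mono fun t => ?_
  rw [← mul_assoc, mul_comm (∫⁻ ω : Mat k m, ENNReal.ofReal (wt N ω)), mul_assoc,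
    ← lintegral_mul_const'' _ (measurable_wt N).ennreal_ofReal.aemeasurable,
    ← lintegral_const_mul' _ _ ENNReal.ofReal_ne_top]
  refine lintegral_mono fun ω₀ => ?_
  rw [lintegral_const_mul' _ _ ENNReal.ofReal_ne_top, ← mul_assoc,
    ← ENNReal.ofReal_mul (wt_pos N t).le]
  refine mul_le_mul' (ENNReal.ofReal_le_ofReal ?_) (le_of_eq ?_)
  · rw [wt_orthogonal_mul, mul_comm (wt N t)]
    exact wt_stack_le hk N ω₀ t
  · rw [← lintegral_add_left_eq_self (fun ω : Mat k m => F ((γ : Mat n n) * stack ω t)) ω₀]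
    refine lintegral_congr fun ω => ?_
    rw [planeParam, ← Matrix.mul_add, ← stack_add, add_zero]

theorem lintegral_mul_meanPlane {n m k : ℕ} (hk : k ≤ n) {W F : Mat n m → ENNReal}
    (hW : Measurable W) (hF : Measurable F) :
    ∫⁻ x : Mat n m, W x * ∫⁻ z, F (x + z) ∂(meanPlaneMeasure n m k) =
      ∫⁻ γ, (∫⁻ x : Mat n m, ∫⁻ ω : Mat k m, W x * F (x + planeParam γ ω)) ∂(haarO n) := by
  have hpp := measurable_planeParam hk m
  have hF2 : Measurable fun q : Mat n m × Matrix.orthogonalGroup (Fin n) ℝ =>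
      ∫⁻ ω : Mat k m, W q.1 * F (q.1 + planeParam q.2 ω) := by
    have h : Measurable fun q : (Mat n m × Matrix.orthogonalGroup (Fin n) ℝ) × Mat k m =>
        W q.1.1 * F (q.1.1 + planeParam q.1.2 q.2) :=
      (hW.comp (measurable_fst.comp measurable_fst)).mul
        (hF.comp ((measurable_fst.comp measurable_fst).add
          (hpp.comp ((measurable_snd.comp measurable_fst).prodMk measurable_snd))))
    exact h.lintegral_prod_right'
  rw [← lintegral_lintegral_swap hF2.aemeasurable]
  refine lintegral_congr fun x => ?_
  have hx : Measurable fun γ : Matrix.orthogonalGroup (Fin n) ℝ =>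
      ∫⁻ ω : Mat k m, F (x + planeParam γ ω) := by
    have h : Measurable fun q : Matrix.orthogonalGroup (Fin n) ℝ × Mat k m =>
        F (x + planeParam q.1 q.2) := hF.comp (measurable_const.add hpp)
    exact h.lintegral_prod_right'
  rw [lintegral_meanPlane hk (F := fun z => F (x + z))
    (hF.comp (measurable_const.add measurable_id)), ← lintegral_const_mul'' _ hx.aemeasurable]
  refine lintegral_congr fun γ => ?_
  have hx2 : Measurable fun ω : Mat k m => F (x + planeParam γ ω) :=
    hF.comp (measurable_const.add (continuous_planeParam γ).measurable)
  rw [← lintegral_const_mul'' _ hx2.aemeasurable]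

/-- The convolution of `|f|` with the mean plane measure is locally integrable, with polynomial
growth on average. -/
theorem lintegral_wt_conv_lt_top {n m k N : ℕ} (hm : 1 ≤ m) (hk : 1 ≤ k) (hkn : k + m ≤ n) {p : ℝ}
    (hp1 : 1 ≤ p) (hp : p < (n : ℝ) / ((k : ℝ) + m - 1)) {f : Mat n m → ℂ} (hfm : Measurable f)
    (hf : MemLp f (ENNReal.ofReal p) volume) (hN : m * n ≤ N) (hN1 : k * m < 2 * N) :
    ∫⁻ x : Mat n m, ENNReal.ofReal (wt (2 * N) x) *
      ∫⁻ z, ‖f (x + z)‖ₑ ∂(meanPlaneMeasure n m k) < ⊤ := by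
  have hk' : k ≤ n := by omega
  have hA := lintegral_wt_radon_lt_top hm hk hkn hp1 hp hfm hf (N := N) (by omega)
  have hB : ∫⁻ ω : Mat k m, ENNReal.ofReal (wt N ω) < ⊤ :=
    (integrable_wt hN1).lintegral_lt_top
  rw [lintegral_mul_meanPlane hk' (measurable_wt (2 * N)).ennreal_ofReal hfm.enorm]
  refine lt_of_le_of_lt (lintegral_mono fun γ =>
    lintegral_wt_plane_le hk' hN1 hfm.enorm γ) ?_
  rw [lintegral_const_mul' _ _ hB.ne]
  exact ENNReal.mul_lt_top hB hA

/-! ### Passage to the Stiefel manifold; the dual transform as a convolution -/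

theorem indicator_lintegral_ae {α : Type*} [MeasurableSpace α] {ν : Measure α} {E : Type*}
    [MeasurableSpace E] {S : Set E} (hS : MeasurableSet S) {u : α → E} (hu : Measurable u) :
    ∫⁻ z, S.indicator 1 (u z) ∂ν = 0 ↔ ∀ᵐ z ∂ν, u z ∉ S := by
  refine (lintegral_eq_zero_iff ((measurable_one.indicator hS).comp hu)).trans ?_
  refine eventually_congr (Eventually.of_forall fun z => ?_)
  by_cases h : u z ∈ S <;> simp [h]

theorem frame_map_prod {n k m : ℕ} :
    (stiefelMeasure n k).prod (volume : Measure (Mat (n - k) m)) =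
      ((haarO n).prod volume).map (Prod.map (frame k) id) := by
  rw [stiefelMeasure_eq, ← Measure.map_prod_map _ _ (measurable_frame n k) measurable_id,
    Measure.map_id]

theorem measurable_stiefel_mul {α : Type*} [MeasurableSpace α] {n l m : ℕ} {ξ : α → Stiefel n l}
    (hξ : Measurable ξ) {t : α → Mat l m} (ht : Measurable t) :
    Measurable fun a => (ξ a).1 * t a :=
  measurable_matMul (measurable_subtype_coe.comp hξ) ht

theorem measurable_stiefel_transpose_mul {α : Type*} [MeasurableSpace α] {n l m : ℕ}
    {ξ : α → Stiefel n l} (hξ : Measurable ξ) {x : α → Mat n m} (hx : Measurable x) :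
    Measurable fun a => (ξ a).1ᵀ * x a :=
  measurable_matMul ((measurable_of_continuous (f := fun y : Mat n l => yᵀ) (by fun_prop)).comp
    (measurable_subtype_coe.comp hξ)) hx

theorem measurable_lintegral_stack {n k m : ℕ} (hk : k ≤ n) {F : Mat n m → ENNReal}
    (hF : Measurable F) :
    Measurable fun q : Matrix.orthogonalGroup (Fin n) ℝ × Mat (n - k) m =>
      ∫⁻ ω : Mat k m, F ((q.1 : Mat n n) * stack ω q.2) := by
  have h : Measurable fun q : (Matrix.orthogonalGroup (Fin n) ℝ × Mat (n - k) m) × Mat k m =>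
      F ((q.1.1 : Mat n n) * stack q.2 q.1.2) :=
    hF.comp (measurable_matMul ((measurable_coe_orthogonal n).comp
      (measurable_fst.comp measurable_fst)) ((measurable_stack_prod hk m).comp
        (measurable_snd.prodMk (measurable_snd.comp measurable_fst))))
  exact h.lintegral_prod_right'

theorem lintegral_planeMeasure_translate {n k m : ℕ} (hk : k ≤ n)
    (γ : Matrix.orthogonalGroup (Fin n) ℝ) (F : Mat n m → ENNReal) (t : Mat (n - k) m) :
    ∫⁻ z, F ((frame k γ).1 * t + z) ∂(planeMeasure m (frame k γ)) =
      ∫⁻ ω : Mat k m, F ((γ : Mat n n) * stack ω t) := by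
  rw [lintegral_planeMeasure hk γ fun z => F ((frame k γ).1 * t + z)]
  simp only [frame_mul_add_planeParam]

theorem measurable_lintegral_translate {α : Type*} [MeasurableSpace α] {n l m : ℕ}
    {ξ : α → Stiefel n l} (hξ : Measurable ξ) {x : α → Mat n m} (hx : Measurable x)
    {F : Mat n m → ENNReal} (hF : Measurable F) :
    Measurable fun a => ∫⁻ z, F (x a + z) ∂(planeMeasure m (ξ a)) :=
  measurable_lintegral_planeMeasure hξ (F := fun a z => F (x a + z))
    (hF.comp ((hx.comp measurable_fst).add measurable_snd))

/-- Almost everywhere finiteness of plane integrals passes to the Stiefel manifold. -/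
theorem ae_stiefel_prod_of_ae {n k m : ℕ} (hk : k ≤ n) {F : Mat n m → ENNReal} (hF : Measurable F)
    {A : Set ENNReal} (hA : MeasurableSet A)
    (h : ∀ᵐ q : Matrix.orthogonalGroup (Fin n) ℝ × Mat (n - k) m ∂((haarO n).prod volume),
      (∫⁻ ω : Mat k m, F ((q.1 : Mat n n) * stack ω q.2)) ∈ A) :
    ∀ᵐ q : Stiefel n (n - k) × Mat (n - k) m ∂((stiefelMeasure n k).prod volume),
      (∫⁻ z, F (q.1.1 * q.2 + z) ∂(planeMeasure m q.1)) ∈ A := by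
  have hm : Measurable fun q : Stiefel n (n - k) × Mat (n - k) m =>
      ∫⁻ z, F (q.1.1 * q.2 + z) ∂(planeMeasure m q.1) :=
    measurable_lintegral_translate measurable_fst
      (measurable_stiefel_mul measurable_fst measurable_snd) hF
  rw [frame_map_prod, ae_map_iff
    ((measurable_frame n k).prodMap measurable_id).aemeasurable (hm hA)]
  filter_upwards [h] with q hq
  rw [← lintegral_planeMeasure_translate hk q.1 F q.2] at hq
  exact hq

theorem ae_stiefel_of_ae {n k m : ℕ} (hk : k ≤ n) {F : Mat n m → ENNReal} (hF : Measurable F)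
    (x : Mat n m) {A : Set ENNReal} (hA : MeasurableSet A)
    (h : ∀ᵐ γ ∂(haarO n), (∫⁻ ω : Mat k m, F (x + planeParam γ ω)) ∈ A) :
    ∀ᵐ ξ ∂(stiefelMeasure n k),
      (∫⁻ z, F (ξ.1 * (ξ.1ᵀ * x) + z) ∂(planeMeasure m ξ)) ∈ A := by
  have hm : Measurable fun ξ : Stiefel n (n - k) =>
      ∫⁻ z, F (ξ.1 * (ξ.1ᵀ * x) + z) ∂(planeMeasure m ξ) :=
    measurable_lintegral_translate measurable_id
      (measurable_stiefel_mul measurable_id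
        (measurable_stiefel_transpose_mul measurable_id measurable_const)) hF
  rw [stiefelMeasure_eq, ae_map_iff (measurable_frame n k).aemeasurable (hm hA)]
  filter_upwards [h] with γ hγ
  rw [← lintegral_planeMeasure_shift hk γ F x] at hγ
  exact hγ

/-- Integrating the indicator of `S` over all parallel planes gives the volume of `S`, so almost
every plane meets `S` in a null set and `f` may be replaced there by `f₀`. Integrability of `f₀`
over almost every plane follows from the weighted bound, the weight being positive. -/
theorem radon_integrable_ae {n m k : ℕ} (hm : 1 ≤ m) (hk : 1 ≤ k) (hkn : k + m ≤ n) {p : ℝ}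
    (hp1 : 1 ≤ p) (hp : p < (n : ℝ) / ((k : ℝ) + m - 1)) {f f₀ : Mat n m → ℂ}
    (hfm : Measurable f₀) (hf : MemLp f₀ (ENNReal.ofReal p) volume) {S : Set (Mat n m)}
    (hS : MeasurableSet S) (hS0 : volume S = 0) (hfS : ∀ x ∉ S, f x = f₀ x) :
    ∀ᵐ q : Stiefel n (n - k) × Mat (n - k) m ∂((stiefelMeasure n k).prod volume),
      Integrable (fun ω : Mat k m => f (rotationTo q.1 * stack ω q.2)) := by
  have hk' : k ≤ n := by omega
  have hSm : Measurable (S.indicator (1 : Mat n m → ENNReal)) := measurable_one.indicator hS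
  have h1 := ae_stiefel_prod_of_ae hk' hSm (A := {0}) (measurableSet_singleton 0) (by
    have hmeas := measurable_lintegral_stack (k := k) hk' hSm
    have h0 : ∫⁻ q : Matrix.orthogonalGroup (Fin n) ℝ × Mat (n - k) m,
        (∫⁻ ω : Mat k m, S.indicator 1 ((q.1 : Mat n n) * stack ω q.2)) ∂((haarO n).prod volume)
        = 0 := by
      rw [lintegral_prod _ hmeas.aemeasurable]
      refine (lintegral_congr fun γ => ?_).trans lintegral_zero
      rw [lintegral_lintegral_stack hk' γ hSm, lintegral_indicator_one hS, hS0]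
    rw [lintegral_eq_zero_iff hmeas] at h0
    exact h0)
  have h2 := ae_stiefel_prod_of_ae hk' hfm.enorm (A := Set.Iio ⊤) measurableSet_Iio (by
    have hmeas := measurable_lintegral_stack (k := k) hk' hfm.enorm
    have hfin := lintegral_wt_radon_lt_top hm hk hkn hp1 hp hfm hf (N := m * n) (by omega)
    have hmeas2 : Measurable fun q : Matrix.orthogonalGroup (Fin n) ℝ × Mat (n - k) m =>
        ENNReal.ofReal (wt (m * n) q.2) *
          ∫⁻ ω : Mat k m, ‖f₀ ((q.1 : Mat n n) * stack ω q.2)‖ₑ :=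
      ((measurable_wt _).comp measurable_snd).ennreal_ofReal.mul hmeas
    rw [← lintegral_prod (fun q : Matrix.orthogonalGroup (Fin n) ℝ × Mat (n - k) m =>
        ENNReal.ofReal (wt (m * n) q.2) *
          ∫⁻ ω : Mat k m, ‖f₀ ((q.1 : Mat n n) * stack ω q.2)‖ₑ) hmeas2.aemeasurable] at hfin
    filter_upwards [ae_lt_top hmeas2 hfin.ne] with q hq
    refine Set.mem_Iio.mpr (lt_top_iff_ne_top.mpr fun htop => ?_)
    rw [htop, ENNReal.mul_top (by simpa using wt_pos _ _)] at hq
    exact lt_irrefl _ hq)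
  filter_upwards [h1, h2] with q hq1 hq2
  rw [integrable_radon_iff hk hk']
  have hu : Measurable fun z : Mat n m => q.1.1 * q.2 + z := measurable_const.add measurable_id
  have hae := (indicator_lintegral_ae hS hu).mp hq1
  have h3 : Integrable (fun z => f₀ (q.1.1 * q.2 + z)) (planeMeasure m q.1) :=
    ⟨(hfm.comp hu).aestronglyMeasurable, hq2⟩
  refine h3.congr ?_
  filter_upwards [hae] with z hz
  exact (hfS _ hz).symm

/-- The convolution with the mean plane measure. -/
def planeConv {n m : ℕ} (k : ℕ) (f : Mat n m → ℂ) (x : Mat n m) : ℂ :=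
  ∫ z, f (x + z) ∂(meanPlaneMeasure n m k)

/-- For an `x` whose translate of the mean plane measure does not charge `S`, almost every plane
through `x` sees only `f₀`. Finiteness of `|f₀| * μ` at `x` then allows Fubini in `(γ, ω)`. -/
theorem dualRadon_radon_eq {n m k : ℕ} (hk : 1 ≤ k) (hkn : k ≤ n) {f f₀ : Mat n m → ℂ}
    (hfm : Measurable f₀) {S : Set (Mat n m)} (hS : MeasurableSet S)
    (hfS : ∀ x ∉ S, f x = f₀ x) {x : Mat n m}
    (hx0 : ∀ᵐ z ∂(meanPlaneMeasure n m k), x + z ∉ S)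
    (hx1 : ∫⁻ z, ‖f₀ (x + z)‖ₑ ∂(meanPlaneMeasure n m k) < ⊤) :
    Integrable (fun ξ : Stiefel n (n - k) => radon f ξ (ξ.1ᵀ * x)) (stiefelMeasure n k) ∧
      dualRadon (radon (k := k) f) x = planeConv k f₀ x := by
  have hSm : Measurable (S.indicator (1 : Mat n m → ENNReal)) := measurable_one.indicator hS
  have hxa : Measurable fun z : Mat n m => x + z := measurable_const.add measurable_id
  have hpp := measurable_planeParam hkn m
  -- The version with `f₀` is strongly measurable in `ξ`; `radon f` is only known to agree with it
  -- almost everywhere.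
  set A : Stiefel n (n - k) → ℂ := fun ξ =>
    ∫ z, f₀ (ξ.1 * (ξ.1ᵀ * x) + z) ∂(planeMeasure m ξ) with hAd
  have hxi : Measurable fun ξ : Stiefel n (n - k) => ξ.1 * (ξ.1ᵀ * x) :=
    measurable_stiefel_mul measurable_id
      (measurable_stiefel_transpose_mul measurable_id measurable_const)
  have hA : StronglyMeasurable A :=
    stronglyMeasurable_integral_planeMeasure measurable_id
      (F := fun (ξ : Stiefel n (n - k)) z => f₀ (ξ.1 * (ξ.1ᵀ * x) + z))
      (hfm.comp ((hxi.comp measurable_fst).add measurable_snd))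
  have hAγ : ∀ γ, A (frame k γ) = ∫ ω : Mat k m, f₀ (x + planeParam γ ω) := fun γ =>
    integral_planeMeasure_shift hkn γ f₀ x
  have hae : (fun ξ : Stiefel n (n - k) => radon f ξ (ξ.1ᵀ * x)) =ᵐ[stiefelMeasure n k] A := by
    have h1 := ae_stiefel_of_ae hkn hSm x (A := {0}) (measurableSet_singleton 0) (by
      have h0 := (indicator_lintegral_ae hS hxa).mpr hx0
      rw [lintegral_meanPlane hkn (F := fun z => S.indicator 1 (x + z)) (hSm.comp hxa)] at h0
      have hmeas : Measurable fun q : Matrix.orthogonalGroup (Fin n) ℝ × Mat k m =>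
          S.indicator (1 : Mat n m → ENNReal) (x + planeParam q.1 q.2) :=
        hSm.comp (measurable_const.add hpp)
      rw [lintegral_eq_zero_iff hmeas.lintegral_prod_right'] at h0
      exact h0)
    filter_upwards [h1] with ξ hξ
    rw [radon_eq hk hkn]
    have hu : Measurable fun z : Mat n m => ξ.1 * (ξ.1ᵀ * x) + z :=
      measurable_const.add measurable_id
    refine integral_congr_ae ?_
    filter_upwards [(indicator_lintegral_ae hS hu).mp hξ] with z hz
    exact hfS _ hz
  have hint : Integrable (fun q : Matrix.orthogonalGroup (Fin n) ℝ × Mat k m =>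
      f₀ (x + planeParam q.1 q.2)) ((haarO n).prod volume) := by
    refine ⟨(hfm.comp (measurable_const.add hpp)).aestronglyMeasurable, ?_⟩
    rw [meanPlaneMeasure, lintegral_map (f := fun z => ‖f₀ (x + z)‖ₑ) (hfm.comp hxa).enorm hpp]
      at hx1
    exact hx1
  have hAi : Integrable A (stiefelMeasure n k) := by
    rw [stiefelMeasure_eq, integrable_map_measure hA.aestronglyMeasurable
      (measurable_frame n k).aemeasurable]
    refine hint.integral_prod_left.congr (Eventually.of_forall fun γ => ?_)
    exact (hAγ γ).symm
  refine ⟨hAi.congr hae.symm, ?_⟩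
  rw [dualRadon, integral_congr_ae hae, stiefelMeasure_eq,
    integral_map (measurable_frame n k).aemeasurable hA.aestronglyMeasurable]
  simp only [hAγ]
  rw [planeConv, meanPlaneMeasure, integral_map (f := fun z => f₀ (x + z)) hpp.aemeasurable
    (hfm.comp hxa).aestronglyMeasurable, ← integral_prod _ hint]

/-! ### Weights under translation and dilation; rapid decay -/

theorem gram_trace_eq_sum {n m : ℕ} (y : Mat n m) :
    (yᵀ * y).trace = ∑ j, ∑ i, y i j ^ 2 := by
  simp only [Matrix.trace, Matrix.diag, Matrix.mul_apply, Matrix.transpose_apply, sq]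

theorem gram_trace_mul_le {n m l : ℕ} (y : Mat n m) (s : Mat m l) :
    ((y * s)ᵀ * (y * s)).trace ≤ (yᵀ * y).trace * (sᵀ * s).trace := by
  simp only [gram_trace_eq_sum, Matrix.mul_apply]
  rw [Finset.mul_sum]
  refine Finset.sum_le_sum fun j _ => ?_
  rw [Finset.sum_comm, Finset.sum_mul]
  exact Finset.sum_le_sum fun i _ => Finset.sum_mul_sq_le_sq_mul_sq _ _ _

/-- A Peetre-type inequality: `1 + |x - u|² ≤ 2 (1 + |x|²)(1 + |u|²)`. It lets the weight be moved
across a convolution. -/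
theorem wt_mul_wt_le {n m : ℕ} (N : ℕ) (x u : Mat n m) :
    wt N x * wt N u ≤ 2 ^ N * wt N (x - u) := by
  have h1 := gram_trace_nonneg x
  have h2 := gram_trace_nonneg u
  have h3 := gram_trace_nonneg (x - u)
  have h : 1 + ((x - u)ᵀ * (x - u)).trace ≤
      2 * ((1 + (xᵀ * x).trace) * (1 + (uᵀ * u).trace)) := by
    have h4 : ((x - u)ᵀ * (x - u)).trace ≤ 2 * (xᵀ * x).trace + 2 * (uᵀ * u).trace := by
      simp only [gram_trace_eq_sum, Finset.mul_sum, ← Finset.sum_add_distrib, Matrix.sub_apply]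
      refine Finset.sum_le_sum fun j _ => Finset.sum_le_sum fun i _ => ?_
      nlinarith [sq_nonneg (x i j + u i j)]
    nlinarith [mul_nonneg h1 h2]
  unfold wt
  rw [← mul_inv, ← mul_pow, ← div_eq_mul_inv, inv_eq_one_div, div_le_div_iff₀ (by positivity)
    (by positivity), one_mul, ← mul_pow]
  gcongr

/-- By Cauchy-Schwarz `|y a^{1/2}|² ≤ |y|² tr a`, so a dilation costs only a power of `1 + tr a`. -/
theorem wt_mul_sqrt_inv_le {n m : ℕ} (N : ℕ) {a : Mat m m} (ha : a.PosSemidef) (y : Mat n m) :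
    (wt N (y * CFC.sqrt a))⁻¹ ≤ (1 + a.trace) ^ N * (wt N y)⁻¹ := by
  have h1 := gram_trace_nonneg y
  have h2 := gram_trace_nonneg (y * CFC.sqrt a)
  have h3 := gram_trace_mul_le y (CFC.sqrt a)
  have h4 := gram_trace_nonneg (CFC.sqrt a)
  rw [sqrt_transpose, sqrt_mul_sqrt ha] at h3 h4
  unfold wt
  rw [inv_inv, inv_inv, ← mul_pow]
  gcongr
  nlinarith

/-- A rapidly decreasing function. -/
def RapidDecay {n m : ℕ} (w : Mat n m → ℂ) : Prop :=
  ∀ M : ℕ, ∃ C : ℝ, 0 ≤ C ∧ ∀ y, ‖w y‖ ≤ C * wt M y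

theorem rapidDecay_schwartz {n m : ℕ} (g : 𝓢(EMat n m, ℂ)) :
    RapidDecay fun y : Mat n m => g (flat y) := by
  intro M
  refine ⟨2 ^ (2 * M) * ((Finset.Iic (2 * M, 0)).sup fun q => SchwartzMap.seminorm ℝ q.1 q.2) g,
    by positivity, fun y => ?_⟩
  have h := SchwartzMap.one_add_le_sup_seminorm_apply (𝕜 := ℝ) (m := (2 * M, 0)) le_rfl le_rfl g
    (flat y)
  rw [norm_iteratedFDeriv_zero] at h
  have h0 := gram_trace_nonneg y
  unfold wt
  rw [← div_eq_mul_inv, le_div_iff₀ (by positivity), mul_comm]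
  refine le_trans ?_ h
  rw [← norm_flat_sq, pow_mul]
  gcongr
  nlinarith [norm_nonneg (flat y)]

theorem IsSchwartz.exists_flat {n m : ℕ} {w : Mat n m → ℂ} (hw : IsSchwartz w) :
    ∃ g : 𝓢(EMat n m, ℂ), w = fun y => g (flat y) := by
  obtain ⟨g, hg⟩ := hw
  exact ⟨g, funext hg⟩

theorem measurable_flat (n m : ℕ) : Measurable (flat : Mat n m → EMat n m) :=
  (flatEquiv n m).measurable

theorem IsSchwartz.measurable {n m : ℕ} {w : Mat n m → ℂ} (hw : IsSchwartz w) : Measurable w := by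
  obtain ⟨g, rfl⟩ := hw.exists_flat
  exact g.continuous.measurable.comp (measurable_flat n m)

theorem IsSchwartz.rapidDecay {n m : ℕ} {w : Mat n m → ℂ} (hw : IsSchwartz w) : RapidDecay w := by
  obtain ⟨g, rfl⟩ := hw.exists_flat
  exact rapidDecay_schwartz g

theorem RapidDecay.lintegral_lt_top {n m : ℕ} {w : Mat n m → ℂ} (hw : RapidDecay w) (N : ℕ) :
    ∫⁻ y : Mat n m, ‖w y‖ₑ * ENNReal.ofReal (wt N y)⁻¹ < ⊤ := by
  obtain ⟨C, hC, h⟩ := hw (N + (n * m + 1))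
  have hi := (integrable_wt (n := n) (m := m) (N := n * m + 1) (by omega)).lintegral_lt_top
  refine lt_of_le_of_lt (lintegral_mono (g := fun y : Mat n m => ENNReal.ofReal C *
    ENNReal.ofReal (wt (n * m + 1) y)) fun y => ?_) ?_
  · have hp := wt_pos N y
    beta_reduce
    rw [← ofReal_norm, ← ENNReal.ofReal_mul (norm_nonneg _), ← ENNReal.ofReal_mul hC]
    refine ENNReal.ofReal_le_ofReal ?_
    rw [← div_eq_mul_inv, div_le_iff₀ hp]
    refine (h y).trans (le_of_eq ?_)
    unfold wt
    rw [pow_add, mul_inv]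
    ring
  · rw [lintegral_const_mul' _ _ ENNReal.ofReal_ne_top]
    exact ENNReal.mul_lt_top ENNReal.ofReal_lt_top hi

/-- Translate the variable and compare the two weights by `wt_mul_wt_le`; the loss is polynomial in
`u`, hence absorbed by the decay of the wavelet. -/
theorem lintegral_wt_translate_le {n m : ℕ} (N : ℕ) (h : Mat n m → ENNReal) (u : Mat n m) :
    ∫⁻ x : Mat n m, ENNReal.ofReal (wt N x) * h (x - u) ≤
      ENNReal.ofReal (2 ^ N * (wt N u)⁻¹) * ∫⁻ x : Mat n m, ENNReal.ofReal (wt N x) * h x := by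
  rw [← lintegral_sub_right_eq_self (fun x : Mat n m => ENNReal.ofReal (wt N x) * h x) u,
    ← lintegral_const_mul' _ _ ENNReal.ofReal_ne_top]
  refine lintegral_mono fun x => ?_
  have hp := wt_pos N u
  rw [← mul_assoc, ← ENNReal.ofReal_mul (by positivity)]
  gcongr
  have := wt_mul_wt_le N x u
  rw [mul_right_comm, ← div_eq_mul_inv, le_div_iff₀ hp]
  exact this

/-! ### Absolute convergence and adjoint of the triple integral -/

/-- The parameter space of the triple integral `(a, y, z)`. -/
abbrev Param (n m : ℕ) := (Mat m m × Mat n m) × Mat n m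

/-- The displacement `z - y a^{1/2}`. -/
def shift {n m : ℕ} (q : Param n m) : Mat n m := q.2 - q.1.2 * CFC.sqrt q.1.1

theorem measurable_mul_sqrt (n m : ℕ) :
    Measurable fun q : Mat m m × Mat n m => q.2 * CFC.sqrt q.1 :=
  measurable_matMul measurable_snd ((measurable_sqrt m).comp measurable_fst)

theorem measurable_shift (n m : ℕ) : Measurable (shift : Param n m → Mat n m) :=
  measurable_snd.sub ((measurable_mul_sqrt n m).comp measurable_fst)

/-- The basic absolute convergence statement. -/
theorem lintegral_wt_shift_lt_top {n m k N : ℕ} {f : Mat n m → ℂ} (hfm : Measurable f)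
    {w : Mat n m → ℂ} (hwm : Measurable w) (hw : RapidDecay w)
    (hH : ∫⁻ x : Mat n m, ENNReal.ofReal (wt N x) *
      ∫⁻ z, ‖f (x + z)‖ₑ ∂(meanPlaneMeasure n m k) < ⊤)
    {ν : Measure (Mat m m)} [SFinite ν] (hν : ∀ᵐ a ∂ν, a.PosSemidef) {c : Mat m m → ℂ}
    (hc : Measurable c) (hcν : ∫⁻ a, ‖c a‖ₑ * ENNReal.ofReal ((1 + a.trace) ^ N) ∂ν < ⊤) :
    ∫⁻ x : Mat n m, ENNReal.ofReal (wt N x) *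
      ∫⁻ q, ‖f (x + shift q) * (w q.1.2 * c q.1.1)‖ₑ
        ∂((ν.prod volume).prod (meanPlaneMeasure n m k)) < ⊤ := by
  set μ := meanPlaneMeasure n m k
  set h : Mat n m → ENNReal := fun x => ∫⁻ z, ‖f (x + z)‖ₑ ∂μ with hh
  set b : Mat m m × Mat n m → ENNReal := fun q => ‖w q.2 * c q.1‖ₑ with hb
  have hbm : Measurable b := ((hwm.comp measurable_snd).mul (hc.comp measurable_fst)).enorm
  have hhm : Measurable h := by
    have : Measurable fun q : Mat n m × Mat n m => ‖f (q.1 + q.2)‖ₑ :=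
      (hfm.comp (measurable_fst.add measurable_snd)).enorm
    exact this.lintegral_prod_right'
  have hwtm : Measurable fun x : Mat n m => ENNReal.ofReal (wt N x) :=
    (measurable_wt N).ennreal_ofReal
  have hu := measurable_mul_sqrt n m
  have h1 : ∀ x : Mat n m, ∫⁻ q, ‖f (x + shift q) * (w q.1.2 * c q.1.1)‖ₑ
      ∂((ν.prod volume).prod μ) =
      ∫⁻ q : Mat m m × Mat n m, h (x - q.2 * CFC.sqrt q.1) * b q ∂(ν.prod volume) := fun x => by
    have hm : Measurable fun q : Param n m => ‖f (x + shift q) * (w q.1.2 * c q.1.1)‖ₑ :=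
      ((hfm.comp (measurable_const.add (measurable_shift n m))).mul
        ((hwm.comp (measurable_snd.comp measurable_fst)).mul
          (hc.comp (measurable_fst.comp measurable_fst)))).enorm
    rw [lintegral_prod _ hm.aemeasurable]
    refine lintegral_congr fun q => ?_
    simp only [hh, hb]
    rw [← lintegral_mul_const' _ _ enorm_ne_top]
    refine lintegral_congr fun z => ?_
    rw [enorm_mul, shift]
    congr 3
    simp only
    abel
  simp only [h1]
  have h2 : ∀ x : Mat n m, ENNReal.ofReal (wt N x) *
      ∫⁻ q : Mat m m × Mat n m, h (x - q.2 * CFC.sqrt q.1) * b q ∂(ν.prod volume) =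
      ∫⁻ q : Mat m m × Mat n m, ENNReal.ofReal (wt N x) * h (x - q.2 * CFC.sqrt q.1) * b q
        ∂(ν.prod volume) := fun x => by
    rw [← lintegral_const_mul' _ _ ENNReal.ofReal_ne_top]
    simp only [mul_assoc]
  simp only [h2]
  have hm2 : Measurable fun p : Mat n m × (Mat m m × Mat n m) =>
      ENNReal.ofReal (wt N p.1) * h (p.1 - p.2.2 * CFC.sqrt p.2.1) * b p.2 :=
    ((hwtm.comp measurable_fst).mul (hhm.comp (measurable_fst.sub (hu.comp measurable_snd)))).mul
      (hbm.comp measurable_snd)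
  rw [lintegral_lintegral_swap hm2.aemeasurable]
  set H := ∫⁻ x : Mat n m, ENNReal.ofReal (wt N x) * h x
  have hmw : Measurable fun y : Mat n m => ‖w y‖ₑ * ENNReal.ofReal (wt N y)⁻¹ :=
    hwm.enorm.mul (measurable_wt N).inv.ennreal_ofReal
  have hmc : Measurable fun a : Mat m m => ‖c a‖ₑ * ENNReal.ofReal ((1 + a.trace) ^ N) :=
    hc.enorm.mul (measurable_of_continuous (f := fun a : Mat m m => (1 + a.trace) ^ N)
      (by fun_prop)).ennreal_ofReal
  have hae : ∀ᵐ q : Mat m m × Mat n m ∂(ν.prod volume), q.1.PosSemidef :=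
    Measure.quasiMeasurePreserving_fst.ae hν
  -- The dominating function separates into a constant, a function of `a` and a function of `y`,
  -- each with finite integral.
  refine lt_of_le_of_lt (lintegral_mono_ae (g := fun q : Mat m m × Mat n m =>
    (ENNReal.ofReal (2 ^ N) * H) * ((‖c q.1‖ₑ * ENNReal.ofReal ((1 + q.1.trace) ^ N)) *
      (‖w q.2‖ₑ * ENNReal.ofReal (wt N q.2)⁻¹))) ?_) ?_
  · filter_upwards [hae] with q hq
    rw [lintegral_mul_const' _ _ enorm_ne_top]
    have h3 := lintegral_wt_translate_le N h (q.2 * CFC.sqrt q.1)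
    have h4 := wt_mul_sqrt_inv_le N hq q.2
    have h5 : 0 ≤ (1 + q.1.trace) ^ N := by
      have := hq.trace_nonneg
      positivity
    calc _ ≤ (ENNReal.ofReal (2 ^ N * (wt N (q.2 * CFC.sqrt q.1))⁻¹) * H) * b q := by gcongr
      _ ≤ (ENNReal.ofReal (2 ^ N * ((1 + q.1.trace) ^ N * (wt N q.2)⁻¹)) * H) * b q := by gcongr
      _ = _ := by
        rw [ENNReal.ofReal_mul (by positivity), ENNReal.ofReal_mul h5, hb]
        simp only [enorm_mul]
        ring
  · rw [lintegral_const_mul' _ _ (ENNReal.mul_ne_top ENNReal.ofReal_ne_top hH.ne),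
      lintegral_prod_mul hmc.aemeasurable hmw.aemeasurable]
    exact ENNReal.mul_lt_top (ENNReal.mul_lt_top ENNReal.ofReal_lt_top hH)
      (ENNReal.mul_lt_top hcν (hw.lintegral_lt_top N))

section

variable {n m k N : ℕ} {f₀ : Mat n m → ℂ} {w : Mat n m → ℂ} {ν : Measure (Mat m m)} [SFinite ν]
  {c : Mat m m → ℂ}

theorem measurable_tripleIntegrand (hfm : Measurable f₀) (hwm : Measurable w) (hc : Measurable c) :
    Measurable fun p : Mat n m × Param n m =>
      f₀ (p.1 + shift p.2) * (w p.2.1.2 * c p.2.1.1) :=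
  (hfm.comp (measurable_fst.add ((measurable_shift n m).comp measurable_snd))).mul
    ((hwm.comp (measurable_snd.comp (measurable_fst.comp measurable_snd))).mul
      (hc.comp (measurable_fst.comp (measurable_fst.comp measurable_snd))))

/-- Integrability of the triple integral against a rapidly decreasing function. -/
theorem integrable_mul_triple (hfm : Measurable f₀) (hwm : Measurable w) (hc : Measurable c)
    (hfin : ∫⁻ x : Mat n m, ENNReal.ofReal (wt N x) *
      ∫⁻ q, ‖f₀ (x + shift q) * (w q.1.2 * c q.1.1)‖ₑ
        ∂((ν.prod volume).prod (meanPlaneMeasure n m k)) < ⊤)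
    {G : Mat n m → ℂ} (hG : Measurable G) (hGd : RapidDecay G) :
    Integrable (fun p : Mat n m × Param n m =>
      G p.1 * (f₀ (p.1 + shift p.2) * (w p.2.1.2 * c p.2.1.1)))
      (volume.prod ((ν.prod volume).prod (meanPlaneMeasure n m k))) := by
  have hm := measurable_tripleIntegrand hfm hwm hc (n := n)
  have hm2 := (hG.comp measurable_fst).mul hm
  refine ⟨hm2.aestronglyMeasurable, ?_⟩
  obtain ⟨C, hC, hCG⟩ := hGd N
  rw [hasFiniteIntegral_iff_enorm, lintegral_prod (fun p : Mat n m × Param n m =>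
    ‖G p.1 * (f₀ (p.1 + shift p.2) * (w p.2.1.2 * c p.2.1.1))‖ₑ) hm2.enorm.aemeasurable]
  refine lt_of_le_of_lt (lintegral_mono (g := fun x => ENNReal.ofReal C *
    (ENNReal.ofReal (wt N x) * ∫⁻ q, ‖f₀ (x + shift q) * (w q.1.2 * c q.1.1)‖ₑ
        ∂((ν.prod volume).prod (meanPlaneMeasure n m k)))) fun x => ?_) ?_
  · beta_reduce
    rw [← mul_assoc, ← ENNReal.ofReal_mul hC]
    simp only [enorm_mul (G x)]
    rw [lintegral_const_mul' _ _ enorm_ne_top]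
    gcongr
    rw [← ofReal_norm]
    exact ENNReal.ofReal_le_ofReal (hCG x)
  · rw [lintegral_const_mul' _ _ ENNReal.ofReal_ne_top]
    exact ENNReal.mul_lt_top ENNReal.ofReal_lt_top hfin

/-- For almost all `x` the triple integral converges absolutely. -/
theorem ae_integrable_triple (hfm : Measurable f₀) (hwm : Measurable w) (hc : Measurable c)
    (hfin : ∫⁻ x : Mat n m, ENNReal.ofReal (wt N x) *
      ∫⁻ q, ‖f₀ (x + shift q) * (w q.1.2 * c q.1.1)‖ₑ
        ∂((ν.prod volume).prod (meanPlaneMeasure n m k)) < ⊤) :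
    ∀ᵐ x : Mat n m, Integrable (fun q : Param n m => f₀ (x + shift q) * (w q.1.2 * c q.1.1))
      ((ν.prod volume).prod (meanPlaneMeasure n m k)) := by
  have hm := measurable_tripleIntegrand hfm hwm hc (n := n)
  have hm1 : Measurable fun x : Mat n m => ENNReal.ofReal (wt N x) *
      ∫⁻ q, ‖f₀ (x + shift q) * (w q.1.2 * c q.1.1)‖ₑ
        ∂((ν.prod volume).prod (meanPlaneMeasure n m k)) :=
    (measurable_wt N).ennreal_ofReal.mul hm.enorm.lintegral_prod_right'
  filter_upwards [ae_lt_top hm1 hfin.ne] with x hx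
  refine ⟨(hm.comp (measurable_const.prodMk measurable_id)).aestronglyMeasurable,
    lt_top_iff_ne_top.mpr fun htop => ?_⟩
  rw [htop, ENNReal.mul_top (by simpa using wt_pos _ _)] at hx
  exact lt_irrefl _ hx

/-- The double integral of a function which agrees almost everywhere with the plane average. -/
theorem ae_integrable_double {D : Mat n m → ℂ} (hfm : Measurable f₀) (hwm : Measurable w)
    (hc : Measurable c)
    (hfin : ∫⁻ x : Mat n m, ENNReal.ofReal (wt N x) *
      ∫⁻ q, ‖f₀ (x + shift q) * (w q.1.2 * c q.1.1)‖ₑ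
        ∂((ν.prod volume).prod (meanPlaneMeasure n m k)) < ⊤)
    (hD : D =ᵐ[volume] planeConv k f₀) :
    ∀ᵐ x : Mat n m, Integrable (fun q : Mat m m × Mat n m =>
        D (x - q.2 * CFC.sqrt q.1) * (w q.2 * c q.1)) (ν.prod volume) ∧
      ∫ q : Mat m m × Mat n m, D (x - q.2 * CFC.sqrt q.1) * (w q.2 * c q.1) ∂(ν.prod volume) =
        ∫ q, f₀ (x + shift q) * (w q.1.2 * c q.1.1)
          ∂((ν.prod volume).prod (meanPlaneMeasure n m k)) := by
  -- The points `x - y a^{1/2}` avoid the exceptional null set of `hD` for almost all `(x, a, y)`,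
  -- so `D` can be exchanged for the convolution.
  have hq := quasiMeasurePreserving_add (n := n) (ν.prod (volume : Measure (Mat n m)))
    (measurable_mul_sqrt n m).neg
  have hae := Measure.ae_ae_of_ae_prod (hq.ae hD)
  filter_upwards [ae_integrable_triple hfm hwm hc hfin, hae] with x hx hx2
  have hinner : ∀ q : Mat m m × Mat n m,
      ∫ z, f₀ (x + shift (q, z)) * (w q.2 * c q.1) ∂(meanPlaneMeasure n m k) =
        planeConv k f₀ (x - q.2 * CFC.sqrt q.1) * (w q.2 * c q.1) := fun q => by
    rw [integral_mul_const, planeConv]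
    congr 2
    funext z
    congr 1
    rw [shift]
    abel
  have hcong : (fun q : Mat m m × Mat n m =>
      ∫ z, f₀ (x + shift (q, z)) * (w q.2 * c q.1) ∂(meanPlaneMeasure n m k)) =ᵐ[ν.prod volume]
      fun q => D (x - q.2 * CFC.sqrt q.1) * (w q.2 * c q.1) := by
    filter_upwards [hx2] with q hq
    rw [hinner, sub_eq_add_neg]
    exact congrArg (· * _) hq.symm
  refine ⟨hx.integral_prod_left.congr hcong, ?_⟩
  rw [integral_prod _ hx]
  exact (integral_congr_ae hcong).symm

end

section

variable {n m k N : ℕ} {f₀ : Mat n m → ℂ} {w : Mat n m → ℂ} {ν : Measure (Mat m m)} [SFinite ν]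
  {c : Mat m m → ℂ}

/-- The adjoint relation for the triple integral. -/
theorem integral_mul_triple (hfm : Measurable f₀) (hwm : Measurable w) (hc : Measurable c)
    (hfin : ∫⁻ x : Mat n m, ENNReal.ofReal (wt N x) *
      ∫⁻ q, ‖f₀ (x + shift q) * (w q.1.2 * c q.1.1)‖ₑ
        ∂((ν.prod volume).prod (meanPlaneMeasure n m k)) < ⊤)
    {G : Mat n m → ℂ} (hG : Measurable G) (hGd : RapidDecay G) :
    ∫ x, G x * ∫ q, f₀ (x + shift q) * (w q.1.2 * c q.1.1)
        ∂((ν.prod volume).prod (meanPlaneMeasure n m k)) =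
      ∫ x, f₀ x * ∫ r : Mat m m × Mat n m, (w r.2 * c r.1) *
        ∫ z, G (x + r.2 * CFC.sqrt r.1 - z) ∂(meanPlaneMeasure n m k) ∂(ν.prod volume) := by
  set P := (ν.prod (volume : Measure (Mat n m))).prod (meanPlaneMeasure n m k)
  have hK := integrable_mul_triple hfm hwm hc hfin hG hGd
  -- The integrand after the shear `x ↦ x + shift q`, which preserves the product measure: the
  -- displacement passes from `f₀` to the test function `G`.
  set K' : Param n m × Mat n m → ℂ := fun p =>
    f₀ p.2 * ((w p.1.1.2 * c p.1.1.1) * G (p.2 - shift p.1)) with hK'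
  have hK'm : Measurable K' :=
    (hfm.comp measurable_snd).mul
      (((hwm.comp (measurable_snd.comp (measurable_fst.comp measurable_fst))).mul
        (hc.comp (measurable_fst.comp (measurable_fst.comp measurable_fst)))).mul
      (hG.comp (measurable_snd.sub ((measurable_shift n m).comp measurable_fst))))
  have hΦ : MeasurePreserving (fun p : Param n m × Mat n m => (p.1, p.2 + shift p.1))
      (P.prod volume) (P.prod volume) :=
    (MeasurePreserving.id P).skew_product (g := fun q x => x + shift q)
      (measurable_snd.add ((measurable_shift n m).comp measurable_fst))
      (Eventually.of_forall fun q => (measurePreserving_add_right volume (shift q)).map_eq)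
  have hcomp : ∀ p : Param n m × Mat n m, K' (p.1, p.2 + shift p.1) =
      G p.2 * (f₀ (p.2 + shift p.1) * (w p.1.1.2 * c p.1.1.1)) := fun p => by
    simp only [hK', add_sub_cancel_right]
    ring
  have hKs : Integrable (fun p : Param n m × Mat n m => K' (p.1, p.2 + shift p.1))
      (P.prod volume) := by
    simp only [hcomp]
    exact hK.swap
  have hK'i : Integrable K' (P.prod volume) :=
    (hΦ.integrable_comp hK'm.aestronglyMeasurable).mp hKs
  have hI : ∫ p, K' (p.1, p.2 + shift p.1) ∂(P.prod volume) = ∫ p, K' p ∂(P.prod volume) := by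
    conv_rhs => rw [← hΦ.map_eq]
    exact (integral_map hΦ.measurable.aemeasurable hK'm.aestronglyMeasurable).symm
  calc _ = ∫ x, ∫ q, G x * (f₀ (x + shift q) * (w q.1.2 * c q.1.1)) ∂P := by
        simp only [integral_const_mul]
    _ = ∫ p : Mat n m × Param n m, G p.1 * (f₀ (p.1 + shift p.2) * (w p.2.1.2 * c p.2.1.1))
          ∂(volume.prod P) := (integral_prod _ hK).symm
    _ = ∫ p, K' (p.1, p.2 + shift p.1) ∂(P.prod volume) := by
        simp only [hcomp]
        exact (integral_prod_swap (fun p : Mat n m × Param n m =>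
          G p.1 * (f₀ (p.1 + shift p.2) * (w p.2.1.2 * c p.2.1.1)))).symm
    _ = ∫ x, ∫ q, K' (q, x) ∂P := by rw [hI, integral_prod_symm _ hK'i]
    _ = _ := by
        refine integral_congr_ae ?_
        filter_upwards [hK'i.prod_left_ae] with x hx
        simp only [hK', integral_const_mul] at hx ⊢
        -- Integrability of the factor without `f₀ x` is obtained by dividing, so zeros of `f₀` are
        -- treated apart; there both sides vanish.
        by_cases h0 : f₀ x = 0
        · rw [h0, zero_mul, zero_mul]
        congr 1
        have hx2 : Integrable (fun q : Param n m => (w q.1.2 * c q.1.1) * G (x - shift q)) P := by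
          have := hx.const_mul (f₀ x)⁻¹
          simpa only [← mul_assoc, inv_mul_cancel₀ h0, one_mul] using this
        rw [integral_prod _ hx2]
        refine integral_congr_ae (Eventually.of_forall fun r => ?_)
        refine Eq.trans ?_ (integral_const_mul (w r.2 * c r.1) _)
        refine integral_congr_ae (Eventually.of_forall fun z => ?_)
        change _ * G (x - (z - r.2 * CFC.sqrt r.1)) = _
        rw [show x - (z - r.2 * CFC.sqrt r.1) = x + r.2 * CFC.sqrt r.1 - z by abel]

end

/-! ### Order intervals in the cone -/

theorem measurableSet_loewnerIoo {m : ℕ} (a b : Mat m m) : MeasurableSet (loewnerIoo a b) :=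
  ((measurable_id.sub measurable_const) (measurableSet_posDef m)).inter
    ((measurable_const.sub measurable_id) (measurableSet_posDef m))

theorem posDef_of_mem_loewnerIoo {m : ℕ} {a b s : Mat m m} (ha : a.PosSemidef)
    (hs : s ∈ loewnerIoo a b) : s.PosDef := by
  have := hs.1.add_posSemidef ha
  rwa [sub_add_cancel] at this

/-- The closed order interval `[εI, ρI]`. -/
def loewnerIcc (m : ℕ) (ε ρ : ℝ) : Set (Mat m m) :=
  {a | (a - ε • (1 : Mat m m)).PosSemidef ∧ (ρ • (1 : Mat m m) - a).PosSemidef}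

theorem loewnerIoo_subset_loewnerIcc (m : ℕ) (ε ρ : ℝ) :
    loewnerIoo (ε • (1 : Mat m m)) (ρ • 1) ⊆ loewnerIcc m ε ρ :=
  fun _ h => ⟨h.1.posSemidef, h.2.posSemidef⟩

theorem posDef_of_mem_loewnerIcc {m : ℕ} {ε ρ : ℝ} (hε : 0 < ε) {a : Mat m m}
    (ha : a ∈ loewnerIcc m ε ρ) : a.PosDef := by
  have := (Matrix.PosDef.one.smul hε).add_posSemidef ha.1
  rwa [add_sub_cancel] at this

theorem abs_apply_le_of_mem_loewnerIcc {m : ℕ} {ε ρ : ℝ} (hε : 0 < ε) {a : Mat m m}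
    (ha : a ∈ loewnerIcc m ε ρ) (i j : Fin m) : |a i j| ≤ m * ρ := by
  have h1 := abs_gram_apply_le (CFC.sqrt a) i j
  rw [sqrt_transpose_mul (posDef_of_mem_loewnerIcc hε ha).posSemidef] at h1
  refine h1.trans ?_
  have h2 := ha.2.trace_nonneg
  simp only [Matrix.trace_sub, Matrix.trace_smul, Matrix.trace_one, Fintype.card_fin,
    smul_eq_mul] at h2
  linarith

theorem isCompact_loewnerIcc {m : ℕ} {ε ρ : ℝ} (hε : 0 < ε) : IsCompact (loewnerIcc m ε ρ) := by
  have hc : IsCompact (Set.pi Set.univ fun _ : Fin m => Set.pi Set.univ fun _ : Fin m =>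
      Set.Icc (-(m * ρ)) (m * ρ)) :=
    isCompact_univ_pi fun _ => isCompact_univ_pi fun _ => isCompact_Icc
  have h1 : IsClosed (loewnerIcc m ε ρ) :=
    ((isClosed_posSemidef m).preimage (continuous_id.sub continuous_const)).inter
      ((isClosed_posSemidef m).preimage (continuous_const.sub continuous_id))
  exact hc.of_isClosed_subset h1 fun a ha i _ j _ =>
    abs_le.mp (abs_apply_le_of_mem_loewnerIcc hε ha i j)

theorem coneVolume_loewnerIcc_lt_top {m : ℕ} {ε ρ : ℝ} (hε : 0 < ε) :
    coneVolume m (loewnerIcc m ε ρ) < ⊤ := by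
  refine lt_of_le_of_lt (Measure.restrict_apply_le _ _) ?_
  rw [Measure.map_apply (measurable_symOf m) (isCompact_loewnerIcc hε).isClosed.measurableSet]
  have hc : IsCompact (Set.pi Set.univ fun _ : {q : Fin m × Fin m // q.1 ≤ q.2} =>
      Set.Icc (-(m * ρ)) (m * ρ)) := isCompact_univ_pi fun _ => isCompact_Icc
  have hsub : symOf m ⁻¹' loewnerIcc m ε ρ ⊆ Set.pi Set.univ fun _ => Set.Icc (-(m * ρ)) (m * ρ) :=
    fun c hc q _ => by
      have h := abs_apply_le_of_mem_loewnerIcc hε hc q.1.1 q.1.2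
      have h2 : symOf m c q.1.1 q.1.2 = c q := by
        simp only [symOf, Matrix.of_apply, q.2, dite_true]
      rw [h2] at h
      exact abs_le.mp h
  exact lt_of_le_of_lt (measure_mono hsub) hc.measure_lt_top

/-- For `ε > 0` the order interval lies in the compact set `loewnerIcc`, which consists of positive
definite matrices. There the integrand, with the density of `d_*a` included, is bounded by a
continuous function, and the set has finite volume. -/
theorem lintegral_loewnerIoo_lt_top {m : ℕ} {ε ρ : ℝ} (hε : 0 < ε) (e : ℝ) (N : ℕ) :
    ∫⁻ a in loewnerIoo (ε • (1 : Mat m m)) (ρ • 1),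
      ‖((a.det ^ e : ℝ) : ℂ)‖ₑ * ENNReal.ofReal ((1 + a.trace) ^ N) ∂(coneInvMeasure m) < ⊤ := by
  have hK := isCompact_loewnerIcc (m := m) (ρ := ρ) hε
  have hcont : ContinuousOn (fun a : Mat m m => a.det ^ (-((m : ℝ) + 1) / 2) *
      (|a.det ^ e| * |(1 + a.trace) ^ N|)) (loewnerIcc m ε ρ) := by
    have hd : ∀ s : ℝ, ContinuousOn (fun a : Mat m m => a.det ^ s) (loewnerIcc m ε ρ) := fun s =>
      ContinuousOn.rpow_const (by fun_prop) fun a ha =>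
        Or.inl (posDef_of_mem_loewnerIcc hε ha).det_pos.ne'
    refine (hd _).mul ((hd e).abs.mul ?_)
    fun_prop
  obtain ⟨C, hC⟩ := hK.exists_bound_of_continuousOn hcont
  have hm1 : Measurable fun a : Mat m m =>
      ‖((a.det ^ e : ℝ) : ℂ)‖ₑ * ENNReal.ofReal ((1 + a.trace) ^ N) :=
    (Complex.measurable_ofReal.comp (measurable_det_rpow e)).enorm.mul
      (measurable_of_continuous (f := fun a : Mat m m => (1 + a.trace) ^ N)
        (by fun_prop)).ennreal_ofReal
  rw [← lintegral_indicator (measurableSet_loewnerIoo _ _),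
    lintegral_coneInv (hm1.indicator (measurableSet_loewnerIoo _ _))]
  refine lt_of_le_of_lt (lintegral_mono (g := (loewnerIcc m ε ρ).indicator
    fun _ => ENNReal.ofReal C) fun a => ?_) ?_
  · beta_reduce
    by_cases ha : a ∈ loewnerIoo (ε • (1 : Mat m m)) (ρ • 1)
    · have ha2 := loewnerIoo_subset_loewnerIcc m ε ρ ha
      have hp := posDef_of_mem_loewnerIcc hε ha2
      rw [Set.indicator_of_mem ha, Set.indicator_of_mem ha2, ← ofReal_norm, Complex.norm_real,
        ← ENNReal.ofReal_mul (norm_nonneg _),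
        ← ENNReal.ofReal_mul (Real.rpow_nonneg hp.det_pos.le _)]
      refine ENNReal.ofReal_le_ofReal (le_trans ?_ (hC a ha2))
      rw [Real.norm_eq_abs, Real.norm_eq_abs]
      refine le_trans ?_ (le_abs_self _)
      have := Real.rpow_nonneg hp.det_pos.le (-((m : ℝ) + 1) / 2)
      gcongr
      exact le_abs_self _
    · rw [Set.indicator_of_notMem ha, mul_zero]
      exact zero_le
  · rw [lintegral_indicator hK.isClosed.measurableSet, setLIntegral_const]
    exact ENNReal.mul_lt_top ENNReal.ofReal_lt_top (coneVolume_loewnerIcc_lt_top hε)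

theorem measurePreserving_congr {m : ℕ} {g : Mat m m} (hg : g.det ≠ 0) :
    MeasurePreserving (fun r : Mat m m => gᵀ * r * g) (coneInvMeasure m) (coneInvMeasure m) := by
  have hc : Measurable fun r : Mat m m => gᵀ * r * g :=
    measurable_of_continuous (by fun_prop)
  refine ⟨hc, Measure.ext fun s hs => ?_⟩
  have hind : Measurable (s.indicator (1 : Mat m m → ENNReal)) := measurable_one.indicator hs
  have h := lintegral_coneInv_congr hg hind
  rw [lintegral_indicator_one hs] at h
  rw [Measure.map_apply hc hs, ← h, ← lintegral_indicator_one (hc hs)]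
  rfl

theorem measurableEmbedding_congr {m : ℕ} {g : Mat m m} (hg : g.det ≠ 0) :
    MeasurableEmbedding fun r : Mat m m => gᵀ * r * g := by
  refine Continuous.measurableEmbedding (by fun_prop) fun r s h => ?_
  have hu : IsUnit g := (Matrix.isUnit_iff_isUnit_det g).mpr hg.isUnit
  have hu' : IsUnit gᵀ := (Matrix.isUnit_iff_isUnit_det _).mpr (by
    rw [Matrix.det_transpose]; exact hg.isUnit)
  exact hu'.mul_left_cancel (hu.mul_right_cancel h)

theorem integral_coneInv_congr {m : ℕ} {g : Mat m m} (hg : g.det ≠ 0) (F : Mat m m → ℂ) :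
    ∫ r, F (gᵀ * r * g) ∂(coneInvMeasure m) = ∫ r, F r ∂(coneInvMeasure m) :=
  (measurePreserving_congr hg).integral_comp (measurableEmbedding_congr hg) F

theorem congr_mem_loewnerIoo_iff {m : ℕ} {g : Mat m m} (hg : g.det ≠ 0) (ε ρ : ℝ) (a : Mat m m) :
    gᵀ * a * g ∈ loewnerIoo (ε • (gᵀ * g)) (ρ • (gᵀ * g)) ↔
      a ∈ loewnerIoo (ε • (1 : Mat m m)) (ρ • 1) := by
  have h1 : gᵀ * a * g - ε • (gᵀ * g) = gᵀ * (a - ε • (1 : Mat m m)) * g := by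
    simp [Matrix.mul_sub, Matrix.sub_mul]
  have h2 : ρ • (gᵀ * g) - gᵀ * a * g = gᵀ * (ρ • (1 : Mat m m) - a) * g := by
    simp [Matrix.mul_sub, Matrix.sub_mul]
  simp only [loewnerIoo, Set.mem_ofPred_eq, h1, h2]
  exact and_congr (posDef_congr_iff hg) (posDef_congr_iff hg)

/-- The change of variables `s = r^{1/2} a r^{1/2}` in a truncated cone integral. -/
theorem setIntegral_coneInv_sqrt {m : ℕ} {r : Mat m m} (hr : r.PosDef) (e ε ρ : ℝ)
    (F : Mat m m → ℂ) (hε : 0 < ε) :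
    ∫ a in loewnerIoo (ε • (1 : Mat m m)) (ρ • 1),
      ((a.det ^ e : ℝ) : ℂ) * F (CFC.sqrt r * a * CFC.sqrt r) ∂(coneInvMeasure m) =
    ((r.det ^ (-e) : ℝ) : ℂ) * ∫ s in loewnerIoo (ε • r) (ρ • r),
      ((s.det ^ e : ℝ) : ℂ) * F s ∂(coneInvMeasure m) := by
  have hg := det_sqrt_ne_zero hr
  rw [← integral_const_mul, ← integral_indicator (measurableSet_loewnerIoo _ _),
    ← integral_indicator (measurableSet_loewnerIoo _ _)]
  refine Eq.trans ?_ (integral_coneInv_congr hg _)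
  refine integral_congr_ae (Eventually.of_forall fun a => ?_)
  beta_reduce
  have hmem := congr_mem_loewnerIoo_iff hg ε ρ a
  rw [sqrt_transpose_mul hr.posSemidef] at hmem
  rw [sqrt_transpose] at hmem ⊢
  by_cases ha : a ∈ loewnerIoo (ε • (1 : Mat m m)) (ρ • 1)
  · rw [Set.indicator_of_mem ha, Set.indicator_of_mem (hmem.mpr ha)]
    have hap : a.PosDef := posDef_of_mem_loewnerIoo (Matrix.PosDef.one.smul hε).posSemidef ha
    have hdet : (CFC.sqrt r * a * CFC.sqrt r).det = r.det * a.det := by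
      rw [Matrix.det_mul, Matrix.det_mul, mul_right_comm, ← Matrix.det_mul,
        sqrt_mul_sqrt hr.posSemidef]
    rw [hdet, Real.mul_rpow hr.det_pos.le hap.det_pos.le, Real.rpow_neg hr.det_pos.le]
    have hne : ((r.det ^ e : ℝ) : ℂ) ≠ 0 := by
      exact_mod_cast (Real.rpow_pos_of_pos hr.det_pos e).ne'
    push_cast
    field_simp
  · rw [Set.indicator_of_notMem ha, Set.indicator_of_notMem fun h => ha (hmem.mp h)]

open scoped FourierTransform

/-! ### Flatness at the singular matrices -/

section

variable {E F : Type*} [NormedAddCommGroup E] [NormedSpace ℝ E] [NormedAddCommGroup F]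
  [NormedSpace ℝ F]

/-- A smooth function which vanishes to infinite order at `z₀` is small near `z₀`. -/
theorem norm_le_of_iteratedFDeriv_eq_zero {G : E → F} (hG : ContDiff ℝ (⊤ : ℕ∞) G) {z₀ z : E} {B : ℝ}
    {N : ℕ} (h0 : ∀ j < N, iteratedFDeriv ℝ j G z₀ = 0)
    (hB : ∀ y ∈ segment ℝ z₀ z, ‖iteratedFDeriv ℝ N G y‖ ≤ B) :
    ‖G z‖ ≤ B * ‖z - z₀‖ ^ N := by
  have hB0 : 0 ≤ B := (norm_nonneg _).trans (hB z (right_mem_segment ℝ z₀ z))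
  -- Descent from the derivative of order `N`: each use of the mean value inequality on the segment
  -- lowers the order by one and gains a factor `‖z - z₀‖`.
  have key : ∀ j ≤ N, ∀ y ∈ segment ℝ z₀ z,
      ‖iteratedFDeriv ℝ (N - j) G y‖ ≤ B * ‖z - z₀‖ ^ j := by
    intro j
    induction j with
    | zero => intro _ y hy; simpa using hB y hy
    | succ j ih =>
      intro hj y hy
      have hlt : N - (j + 1) < N := by omega
      have hd : ∀ x, DifferentiableAt ℝ (iteratedFDeriv ℝ (N - (j + 1)) G) x := fun x =>
        (hG.differentiable_iteratedFDeriv (WithTop.coe_lt_coe.mpr (ENat.natCast_lt_top _))) x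
      have h1 := (convex_segment z₀ z).norm_image_sub_le_of_norm_fderiv_le (𝕜 := ℝ)
        (f := iteratedFDeriv ℝ (N - (j + 1)) G) (C := B * ‖z - z₀‖ ^ j) (fun x _ => hd x)
        (fun x hx => by
          rw [norm_fderiv_iteratedFDeriv, show N - (j + 1) + 1 = N - j by omega]
          exact ih (by omega) x hx) (left_mem_segment ℝ z₀ z) hy
      rw [h0 _ hlt, sub_zero] at h1
      refine h1.trans ?_
      rw [pow_succ, ← mul_assoc]
      have h2 : ‖y - z₀‖ ≤ ‖z - z₀‖ := by
        obtain ⟨t, ht, rfl⟩ := (segment_eq_image' ℝ z₀ z ▸ hy :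
          y ∈ (fun θ : ℝ => z₀ + θ • (z - z₀)) '' Set.Icc 0 1)
        rw [add_sub_cancel_left, norm_smul, Real.norm_eq_abs, abs_of_nonneg ht.1]
        exact mul_le_of_le_one_left (norm_nonneg _) ht.2
      gcongr
  have h := key N le_rfl z (right_mem_segment ℝ z₀ z)
  rwa [Nat.sub_self, norm_iteratedFDeriv_zero] at h

end

/-- Delete the direction of the smallest eigenvalue `l` of `z'z`: for the projection `p` onto a unit
eigenvector, `z - zp` is singular and lies at squared distance `l` from `z`. As `l` is the smallest
of the `m` eigenvalues, `l^m` is at most their product. -/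
theorem exists_singular_approx {n m : ℕ} (hm : 1 ≤ m) (z : Mat n m) :
    ∃ z₀ : Mat n m, ¬ (z₀ᵀ * z₀).PosDef ∧
      (((z - z₀)ᵀ * (z - z₀)).trace) ^ m ≤ (zᵀ * z).det := by
  have hA := gram_posSemidef z
  have hne : Nonempty (Fin m) := ⟨⟨0, hm⟩⟩
  obtain ⟨i, hi⟩ := Finite.exists_min hA.isHermitian.eigenvalues
  set v : Fin m → ℝ := (hA.isHermitian.eigenvectorBasis i).ofLp with hv
  set l := hA.isHermitian.eigenvalues i with hl
  have hl0 : 0 ≤ l := hA.eigenvalues_nonneg i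
  have hvv : v ⬝ᵥ v = 1 := by
    have h := hA.isHermitian.eigenvectorBasis.orthonormal.1 i
    have h2 : ‖hA.isHermitian.eigenvectorBasis i‖ ^ 2 = 1 := by rw [h, one_pow]
    rw [EuclideanSpace.norm_sq_eq] at h2
    rw [← h2, dotProduct]
    refine Finset.sum_congr rfl fun j _ => ?_
    rw [Real.norm_eq_abs, sq_abs, sq]
  have hAv : (zᵀ * z) *ᵥ v = l • v := hA.isHermitian.mulVec_eigenvectorBasis i
  set p : Mat m m := Matrix.vecMulVec v v with hp
  have hpv : p *ᵥ v = v := by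
    rw [hp, Matrix.vecMulVec_mulVec, hvv]
    simp
  have hpp : p * p = p := by
    rw [hp, Matrix.vecMulVec_mul_vecMulVec, hvv, one_smul]
  have hpt : pᵀ = p := by
    rw [hp, Matrix.transpose_vecMulVec]
  refine ⟨z - z * p, fun hpd => ?_, ?_⟩
  · have h1 : (z - z * p) *ᵥ v = 0 := by
      rw [Matrix.sub_mulVec, ← Matrix.mulVec_mulVec, hpv, sub_self]
    have h2 : ((z - z * p)ᵀ * (z - z * p)) *ᵥ v = 0 := by
      rw [← Matrix.mulVec_mulVec, h1, Matrix.mulVec_zero]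
    have h3 := Matrix.eq_zero_of_mulVec_eq_zero hpd.det_pos.ne' h2
    rw [h3] at hvv
    simp at hvv
  · have h1 : ((z - (z - z * p))ᵀ * (z - (z - z * p))).trace = l := by
      rw [sub_sub_cancel, Matrix.transpose_mul, hpt, Matrix.mul_assoc, Matrix.trace_mul_comm,
        Matrix.mul_assoc, Matrix.mul_assoc, hpp, ← Matrix.mul_assoc, hp, Matrix.mul_vecMulVec, hAv,
        Matrix.trace_vecMulVec, smul_dotProduct, hvv]
      simp
    rw [h1, hA.isHermitian.det_eq_prod_eigenvalues]
    have := Finset.prod_le_prod (s := Finset.univ) (f := fun _ : Fin m => l)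
      (g := hA.isHermitian.eigenvalues) (fun _ _ => hl0) fun j _ => hi j
    simpa using this

/-- A Schwartz function which vanishes near the singular matrices is dominated by every power
of the determinant. -/
theorem schwartz_flat_bound {n m : ℕ} (hm : 1 ≤ m) (G : 𝓢(EMat n m, ℂ))
    (h0 : ∀ z : Mat n m, ¬ (zᵀ * z).PosDef → (G : EMat n m → ℂ) =ᶠ[𝓝 (flat z)] 0) (e M : ℕ) :
    ∃ C : ℝ, 0 ≤ C ∧ ∀ z : Mat n m, ‖G (flat z)‖ ≤ C * (absDet z ^ e * wt M z) := by
  obtain ⟨C₁, hC₁, hd⟩ := rapidDecay_schwartz G M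
  set C₂ : ℝ := 2 ^ (2 * M) *
    ((Finset.Iic (2 * M, m * e)).sup fun q => SchwartzMap.seminorm ℝ q.1 q.2) G with hC₂
  have hC₂0 : 0 ≤ C₂ := by positivity
  have hdec : ∀ v : EMat n m, ‖iteratedFDeriv ℝ (m * e) G v‖ ≤ C₂ * ((1 + ‖v‖) ^ (2 * M))⁻¹ := by
    intro v
    have h := SchwartzMap.one_add_le_sup_seminorm_apply (𝕜 := ℝ) (m := (2 * M, m * e)) le_rfl
      le_rfl G v
    rw [← div_eq_mul_inv, le_div_iff₀ (by positivity), mul_comm]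
    exact h
  clear_value C₂
  -- `C₁` serves the matrices far from their singular approximation, `C₂ 4^M` the near ones; the
  -- `4^M` compares the weights at points within distance `1`.
  refine ⟨max C₁ (C₂ * 4 ^ M), by positivity, fun z => ?_⟩
  obtain ⟨z₀, hz₀, hdet⟩ := exists_singular_approx hm z
  set l := ((z - z₀)ᵀ * (z - z₀)).trace with hl
  have hl0 : 0 ≤ l := gram_trace_nonneg _
  have hln : ‖flat z - flat z₀‖ ^ 2 = l := by
    rw [hl, ← norm_flat_sq]
    congr 2
  have hw := wt_pos M z
  have hdet2 : ‖flat z - flat z₀‖ ^ m ≤ absDet z := by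
    rw [absDet]
    refine Real.le_sqrt_of_sq_le ?_
    rw [← pow_mul, mul_comm, pow_mul, hln]
    exact hdet
  have ha0 := absDet_nonneg z
  -- Near a singular matrix, the Taylor bound of order `me` is used, since distance to the power `m`
  -- is at most `|z|_m`. Farther than `1` from it, `|z|_m ≥ 1` and rapid decay alone suffices.
  rcases le_or_gt ‖flat z - flat z₀‖ 1 with h1 | h1
  · have hz : ∀ j < m * e, iteratedFDeriv ℝ j G (flat z₀) = 0 := fun j _ => by
      have := ((h0 z₀ hz₀).iteratedFDeriv ℝ j).eq_of_nhds
      rw [this]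
      simp
    have hsegm : ∀ y ∈ segment ℝ (flat z₀) (flat z),
        ‖iteratedFDeriv ℝ (m * e) G y‖ ≤ C₂ * 4 ^ M * wt M z := fun y hy => by
      refine (hdec y).trans ?_
      rw [mul_assoc]
      refine mul_le_mul_of_nonneg_left ?_ hC₂0
      have h2 : ‖flat z - y‖ ≤ 1 := by
        have hy2 : y ∈ segment ℝ (flat z) (flat z₀) := segment_symm ℝ (flat z₀) (flat z) ▸ hy
        have h3 : y ∈ Metric.closedBall (flat z) 1 :=
          (convex_closedBall (flat z) 1).segment_subset (Metric.mem_closedBall_self zero_le_one)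
            (by rw [Metric.mem_closedBall, dist_comm, dist_eq_norm]; exact h1) hy2
        rwa [Metric.mem_closedBall, dist_comm, dist_eq_norm] at h3
      have h4 : ‖flat z‖ ≤ ‖y‖ + 1 := by
        have := norm_le_norm_add_norm_sub' (flat z) y
        linarith
      unfold wt
      rw [← norm_flat_sq, ← div_eq_mul_inv, inv_eq_one_div, div_le_div_iff₀ (by positivity)
        (by positivity), one_mul, pow_mul, ← mul_pow]
      gcongr
      nlinarith [norm_nonneg (flat z), norm_nonneg y]
    have h5 := norm_le_of_iteratedFDeriv_eq_zero (G.smooth ⊤) hz hsegm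
    refine h5.trans ?_
    rw [pow_mul]
    calc C₂ * 4 ^ M * wt M z * (‖flat z - flat z₀‖ ^ m) ^ e
        ≤ C₂ * 4 ^ M * wt M z * absDet z ^ e := by gcongr
      _ ≤ max C₁ (C₂ * 4 ^ M) * wt M z * absDet z ^ e := by
          gcongr
          exact le_max_right _ _
      _ = _ := by ring
  · refine (hd z).trans ?_
    have h2 : 1 ≤ absDet z ^ e := one_le_pow₀ ((one_le_pow₀ h1.le).trans hdet2)
    calc C₁ * wt M z ≤ max C₁ (C₂ * 4 ^ M) * wt M z := by
          gcongr
          exact le_max_left _ _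
      _ = max C₁ (C₂ * 4 ^ M) * (1 * wt M z) := by ring
      _ ≤ _ := by gcongr

/-! ### The Fourier transform of a wavelet and its symbol on the cone -/

theorem continuous_flat (n m : ℕ) : Continuous (flat : Mat n m → EMat n m) :=
  (flatL n m).toLinearMap.continuous_of_finiteDimensional

theorem integral_comp_flat {n m : ℕ} (F : EMat n m → ℂ) :
    ∫ x : Mat n m, F (flat x) = ∫ v, F v :=
  (measurePreserving_flatEquiv n m).integral_comp (flatEquiv n m).measurableEmbedding F

theorem integrable_comp_flat {n m : ℕ} (F : EMat n m → ℂ) :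
    Integrable (fun x : Mat n m => F (flat x)) ↔ Integrable F :=
  (measurePreserving_flatEquiv n m).integrable_comp_emb (flatEquiv n m).measurableEmbedding

/-- The Fourier transform with the kernel `exp(i⟨x, y⟩)`. -/
def angularFourier {n m : ℕ} (g : 𝓢(EMat n m, ℂ)) : 𝓢(EMat n m, ℂ) :=
  SchwartzMap.compCLMOfContinuousLinearEquiv ℂ
    (LinearEquiv.smulOfNeZero ℝ (EMat n m) (-(2 * Real.pi)⁻¹)
      (neg_ne_zero.mpr (inv_ne_zero (by positivity)))).toContinuousLinearEquiv (𝓕 g)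

/-- The transform `𝓕` has kernel `exp(-2πi⟨x, y⟩)`, so its argument is rescaled by `-(2π)⁻¹`. In
particular the transform of a Schwartz function in the present normalization is a Schwartz function.
-/
theorem fourier_eq_angularFourier {n m : ℕ} (g : 𝓢(EMat n m, ℂ)) (y : Mat n m) :
    fourier (fun x => g (flat x)) y = angularFourier g (flat y) := by
  have h1 : angularFourier g (flat y) = 𝓕 (g : EMat n m → ℂ) (-(2 * Real.pi)⁻¹ • flat y) := rfl
  have hpi : Real.pi ≠ 0 := Real.pi_ne_zero
  rw [h1, Real.fourier_eq, fourier, ← integral_comp_flat]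
  refine integral_congr_ae (Eventually.of_forall fun x => ?_)
  beta_reduce
  rw [Circle.smul_def, Real.fourierChar_apply, smul_eq_mul, inner_smul_right, inner_flat]
  congr 2
  have h2 : (xᵀ * y).trace = (yᵀ * x).trace := by
    rw [← Matrix.trace_transpose, Matrix.transpose_mul, Matrix.transpose_transpose]
  have h3 : 2 * Real.pi * -(-(2 * Real.pi)⁻¹ * (xᵀ * y).trace) = (yᵀ * x).trace := by
    rw [h2]
    field_simp
  rw [h3, mul_comm]

theorem continuous_fourier {n m : ℕ} {w : Mat n m → ℂ} (hw : IsSchwartz w) :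
    Continuous (fourier w) := by
  obtain ⟨g, rfl⟩ := hw.exists_flat
  have h : fourier (fun x : Mat n m => g (flat x)) = fun y => angularFourier g (flat y) :=
    funext (fourier_eq_angularFourier g)
  rw [h]
  exact (angularFourier g).continuous.comp (continuous_flat n m)

theorem dense_gram_posDef {n m : ℕ} (hmn : m ≤ n) : Dense {y : Mat n m | (yᵀ * y).PosDef} :=
  Measure.dense_of_ae (ae_gram_posDef hmn)

theorem rank_eq_of_gram_posDef {n m : ℕ} {y : Mat n m} (h : (yᵀ * y).PosDef) : y.rank = m := by
  rw [← Matrix.rank_transpose_mul_self, Matrix.rank_of_isUnit _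
    ((Matrix.isUnit_iff_isUnit_det _).mpr h.det_pos.ne'.isUnit), Fintype.card_fin]

/-- The symmetric function on the cone representing the Fourier transform of a wavelet. -/
def coneSymbol {n m : ℕ} (w : Mat n m → ℂ) (r : Mat m m) : ℂ := fourier w (gramSection n r)

theorem measurable_coneSymbol {n m : ℕ} {w : Mat n m → ℂ} (hw : IsSchwartz w) :
    Measurable (coneSymbol w) :=
  (measurable_of_continuous (continuous_fourier hw)).comp (measurable_gramSection n m)

section

variable {n m k : ℕ} {w : Mat n m → ℂ}

/-- `coneSymbol` agrees with `u₀` on the cone and, unlike an arbitrary `u₀`, is measurable on all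
matrices. -/
theorem IsRieszWavelet.fourier_eq_coneSymbol (hw : IsRieszWavelet k w) (hmn : m ≤ n) {y : Mat n m}
    (hy : (yᵀ * y).PosDef) : fourier w y = coneSymbol w (yᵀ * y) := by
  obtain ⟨u₀, -, -, h⟩ := hw.fourier_radial
  have hg := gram_gramSection hmn hy.posSemidef
  rw [coneSymbol, h y (rank_eq_of_gram_posDef hy), h _ (rank_eq_of_gram_posDef (hg.symm ▸ hy)), hg]

theorem IsRieszWavelet.coneSymbol_symm (hw : IsRieszWavelet k w) (hmn : m ≤ n) {r s : Mat m m}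
    (hr : r.PosDef) (hs : s.PosDef) :
    coneSymbol w (CFC.sqrt s * r * CFC.sqrt s) = coneSymbol w (CFC.sqrt r * s * CFC.sqrt r) := by
  obtain ⟨u₀, hsym, -, h⟩ := hw.fourier_radial
  have hu : ∀ r : Mat m m, r.PosDef → coneSymbol w r = u₀ r := fun r hr => by
    have hg := gram_gramSection hmn hr.posSemidef
    rw [coneSymbol, h _ (rank_eq_of_gram_posDef (hg.symm ▸ hr)), hg]
  have hp : ∀ {r s : Mat m m}, r.PosDef → s.PosDef → (CFC.sqrt s * r * CFC.sqrt s).PosDef :=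
    fun {r s} hr hs => by
      have := (posDef_congr_iff (det_sqrt_ne_zero hs)).mpr hr
      rwa [sqrt_transpose] at this
  rw [hu _ (hp hr hs), hu _ (hp hs hr), hsym r s hr hs]

/-- Around a singular `z` all Gram matrices stay in the neighborhood `U` of the boundary, so `Fw`
vanishes at the matrices of full rank there. These are dense, and by continuity `Fw` vanishes near
`z`; `schwartz_flat_bound` applies. -/
theorem IsRieszWavelet.fourier_bound (hw : IsRieszWavelet k w) (hm : 1 ≤ m) (hmn : m ≤ n)
    (e M : ℕ) : ∃ C : ℝ, 0 ≤ C ∧ ∀ z : Mat n m, ‖fourier w z‖ ≤ C * (absDet z ^ e * wt M z) := by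
  obtain ⟨g, rfl⟩ := hw.schwartz.exists_flat
  simp only [fourier_eq_angularFourier]
  refine schwartz_flat_bound hm _ (fun z hz => ?_) e M
  obtain ⟨u₀, -, ⟨U, hU, hsing, h0⟩, h⟩ := hw.fourier_radial
  have hzU : zᵀ * z ∈ U := hsing ⟨gram_posSemidef z, hz⟩
  set V : Set (Mat n m) := {y | yᵀ * y ∈ U} with hV
  have hVo : IsOpen V := hU.preimage (by fun_prop : Continuous fun y : Mat n m => yᵀ * y)
  have hzero : ∀ y ∈ V, angularFourier g (flat y) = 0 := by
    have hcl : IsClosed {y : Mat n m | angularFourier g (flat y) = 0} :=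
      isClosed_eq ((angularFourier g).continuous.comp (continuous_flat n m)) continuous_const
    intro y hy
    have h1 : V ∩ {y : Mat n m | (yᵀ * y).PosDef} ⊆ {y : Mat n m | angularFourier g (flat y) = 0} :=
      fun y hy => by
        have h2 := h y (rank_eq_of_gram_posDef hy.2)
        rw [fourier_eq_angularFourier] at h2
        rw [Set.mem_ofPred_eq, h2]
        exact h0 _ hy.1 hy.2
    exact hcl.closure_subset_iff.mpr h1 ((dense_gram_posDef hmn).open_subset_closure_inter hVo hy)
  have hcont : Continuous (flatL n m).symm :=
    (flatL n m).symm.toLinearMap.continuous_of_finiteDimensional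
  have hpre : (flatL n m).symm ⁻¹' V ∈ 𝓝 (flat z) := by
    refine (hVo.preimage hcont).mem_nhds ?_
    change (flatL n m).symm (flatL n m z) ∈ V
    rw [LinearEquiv.symm_apply_apply]
    exact hzU
  filter_upwards [hpre] with v hv
  have := hzero _ hv
  rwa [← flatL_apply, LinearEquiv.apply_symm_apply] at this

theorem IsRieszWavelet.integrable_dwIntegrand (hw : IsRieszWavelet k w) (hm : 1 ≤ m)
    (hmn : m ≤ n) : Integrable (dwIntegrand k w) := by
  -- The power `n + k` cancels the denominator and the weight keeps the quotient integrable. At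
  -- `|z|_m = 0` the quotient is `0` by convention.
  obtain ⟨C, hC, h⟩ := hw.fourier_bound hm hmn (n + k) (n * m + 1)
  have hmeas : Measurable (dwIntegrand k w) :=
    (measurable_of_continuous (continuous_fourier hw.schwartz)).div
      (Complex.measurable_ofReal.comp ((measurable_of_continuous (continuous_absDet n m)).pow_const _))
  refine ((integrable_wt (n := n) (m := m) (N := n * m + 1) (by omega)).const_mul C).mono'
    hmeas.aestronglyMeasurable (Eventually.of_forall fun z => ?_)
  have ha := absDet_nonneg z
  have hwt := wt_pos (n * m + 1) z
  rw [dwIntegrand, norm_div, Complex.norm_real, Real.norm_eq_abs, abs_of_nonneg (by positivity)]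
  refine div_le_of_le_mul₀ (by positivity) (by positivity) ((h z).trans (le_of_eq (by ring)))

/-- The image of Lebesgue measure under `y ↦ y'y`. -/
theorem map_gram_volume (hmn : m ≤ n) :
    (volume : Measure (Mat n m)).map (fun y => yᵀ * y) = (coneInvMeasure m).withDensity
      fun r => ENNReal.ofReal (polarConst n m * r.det ^ ((n : ℝ) / 2)) := by
  have hd : Measurable fun r : Mat m m => ENNReal.ofReal (polarConst n m * r.det ^ ((n : ℝ) / 2)) :=
    ((measurable_det_rpow _).const_mul _).ennreal_ofReal
  refine Measure.ext fun s hs => ?_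
  have hind : Measurable (s.indicator (1 : Mat m m → ENNReal)) := measurable_one.indicator hs
  rw [← lintegral_indicator_one hs, lintegral_map hind (measurable_gram n m), lintegral_gram hmn hind,
    ← lintegral_indicator_one hs, lintegral_withDensity_eq_lintegral_mul _ hd hind,
    ← lintegral_const_mul' _ _ ENNReal.ofReal_ne_top]
  refine lintegral_congr fun r => ?_
  rw [Pi.mul_apply, ENNReal.ofReal_mul (polarConst_pos hmn).le, mul_assoc]

theorem absDet_rpow_gram {y : Mat n m} (hy : (yᵀ * y).PosDef) (e : ℕ) :
    (yᵀ * y).det ^ ((e : ℝ) / 2) = absDet y ^ e := by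
  rw [absDet, Real.sqrt_eq_rpow, ← Real.rpow_natCast, ← Real.rpow_mul hy.det_pos.le]
  congr 1
  ring

/-- The integral `d_w(k)` as an integral over the cone. -/
theorem IsRieszWavelet.dw_eq (hw : IsRieszWavelet k w) (hm : 1 ≤ m) (hmn : m ≤ n) :
    Integrable (fun s : Mat m m => ((s.det ^ (-(k : ℝ) / 2) : ℝ) : ℂ) * coneSymbol w s)
      (coneInvMeasure m) ∧
    dw k w = ∫ s, ((s.det ^ (-(k : ℝ) / 2) : ℝ) : ℂ) * coneSymbol w s ∂(coneInvMeasure m) := by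
  have hp := polarConst_pos hmn
  set Φ : Mat m m → ℂ := fun s =>
    coneSymbol w s * ((s.det ^ (-((n : ℝ) + k) / 2) : ℝ) : ℂ) with hΦ
  have hΦm : Measurable Φ := (measurable_coneSymbol hw.schwartz).mul
    (Complex.measurable_ofReal.comp (measurable_det_rpow _))
  have hd : Measurable fun r : Mat m m =>
      (ENNReal.ofReal (polarConst n m * r.det ^ ((n : ℝ) / 2))) :=
    ((measurable_det_rpow _).const_mul _).ennreal_ofReal
  have hd' : ∀ᵐ r ∂(coneInvMeasure m),
      ENNReal.ofReal (polarConst n m * r.det ^ ((n : ℝ) / 2)) < ⊤ :=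
    Eventually.of_forall fun r => ENNReal.ofReal_lt_top
  have hae : dwIntegrand k w =ᵐ[volume] fun y => Φ (yᵀ * y) := by
    filter_upwards [ae_gram_posDef hmn] with y hy
    have h1 : (yᵀ * y).det ^ (-((n : ℝ) + k) / 2) = (absDet y ^ (n + k))⁻¹ := by
      rw [← absDet_rpow_gram hy, ← Real.rpow_neg hy.det_pos.le]
      congr 1
      push_cast
      ring
    rw [dwIntegrand, hw.fourier_eq_coneSymbol hmn hy]
    change _ = coneSymbol w (yᵀ * y) * (((yᵀ * y).det ^ (-((n : ℝ) + k) / 2) : ℝ) : ℂ)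
    rw [h1, div_eq_mul_inv]
    push_cast
    rfl
  -- The exponent `-(n+k)/2` of the integrand and `n/2` of the polar density add up to `-k/2`.
  have hsm : ∀ᵐ r ∂(coneInvMeasure m),
      (ENNReal.ofReal (polarConst n m * r.det ^ ((n : ℝ) / 2))).toReal • Φ r =
        ((polarConst n m : ℝ) : ℂ) * (((r.det ^ (-(k : ℝ) / 2) : ℝ) : ℂ) * coneSymbol w r) := by
    filter_upwards [ae_coneInv_posDef m] with r hr
    have hr0 := hr.det_pos
    have h2 : r.det ^ ((n : ℝ) / 2) * r.det ^ (-((n : ℝ) + k) / 2) = r.det ^ (-(k : ℝ) / 2) := by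
      rw [← Real.rpow_add hr0]
      congr 1
      ring
    rw [ENNReal.toReal_ofReal (by positivity), ← h2, hΦ, Complex.real_smul]
    push_cast
    ring
  have hint := hw.integrable_dwIntegrand hm hmn
  have h1 : Integrable Φ ((volume : Measure (Mat n m)).map (fun y => yᵀ * y)) :=
    (integrable_map_measure hΦm.aestronglyMeasurable (measurable_gram n m).aemeasurable).mpr
      (hint.congr hae)
  rw [map_gram_volume hmn, integrable_withDensity_iff_integrable_smul' hd hd'] at h1
  have h2 := h1.congr hsm
  have hpc : ((polarConst n m : ℝ) : ℂ) ≠ 0 := by exact_mod_cast hp.ne'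
  refine ⟨by simpa only [← mul_assoc, inv_mul_cancel₀ hpc, one_mul] using
    h2.const_mul ((polarConst n m : ℝ) : ℂ)⁻¹, ?_⟩
  have h3 : ∫ y, dwIntegrand k w y = ((polarConst n m : ℝ) : ℂ) *
      ∫ s, ((s.det ^ (-(k : ℝ) / 2) : ℝ) : ℂ) * coneSymbol w s ∂(coneInvMeasure m) := by
    rw [integral_congr_ae hae, ← integral_map (measurable_gram n m).aemeasurable
      hΦm.aestronglyMeasurable, map_gram_volume hmn, integral_withDensity_eq_integral_toReal_smul
      hd hd', integral_congr_ae hsm, integral_const_mul]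
  rw [dw, h3, sigma_eq, ← mul_assoc, ← Complex.ofReal_mul]
  -- The normalization `2^m / σ_{n,m}` is the inverse of the polar constant.
  have h4 : (2 : ℝ) ^ m / (2 ^ m * polarConst n m) * polarConst n m = 1 := by
    field_simp
  rw [h4, Complex.ofReal_one, one_mul]

end

/-! ### The Fourier transform of the mean plane measure -/

theorem stack_transpose_mul_stack {n k m : ℕ} (hk : k ≤ n) (ω ω' : Mat k m)
    (t t' : Mat (n - k) m) :
    (stack ω t : Mat n m)ᵀ * (stack ω' t' : Mat n m) = ωᵀ * ω' + tᵀ * t' := by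
  ext i j
  simp only [Matrix.mul_apply, Matrix.add_apply, Matrix.transpose_apply]
  rw [← (stackIndex hk).sum_comp, Fintype.sum_sum_type]
  simp only [stack_stackIndex_inl, stack_stackIndex_inr]

theorem wt_stack_le_left {n k m : ℕ} (hk : k ≤ n) (N : ℕ) (ω : Mat k m) (t : Mat (n - k) m) :
    wt N (stack ω t : Mat n m) ≤ wt N ω := by
  have h1 := gram_trace_nonneg ω
  have h2 := gram_trace_nonneg t
  unfold wt
  rw [gram_stack hk, Matrix.trace_add]
  gcongr
  linarith

theorem wt_stack_le_right {n k m : ℕ} (hk : k ≤ n) (N : ℕ) (ω : Mat k m) (t : Mat (n - k) m) :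
    wt N (stack ω t : Mat n m) ≤ wt N t := by
  have h1 := gram_trace_nonneg ω
  have h2 := gram_trace_nonneg t
  unfold wt
  rw [gram_stack hk, Matrix.trace_add]
  gcongr
  linarith

theorem RapidDecay.translate {n m : ℕ} {G : Mat n m → ℂ} (hG : RapidDecay G) (x : Mat n m) :
    RapidDecay fun y => G (x + y) := by
  intro N
  obtain ⟨C, hC, h⟩ := hG N
  have hx := wt_pos N x
  refine ⟨C * (2 ^ N * (wt N x)⁻¹), by positivity, fun y => (h _).trans ?_⟩
  rw [mul_assoc]
  refine mul_le_mul_of_nonneg_left ?_ hC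
  have h1 := wt_mul_wt_le N (x + y) x
  rw [add_sub_cancel_left] at h1
  rwa [mul_right_comm, ← div_eq_mul_inv, le_div_iff₀ hx]

theorem RapidDecay.orthogonal_mul {n m : ℕ} {G : Mat n m → ℂ} (hG : RapidDecay G)
    (γ : Matrix.orthogonalGroup (Fin n) ℝ) : RapidDecay fun y : Mat n m => G ((γ : Mat n n) * y) := by
  intro N
  obtain ⟨C, hC, h⟩ := hG N
  refine ⟨C, hC, fun y => (h _).trans_eq ?_⟩
  rw [wt_orthogonal_mul]

theorem RapidDecay.integrable {n m : ℕ} {G : Mat n m → ℂ} (hG : RapidDecay G)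
    (hGm : Measurable G) : Integrable G := by
  obtain ⟨C, -, h⟩ := hG (n * m + 1)
  exact ((integrable_wt (by omega)).const_mul C).mono' hGm.aestronglyMeasurable
    (Eventually.of_forall h)

section

variable {n k m : ℕ} {G : Mat n m → ℂ}

theorem continuous_stack_left (n k m : ℕ) (t : Mat (n - k) m) :
    Continuous fun ω : Mat k m => (stack ω t : Mat n m) :=
  (continuous_stack m).comp (continuous_id.prodMk continuous_const)

theorem continuous_stack_right (n k m : ℕ) (ω : Mat k m) :
    Continuous fun t : Mat (n - k) m => (stack ω t : Mat n m) :=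
  (continuous_stack m).comp (continuous_const.prodMk continuous_id)

theorem continuous_integral_stack (hk : k ≤ n) (hGc : Continuous G) (hG : RapidDecay G) :
    Continuous fun t : Mat (n - k) m => ∫ ω : Mat k m, G (stack ω t) := by
  obtain ⟨C, hC, h⟩ := hG (k * m + 1)
  refine continuous_of_dominated (bound := fun ω : Mat k m => C * wt (k * m + 1) ω)
    (fun t => ?_) (fun t => Eventually.of_forall fun ω => ?_)
    ((integrable_wt (by omega)).const_mul C) (Eventually.of_forall fun ω => ?_)
  · exact (hGc.comp (continuous_stack_left n k m t)).aestronglyMeasurable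
  · exact (h _).trans (mul_le_mul_of_nonneg_left (wt_stack_le_left hk _ ω t) hC)
  · exact hGc.comp (continuous_stack_right n k m ω)

theorem integrable_stack (hk : k ≤ n) (hGm : Measurable G) (hG : RapidDecay G) :
    Integrable fun p : Mat k m × Mat (n - k) m => G (stack p.1 p.2) :=
  ((measurePreserving_stackEquiv hk m).integrable_comp_emb
    (stackEquiv hk m).measurableEmbedding).mpr (hG.integrable hGm)

theorem integral_stack (hk : k ≤ n) (F : Mat n m → ℂ) :
    ∫ p : Mat k m × Mat (n - k) m, F (stack p.1 p.2) = ∫ y, F y :=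
  (measurePreserving_stackEquiv hk m).integral_comp (stackEquiv hk m).measurableEmbedding F

/-- The integral over a coordinate plane in terms of the Fourier transform: the projection-slice
theorem combined with Fourier inversion. -/
theorem integral_stack_zero_eq (hk : k ≤ n) (hGc : Continuous G) (hG : RapidDecay G)
    (hF : RapidDecay fun y : Mat n m =>
      ∫ x : Mat n m, (𝐞 (-(xᵀ * y).trace) : ℂ) * G x) :
    ∫ ω : Mat k m, G (stack ω 0) =
      ∫ τ : Mat (n - k) m, ∫ x : Mat n m,
        (𝐞 (-(xᵀ * (stack (0 : Mat k m) τ : Mat n m)).trace) : ℂ) * G x := by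
  have hGm := measurable_of_continuous hGc
  -- The marginal of `G` over `ω`. By Fubini its Fourier transform is that of `G` restricted to the
  -- frequencies `[0; τ]`.
  set H : EMat (n - k) m → ℂ := fun v => ∫ ω : Mat k m, G (stack ω ((flatL (n - k) m).symm v))
    with hH
  have hsymm : ∀ t : Mat (n - k) m, (flatL (n - k) m).symm (flat t) = t := fun t =>
    (flatL (n - k) m).symm_apply_apply t
  have hHflat : ∀ t, H (flat t) = ∫ ω : Mat k m, G (stack ω t) := fun t => by
    simp only [hH, hsymm]
  have hHc : Continuous H := (continuous_integral_stack hk hGc hG).comp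
    (flatL (n - k) m).symm.toLinearMap.continuous_of_finiteDimensional
  have hHi : Integrable H := by
    rw [← integrable_comp_flat]
    simp only [hHflat]
    exact (integrable_stack hk hGm hG).integral_prod_right
  have hft : ∀ τ : Mat (n - k) m, 𝓕 H (flat τ) = ∫ x : Mat n m,
      (𝐞 (-(xᵀ * (stack (0 : Mat k m) τ : Mat n m)).trace) : ℂ) * G x := fun τ => by
    rw [Real.fourier_eq, ← integral_comp_flat, ← integral_stack hk]
    have hi : Integrable fun p : Mat k m × Mat (n - k) m =>
        (𝐞 (-((stack p.1 p.2 : Mat n m)ᵀ * (stack (0 : Mat k m) τ : Mat n m)).trace) : ℂ) *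
          G (stack p.1 p.2) := by
      refine (integrable_stack hk hGm hG).bdd_mul (c := 1) ?_ (Eventually.of_forall fun p => ?_)
      · refine Continuous.aestronglyMeasurable ?_
        have h1 : Continuous fun p : Mat k m × Mat (n - k) m => (stack p.1 p.2 : Mat n m) :=
          continuous_stack m
        have h2 : Continuous fun p : Mat k m × Mat (n - k) m =>
            -((stack p.1 p.2 : Mat n m)ᵀ * (stack (0 : Mat k m) τ : Mat n m)).trace := by
          fun_prop
        exact continuous_subtype_val.comp (Real.continuous_fourierChar.comp h2)
      · rw [Circle.norm_coe]
    rw [Measure.volume_eq_prod, integral_prod_symm _ hi]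
    refine integral_congr_ae (Eventually.of_forall fun t => ?_)
    beta_reduce
    rw [hHflat, Circle.smul_def, smul_eq_mul, inner_flat, ← integral_const_mul]
    simp only [stack_transpose_mul_stack hk, Matrix.mul_zero, zero_add]
  have hFi : Integrable (𝓕 H) := by
    obtain ⟨C, hC, h⟩ := hF ((n - k) * m + 1)
    rw [← integrable_comp_flat]
    refine ((integrable_wt (n := n - k) (m := m) (N := (n - k) * m + 1)
      (by omega)).const_mul C).mono' ?_ (Eventually.of_forall fun τ => ?_)
    · have h1 : Continuous (𝓕 H) :=
        VectorFourier.fourierIntegral_continuous Real.continuous_fourierChar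
          (by exact continuous_inner) hHi
      exact (h1.comp (continuous_flat _ _)).aestronglyMeasurable
    · rw [hft]
      exact (h _).trans (mul_le_mul_of_nonneg_left (wt_stack_le_right hk _ 0 τ) hC)
  -- Inversion at the origin: `H(0)` is the integral of its Fourier transform.
  have hinv := hHi.fourierInv_fourier_eq hFi (v := 0) hHc.continuousAt
  rw [Real.fourierInv_eq] at hinv
  simp only [inner_zero_right, AddChar.map_zero_eq_one, one_smul] at hinv
  have h0 : (0 : EMat (n - k) m) = flat 0 := rfl
  rw [← integral_comp_flat, h0, hHflat] at hinv
  rw [← hinv]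
  exact integral_congr_ae (Eventually.of_forall hft)

end

theorem integral_fourierChar_mul_flat {n m : ℕ} (g : 𝓢(EMat n m, ℂ)) (y : Mat n m) :
    ∫ x : Mat n m, (𝐞 (-(xᵀ * y).trace) : ℂ) * g (flat x) = 𝓕 (g : EMat n m → ℂ) (flat y) := by
  rw [Real.fourier_eq, ← integral_comp_flat]
  simp only [Circle.smul_def, smul_eq_mul, inner_flat]

theorem integral_affine_orthogonal {n m : ℕ} (γ : Matrix.orthogonalGroup (Fin n) ℝ) (x : Mat n m)
    (F : Mat n m → ℂ) : ∫ y : Mat n m, F (x + (γ : Mat n n) * y) = ∫ y, F y := by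
  have hemb : MeasurableEmbedding fun y : Mat n m => (γ : Mat n n) * y :=
    Continuous.measurableEmbedding (by fun_prop) (orthogonal_mul_injective γ)
  rw [(measurePreserving_orthogonal m γ).integral_comp hemb fun y => F (x + y),
    integral_add_left_eq_self F x]

theorem integral_fourierChar_mul_affine {n m : ℕ} (g : 𝓢(EMat n m, ℂ))
    (γ : Matrix.orthogonalGroup (Fin n) ℝ) (x y : Mat n m) :
    ∫ u : Mat n m, (𝐞 (-(uᵀ * y).trace) : ℂ) * g (flat (x + (γ : Mat n n) * u)) =
      (𝐞 ((xᵀ * ((γ : Mat n n) * y)).trace) : ℂ) *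
        𝓕 (g : EMat n m → ℂ) (flat ((γ : Mat n n) * y)) := by
  rw [← integral_fourierChar_mul_flat, ← integral_const_mul]
  refine Eq.trans ?_ (integral_affine_orthogonal γ x _)
  refine integral_congr_ae (Eventually.of_forall fun u => ?_)
  beta_reduce
  have h1 : ((x + (γ : Mat n n) * u)ᵀ * ((γ : Mat n n) * y)).trace =
      (xᵀ * ((γ : Mat n n) * y)).trace + (uᵀ * y).trace := by
    have h2 : ((γ : Mat n n) * u)ᵀ * ((γ : Mat n n) * y) = uᵀ * y := by
      rw [Matrix.transpose_mul, Matrix.mul_assoc, ← Matrix.mul_assoc (γ : Mat n n)ᵀ,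
        orthogonal_transpose_mul, Matrix.one_mul]
    rw [Matrix.transpose_add, Matrix.add_mul, Matrix.trace_add, h2]
  rw [h1, ← mul_assoc, ← Circle.coe_mul, ← AddChar.map_add_eq_mul]
  congr 3
  ring

theorem rapidDecay_fourier {n m : ℕ} (g : 𝓢(EMat n m, ℂ)) :
    RapidDecay fun y : Mat n m => 𝓕 (g : EMat n m → ℂ) (flat y) :=
  rapidDecay_schwartz (𝓕 g)

theorem RapidDecay.char_mul {n m : ℕ} {G : Mat n m → ℂ} (hG : RapidDecay G) (c : Mat n m → ℝ) :
    RapidDecay fun y => (𝐞 (c y) : ℂ) * G y := by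
  intro N
  obtain ⟨C, hC, h⟩ := hG N
  refine ⟨C, hC, fun y => ?_⟩
  rw [norm_mul, Circle.norm_coe, one_mul]
  exact h y

/-- Projection-slice theorem for a rotated plane. -/
theorem integral_planeParam_eq {n k m : ℕ} (hk : k ≤ n) (g : 𝓢(EMat n m, ℂ))
    (γ : Matrix.orthogonalGroup (Fin n) ℝ) (x : Mat n m) :
    ∫ ω : Mat k m, g (flat (x + planeParam γ ω)) =
      ∫ τ : Mat (n - k) m,
        (𝐞 ((xᵀ * ((γ : Mat n n) * (stack (0 : Mat k m) τ : Mat n m))).trace) : ℂ) *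
          𝓕 (g : EMat n m → ℂ) (flat ((γ : Mat n n) * stack (0 : Mat k m) τ)) := by
  have hc : Continuous fun y : Mat n m => g (flat (x + (γ : Mat n n) * y)) :=
    g.continuous.comp ((continuous_flat n m).comp (by fun_prop))
  have hd : RapidDecay fun y : Mat n m => g (flat (x + (γ : Mat n n) * y)) :=
    ((rapidDecay_schwartz g).translate x).orthogonal_mul γ
  have hF : RapidDecay fun y : Mat n m =>
      (𝐞 ((xᵀ * ((γ : Mat n n) * y)).trace) : ℂ) *
        𝓕 (g : EMat n m → ℂ) (flat ((γ : Mat n n) * y)) :=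
    RapidDecay.char_mul (RapidDecay.orthogonal_mul (rapidDecay_fourier g) γ)
      fun y => (xᵀ * ((γ : Mat n n) * y)).trace
  have h := integral_stack_zero_eq (k := k) hk hc hd (by
    simpa only [integral_fourierChar_mul_affine] using hF)
  simp only [integral_fourierChar_mul_affine] at h
  exact h

instance instNegInvariantMat (n m : ℕ) : (volume : Measure (Mat n m)).IsNegInvariant :=
  inferInstanceAs (volume : Measure (Fin n → Fin m → ℝ)).IsNegInvariant

/-- The averaging formula as an identity of measures, so that integrability and values of complex
integrals can be transported as well. -/
theorem map_haarO_stack {n m k : ℕ} (hkn : k + m ≤ n) :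
    ((haarO n).prod (volume : Measure (Mat (n - k) m))).map
      (fun q => (q.1 : Mat n n) * stack (0 : Mat k m) q.2) =
    (volume : Measure (Mat n m)).withDensity fun y =>
      ENNReal.ofReal (polarConst (n - k) m / polarConst n m * (absDet y ^ k)⁻¹) := by
  have hk : k ≤ n := by omega
  have hm : Measurable fun q : Matrix.orthogonalGroup (Fin n) ℝ × Mat (n - k) m =>
      (q.1 : Mat n n) * (stack (0 : Mat k m) q.2 : Mat n m) :=
    measurable_matMul ((measurable_coe_orthogonal n).comp measurable_fst)
      ((measurable_stack_zero hk m).comp measurable_snd)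
  have ha : Measurable fun y : Mat n m => absDet y :=
    measurable_of_continuous (continuous_absDet n m)
  have hd : Measurable fun y : Mat n m =>
      ENNReal.ofReal (polarConst (n - k) m / polarConst n m * (absDet y ^ k)⁻¹) :=
    ((ha.pow_const k).inv.const_mul _).ennreal_ofReal
  have hc : 0 ≤ polarConst (n - k) m / polarConst n m :=
    (div_pos (polarConst_pos (by omega)) (polarConst_pos (by omega))).le
  refine Measure.ext fun s hs => ?_
  have hind : Measurable (s.indicator (1 : Mat n m → ENNReal)) := measurable_one.indicator hs
  have hmi : Measurable fun q : Matrix.orthogonalGroup (Fin n) ℝ × Mat (n - k) m =>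
      s.indicator (1 : Mat n m → ENNReal) ((q.1 : Mat n n) * stack (0 : Mat k m) q.2) :=
    hind.comp hm
  rw [← lintegral_indicator_one hs, lintegral_map hind hm, lintegral_prod _ hmi.aemeasurable,
    lintegral_haarO_lintegral_stack hkn hind, ← lintegral_indicator_one hs,
    lintegral_withDensity_eq_lintegral_mul _ hd hind, ← lintegral_const_mul' _ _
      ENNReal.ofReal_ne_top]
  refine lintegral_congr fun y => ?_
  rw [Pi.mul_apply, ENNReal.ofReal_mul hc, mul_assoc]

/-- The weighted Fourier representation of the convolution with the mean plane measure. -/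
theorem integral_meanPlane_eq {n m k : ℕ} (hkn : k + m ≤ n) (g : 𝓢(EMat n m, ℂ)) :
    Integrable (fun y : Mat n m => ((polarConst (n - k) m / polarConst n m *
      (absDet y ^ k)⁻¹ : ℝ) : ℂ) * 𝓕 (g : EMat n m → ℂ) (flat y)) ∧
    ∀ x : Mat n m, ∫ z, g (flat (x - z)) ∂(meanPlaneMeasure n m k) =
      ∫ y : Mat n m, ((polarConst (n - k) m / polarConst n m * (absDet y ^ k)⁻¹ : ℝ) : ℂ) *
        ((𝐞 ((xᵀ * y).trace) : ℂ) * 𝓕 (g : EMat n m → ℂ) (flat y)) := by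
  have hk : k ≤ n := by omega
  set κ := polarConst (n - k) m / polarConst n m with hκ
  have hκ0 : 0 < κ := div_pos (polarConst_pos (by omega)) (polarConst_pos (by omega))
  have ha : Measurable fun y : Mat n m => absDet y :=
    measurable_of_continuous (continuous_absDet n m)
  have hd : Measurable fun y : Mat n m => ENNReal.ofReal (κ * (absDet y ^ k)⁻¹) :=
    ((ha.pow_const k).inv.const_mul _).ennreal_ofReal
  have hd' : ∀ᵐ y : Mat n m, ENNReal.ofReal (κ * (absDet y ^ k)⁻¹) < ⊤ :=
    Eventually.of_forall fun _ => ENNReal.ofReal_lt_top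
  have hm : Measurable fun q : Matrix.orthogonalGroup (Fin n) ℝ × Mat (n - k) m =>
      (q.1 : Mat n n) * (stack (0 : Mat k m) q.2 : Mat n m) :=
    measurable_matMul ((measurable_coe_orthogonal n).comp measurable_fst)
      ((measurable_stack_zero hk m).comp measurable_snd)
  have hFc : Continuous fun y : Mat n m => 𝓕 (g : EMat n m → ℂ) (flat y) :=
    (𝓕 g).continuous.comp (continuous_flat n m)
  have hsmul : ∀ (F : Mat n m → ℂ) (y : Mat n m),
      (ENNReal.ofReal (κ * (absDet y ^ k)⁻¹)).toReal • F y =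
        ((κ * (absDet y ^ k)⁻¹ : ℝ) : ℂ) * F y := fun F y => by
    have := absDet_nonneg y
    rw [ENNReal.toReal_ofReal (by positivity), Complex.real_smul]
  have hmain : ∀ F : Mat n m → ℂ, Measurable F → RapidDecay F →
      Integrable (fun q : Matrix.orthogonalGroup (Fin n) ℝ × Mat (n - k) m =>
        F ((q.1 : Mat n n) * stack (0 : Mat k m) q.2)) ((haarO n).prod volume) := by
    intro F hF hFd
    obtain ⟨C, hC, h⟩ := hFd ((n - k) * m + 1)
    have hb := ((integrable_wt (n := n - k) (m := m) (N := (n - k) * m + 1)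
      (by omega)).const_mul C).comp_snd (haarO n)
    refine hb.mono' (hF.comp hm).aestronglyMeasurable (Eventually.of_forall fun q => ?_)
    refine (h _).trans (mul_le_mul_of_nonneg_left ?_ hC)
    rw [wt_orthogonal_mul]
    exact wt_stack_le_right hk _ 0 q.2
  have hF0 : ∀ F : Mat n m → ℂ, Measurable F → RapidDecay F →
      Integrable (fun y => ((κ * (absDet y ^ k)⁻¹ : ℝ) : ℂ) * F y) ∧
      ∫ γ, (∫ t : Mat (n - k) m, F ((γ : Mat n n) * stack (0 : Mat k m) t)) ∂(haarO n) =
        ∫ y : Mat n m, ((κ * (absDet y ^ k)⁻¹ : ℝ) : ℂ) * F y := by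
    intro F hF hFd
    have hi := hmain F hF hFd
    have hi2 := (integrable_map_measure hF.aestronglyMeasurable hm.aemeasurable).mpr hi
    rw [map_haarO_stack hkn, integrable_withDensity_iff_integrable_smul' hd hd'] at hi2
    simp only [hsmul] at hi2
    refine ⟨hi2, ?_⟩
    refine (integral_prod _ hi).symm.trans ?_
    rw [← integral_map hm.aemeasurable hF.aestronglyMeasurable, map_haarO_stack hkn,
      integral_withDensity_eq_integral_toReal_smul hd hd']
    simp only [hsmul]
  refine ⟨(hF0 _ (measurable_of_continuous hFc) (rapidDecay_fourier g)).1, fun x => ?_⟩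
  have hchar : Measurable fun y : Mat n m => (𝐞 ((xᵀ * y).trace) : ℂ) :=
    measurable_of_continuous (continuous_subtype_val.comp
      (Real.continuous_fourierChar.comp (by fun_prop)))
  rw [← (hF0 (fun y => (𝐞 ((xᵀ * y).trace) : ℂ) * 𝓕 (g : EMat n m → ℂ) (flat y))
    (hchar.mul (measurable_of_continuous hFc)) ((rapidDecay_fourier g).char_mul _)).2]
  -- The inner integral over the rotated frequency subspace is, by the projection-slice theorem, an
  -- integral of `g` over the rotated plane through `x`.
  simp only [← integral_planeParam_eq hk g _ x]
  have hpp := measurable_planeParam hk m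
  have hgm : Measurable fun z : Mat n m => g (flat (x - z)) :=
    measurable_of_continuous (g.continuous.comp ((continuous_flat n m).comp (by fun_prop)))
  have hgi : Integrable (fun q : Matrix.orthogonalGroup (Fin n) ℝ × Mat k m =>
      g (flat (x - planeParam q.1 q.2))) ((haarO n).prod volume) := by
    obtain ⟨C, hC, h⟩ := ((rapidDecay_schwartz g).translate x) (k * m + 1)
    have hb := ((integrable_wt (n := k) (m := m) (N := k * m + 1)
      (by omega)).const_mul C).comp_snd (haarO n)
    refine hb.mono' (hgm.comp hpp).aestronglyMeasurable (Eventually.of_forall fun q => ?_)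
    rw [sub_eq_add_neg]
    refine (h _).trans (mul_le_mul_of_nonneg_left ?_ hC)
    have hneg : wt (k * m + 1) (-(planeParam q.1 q.2) : Mat n m) =
        wt (k * m + 1) (planeParam q.1 q.2 : Mat n m) := by
      simp [wt]
    rw [hneg, planeParam, wt_orthogonal_mul]
    exact wt_stack_le_left hk _ q.2 0
  rw [meanPlaneMeasure, integral_map hpp.aemeasurable hgm.aestronglyMeasurable, integral_prod _ hgi]
  refine integral_congr_ae (Eventually.of_forall fun γ => ?_)
  beta_reduce
  -- The planes pass through the origin, so `ω ↦ -ω` exchanges `x - z` and `x + z`.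
  rw [← integral_neg_eq_self]
  refine integral_congr_ae (Eventually.of_forall fun ω => ?_)
  beta_reduce
  have : (stack (-ω) (0 : Mat (n - k) m) : Mat n m) = -stack ω 0 := by
    have h := stack_add (n := n) ω (-ω) (0 : Mat (n - k) m) 0
    have h0 : (stack (0 : Mat k m) (0 : Mat (n - k) m) : Mat n m) = 0 := by
      ext i j
      simp [stack]
    rw [add_neg_cancel, add_zero, h0] at h
    exact (neg_eq_of_add_eq_zero_right h.symm).symm
  rw [planeParam, planeParam, this, Matrix.mul_neg, sub_neg_eq_add]

/-! ### The Fourier multiplier of the truncated integral -/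

/-- The Fourier multiplier of the truncated integral. -/
def truncSymbol {n m : ℕ} (k : ℕ) (w : Mat n m → ℂ) (ε ρ : ℝ) (ξ : Mat n m) : ℂ :=
  ∫ s in loewnerIoo (ε • ((2 * Real.pi) ^ 2 • (ξᵀ * ξ))) (ρ • ((2 * Real.pi) ^ 2 • (ξᵀ * ξ))),
    ((s.det ^ (-(k : ℝ) / 2) : ℝ) : ℂ) * coneSymbol w s ∂(coneInvMeasure m)

theorem measurable_fourierChar_trace {α : Type*} [MeasurableSpace α] {n m : ℕ} {f g : α → Mat n m}
    (hf : Measurable f) (hg : Measurable g) :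
    Measurable fun a => (𝐞 (((f a)ᵀ * g a).trace) : ℂ) := by
  have h1 : Measurable fun a => (f a)ᵀ * g a := measurable_matMul
    ((measurable_of_continuous (f := fun y : Mat n m => yᵀ) (by fun_prop)).comp hf) hg
  have h2 : Continuous fun y : Mat m m => (𝐞 y.trace : ℂ) :=
    continuous_subtype_val.comp (Real.continuous_fourierChar.comp (by fun_prop))
  exact (measurable_of_continuous h2).comp h1

theorem fourierChar_eq_exp (t : ℝ) : (𝐞 t : ℂ) = Complex.exp (Complex.I * ((2 * Real.pi * t : ℝ) : ℂ)) := by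
  rw [Real.fourierChar_apply, mul_comm]

theorem integral_fourierChar_mul_sqrt {n m : ℕ} (w : Mat n m → ℂ) (a : Mat m m) (ξ : Mat n m) :
    ∫ y : Mat n m, w y * (𝐞 (((y * CFC.sqrt a)ᵀ * ξ).trace) : ℂ) =
      fourier w (((2 * Real.pi) • ξ) * CFC.sqrt a) := by
  rw [fourier]
  refine integral_congr_ae (Eventually.of_forall fun y => ?_)
  beta_reduce
  have h : (((2 * Real.pi) • ξ * CFC.sqrt a)ᵀ * y).trace =
      2 * Real.pi * ((y * CFC.sqrt a)ᵀ * ξ).trace := by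
    rw [← Matrix.trace_transpose, Matrix.transpose_mul, Matrix.transpose_transpose,
      Matrix.smul_mul, Matrix.mul_smul, Matrix.trace_smul, smul_eq_mul, Matrix.transpose_mul,
      sqrt_transpose, ← Matrix.mul_assoc, Matrix.trace_mul_comm, ← Matrix.mul_assoc]
  rw [h, fourierChar_eq_exp, mul_comm]

/-- The power of `2π` comes from the passage to the frequency scale of `𝓕`, and the ratio of polar
constants from averaging over rotated subspaces. -/
theorem cConst_eq {n m k : ℕ} (hkn : k + m ≤ n) :
    cConst n k m = (2 * Real.pi) ^ (k * m) * (polarConst (n - k) m / polarConst n m) := by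
  have h1 := siegelGamma_pos (n := n) (m := m) (by omega)
  have h2 := siegelGamma_pos (n := n - k) (m := m) (by omega)
  have hnk : ((n - k : ℕ) : ℝ) = n - k := by rw [Nat.cast_sub (by omega)]
  have hpi := Real.pi_pos
  have h3 : Real.pi ^ ((n : ℝ) * m / 2) =
      Real.pi ^ (((n : ℝ) - k) * m / 2) * Real.pi ^ ((k : ℝ) * m / 2) := by
    rw [← Real.rpow_add hpi]
    congr 1
    ring
  have h4 : Real.pi ^ (k * m) = Real.pi ^ ((k : ℝ) * m / 2) * Real.pi ^ ((k : ℝ) * m / 2) := by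
    rw [← Real.rpow_add hpi, ← Real.rpow_natCast]
    congr 1
    push_cast
    ring
  have h5 := Real.rpow_pos_of_pos hpi ((k : ℝ) * m / 2)
  have h6 := Real.rpow_pos_of_pos hpi (((n : ℝ) - k) * m / 2)
  rw [hnk] at h2
  rw [cConst, polarConst, polarConst, hnk, mul_pow, h3, h4]
  field_simp

section

variable {n m k : ℕ} {w : Mat n m → ℂ}

/-- Put `r = (2π)² ξ'ξ`. The Gram matrix of `2πξ a^{1/2}` is `a^{1/2} r a^{1/2}`, which the symmetry
of the symbol replaces by `r^{1/2} a r^{1/2}`. The invariant change of variables then releases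
`|r|^{k/2} = (2π)^{km} |ξ|_m^k`, the inverse of the Riesz multiplier up to a constant. -/
theorem setIntegral_cone_fourier (hw : IsRieszWavelet k w) (hmn : m ≤ n) {ε ρ : ℝ} (hε : 0 < ε)
    {ξ : Mat n m} (hξ : (ξᵀ * ξ).PosDef) :
    ∫ a in loewnerIoo (ε • (1 : Mat m m)) (ρ • 1),
      ((a.det ^ (-(k : ℝ) / 2) : ℝ) : ℂ) * fourier w (((2 * Real.pi) • ξ) * CFC.sqrt a)
        ∂(coneInvMeasure m) =
      (((2 * Real.pi) ^ (k * m) * absDet ξ ^ k : ℝ) : ℂ) * truncSymbol k w ε ρ ξ := by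
  have hpi := Real.pi_pos
  set r : Mat m m := (2 * Real.pi) ^ 2 • (ξᵀ * ξ) with hr
  have hrp : r.PosDef := hξ.smul (by positivity)
  have hgram : ∀ a : Mat m m, (((2 * Real.pi) • ξ) * CFC.sqrt a)ᵀ * (((2 * Real.pi) • ξ) *
      CFC.sqrt a) = CFC.sqrt a * r * CFC.sqrt a := fun a => by
    rw [Matrix.transpose_mul, sqrt_transpose, Matrix.transpose_smul, hr]
    simp only [Matrix.smul_mul, Matrix.mul_smul, smul_smul, Matrix.mul_assoc, sq]
  have hdet : r.det ^ (-(-(k : ℝ) / 2)) = (2 * Real.pi) ^ (k * m) * absDet ξ ^ k := by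
    rw [hr, Matrix.det_smul, Fintype.card_fin, show -(-(k : ℝ) / 2) = (k : ℝ) / 2 by ring,
      Real.mul_rpow (by positivity) hξ.det_pos.le, absDet_rpow_gram hξ, ← Real.rpow_natCast,
      ← Real.rpow_natCast, ← Real.rpow_mul (by positivity), ← Real.rpow_mul (by positivity),
      ← Real.rpow_natCast (2 * Real.pi) (k * m)]
    congr 2
    push_cast
    ring
  have h1 : ∀ a ∈ loewnerIoo (ε • (1 : Mat m m)) (ρ • 1),
      ((a.det ^ (-(k : ℝ) / 2) : ℝ) : ℂ) * fourier w (((2 * Real.pi) • ξ) * CFC.sqrt a) =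
      ((a.det ^ (-(k : ℝ) / 2) : ℝ) : ℂ) * coneSymbol w (CFC.sqrt r * a * CFC.sqrt r) := by
    intro a ha
    have hap : a.PosDef := posDef_of_mem_loewnerIoo (Matrix.PosDef.one.smul hε).posSemidef ha
    have hp : (CFC.sqrt a * r * CFC.sqrt a).PosDef := by
      have := (posDef_congr_iff (det_sqrt_ne_zero hap)).mpr hrp
      rwa [sqrt_transpose] at this
    rw [hw.fourier_eq_coneSymbol hmn ((hgram a).symm ▸ hp), hgram, hw.coneSymbol_symm hmn hrp hap]
  rw [setIntegral_congr_fun (measurableSet_loewnerIoo _ _) h1, setIntegral_coneInv_sqrt hrp _ _ _ _ hε,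
    hdet, truncSymbol]

theorem integrable_det_rpow_loewnerIoo {ε ρ : ℝ} (hε : 0 < ε) (e : ℝ) :
    Integrable (fun a : Mat m m => ((a.det ^ e : ℝ) : ℂ))
      ((coneInvMeasure m).restrict (loewnerIoo (ε • (1 : Mat m m)) (ρ • 1))) := by
  have h := lintegral_loewnerIoo_lt_top (m := m) (ρ := ρ) hε e 0
  simp only [pow_zero, ENNReal.ofReal_one, mul_one] at h
  exact ⟨(Complex.measurable_ofReal.comp (measurable_det_rpow e)).aestronglyMeasurable, h⟩

/-- The adjoint of the truncated transform acts on Schwartz functions as a Fourier multiplier. -/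
theorem integral_adjoint_eq (hw : IsRieszWavelet k w) (hkn : k + m ≤ n) {ε ρ : ℝ} (hε : 0 < ε)
    (g : 𝓢(EMat n m, ℂ)) (x : Mat n m) :
    ∫ r : Mat m m × Mat n m, (w r.2 * ((r.1.det ^ (-(k : ℝ) / 2) : ℝ) : ℂ)) *
        ∫ z, g (flat (x + r.2 * CFC.sqrt r.1 - z)) ∂(meanPlaneMeasure n m k)
      ∂(((coneInvMeasure m).restrict (loewnerIoo (ε • (1 : Mat m m)) (ρ • 1))).prod volume) =
    ((cConst n k m : ℝ) : ℂ) * ∫ ξ : Mat n m, (𝐞 ((xᵀ * ξ).trace) : ℂ) *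
      (truncSymbol k w ε ρ ξ * 𝓕 (g : EMat n m → ℂ) (flat ξ)) := by
  have hmn : m ≤ n := by omega
  set ν := (coneInvMeasure m).restrict (loewnerIoo (ε • (1 : Mat m m)) (ρ • 1)) with hν
  set κ := polarConst (n - k) m / polarConst n m with hκ
  obtain ⟨hgi, hgx⟩ := integral_meanPlane_eq hkn g
  have hwi : Integrable w := hw.schwartz.rapidDecay.integrable hw.schwartz.measurable
  have hci : Integrable (fun a : Mat m m => ((a.det ^ (-(k : ℝ) / 2) : ℝ) : ℂ)) ν :=
    integrable_det_rpow_loewnerIoo hε _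
  set b : Mat m m × Mat n m → ℂ := fun r => w r.2 * ((r.1.det ^ (-(k : ℝ) / 2) : ℝ) : ℂ) with hb
  have hbi : Integrable b (ν.prod volume) :=
    (hci.mul_prod hwi).congr (Eventually.of_forall fun r => mul_comm _ _)
  set W : Mat n m → ℂ := fun ξ =>
    ((κ * (absDet ξ ^ k)⁻¹ : ℝ) : ℂ) * 𝓕 (g : EMat n m → ℂ) (flat ξ) with hW
  have hms := measurable_mul_sqrt n m
  have hcm : Measurable fun p : (Mat m m × Mat n m) × Mat n m =>
      (𝐞 (((x + p.1.2 * CFC.sqrt p.1.1)ᵀ * p.2).trace) : ℂ) :=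
    measurable_fourierChar_trace (measurable_const.add (hms.comp measurable_fst)) measurable_snd
  -- The character has modulus one, and the rest is a product of integrable functions: the singular
  -- weight `|ξ|_m^{-k}` is integrable against the rapidly decreasing `𝓕 g`.
  have hbig : Integrable (fun p : (Mat m m × Mat n m) × Mat n m =>
      (𝐞 (((x + p.1.2 * CFC.sqrt p.1.1)ᵀ * p.2).trace) : ℂ) * (b p.1 * W p.2))
      ((ν.prod volume).prod volume) :=
    (hbi.mul_prod hgi).bdd_mul (c := 1) hcm.aestronglyMeasurable
      (Eventually.of_forall fun p => by rw [Circle.norm_coe])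
  calc _ = ∫ r, ∫ ξ, (𝐞 (((x + r.2 * CFC.sqrt r.1)ᵀ * ξ).trace) : ℂ) * (b r * W ξ)
        ∂(volume : Measure (Mat n m)) ∂(ν.prod volume) := by
        refine integral_congr_ae (Eventually.of_forall fun r => ?_)
        beta_reduce
        rw [hgx, ← integral_const_mul]
        refine integral_congr_ae (Eventually.of_forall fun ξ => ?_)
        simp only [hW, hb]
        ring
    _ = ∫ ξ : Mat n m, ∫ r, (𝐞 (((x + r.2 * CFC.sqrt r.1)ᵀ * ξ).trace) : ℂ) * (b r * W ξ)
        ∂(ν.prod volume) := integral_integral_swap hbig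
    _ = _ := by
        rw [← integral_const_mul]
        refine integral_congr_ae ?_
        -- Only frequencies of full rank matter. For these, the `y`-integral gives the transform of
        -- `w` at `2πξ a^{1/2}`, and the powers of `|ξ|_m` cancel.
        filter_upwards [ae_gram_posDef hmn] with ξ hξ
        have hsplit : ∀ r : Mat m m × Mat n m,
            (𝐞 (((x + r.2 * CFC.sqrt r.1)ᵀ * ξ).trace) : ℂ) * (b r * W ξ) =
            ((𝐞 ((xᵀ * ξ).trace) : ℂ) * W ξ) *
              (((r.1.det ^ (-(k : ℝ) / 2) : ℝ) : ℂ) *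
                (w r.2 * (𝐞 (((r.2 * CFC.sqrt r.1)ᵀ * ξ).trace) : ℂ))) := fun r => by
          rw [Matrix.transpose_add, Matrix.add_mul, Matrix.trace_add, AddChar.map_add_eq_mul,
            Circle.coe_mul]
          simp only [hb]
          ring
        have hcm2 : Measurable fun r : Mat m m × Mat n m =>
            (𝐞 (((r.2 * CFC.sqrt r.1)ᵀ * ξ).trace) : ℂ) :=
          measurable_fourierChar_trace hms measurable_const
        have hi2 : Integrable (fun r : Mat m m × Mat n m =>
            ((r.1.det ^ (-(k : ℝ) / 2) : ℝ) : ℂ) *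
                (w r.2 * (𝐞 (((r.2 * CFC.sqrt r.1)ᵀ * ξ).trace) : ℂ))) (ν.prod volume) := by
          refine (hbi.bdd_mul (c := 1) hcm2.aestronglyMeasurable
            (Eventually.of_forall fun p => by rw [Circle.norm_coe])).congr
            (Eventually.of_forall fun r => ?_)
          simp only [hb]
          ring
        simp only [hsplit]
        rw [integral_const_mul, integral_prod _ hi2]
        simp only [integral_const_mul, integral_fourierChar_mul_sqrt]
        rw [hν, setIntegral_cone_fourier hw hmn hε hξ, cConst_eq hkn]
        have hne : ((absDet ξ : ℝ) : ℂ) ≠ 0 := by exact_mod_cast (absDet_pos hξ).ne'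
        simp only [hW, ← hκ]
        push_cast
        field_simp

end

/-! ### Exhaustion of the cone and the limit of the multipliers -/

/-- The identity dominates small symmetric matrices. -/
theorem posDef_one_sub_smul {m : ℕ} {q : Mat m m} (hq : qᵀ = q) {t : ℝ} (ht : 0 ≤ t)
    (ht1 : t * ∑ i, ∑ j, |q i j| < 1) : (1 - t • q).PosDef := by
  refine Matrix.PosDef.of_dotProduct_mulVec_pos ?_ fun x hx => ?_
  · change (1 - t • q)ᵀ = _
    rw [Matrix.transpose_sub, Matrix.transpose_one, Matrix.transpose_smul, hq]
  · have hxx : 0 < x ⬝ᵥ x := by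
      have := Matrix.dotProduct_star_self_pos_iff.mpr hx
      simpa using this
    have hle : ∀ i j, x i * x j ≤ x ⬝ᵥ x ∧ -(x i * x j) ≤ x ⬝ᵥ x := fun i j => by
      have h1 : ∀ i, x i * x i ≤ x ⬝ᵥ x := fun i =>
        Finset.single_le_sum (f := fun i => x i * x i) (fun i _ => mul_self_nonneg _)
          (Finset.mem_univ i)
      constructor <;> nlinarith [h1 i, h1 j, sq_nonneg (x i - x j), sq_nonneg (x i + x j)]
    have hqx : x ⬝ᵥ (q *ᵥ x) ≤ (∑ i, ∑ j, |q i j|) * (x ⬝ᵥ x) := by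
      have h2 : x ⬝ᵥ (q *ᵥ x) = ∑ i, ∑ j, q i j * (x i * x j) := by
        simp only [dotProduct, Matrix.mulVec, Finset.mul_sum]
        exact Finset.sum_congr rfl fun i _ => Finset.sum_congr rfl fun j _ => by ring
      rw [h2, Finset.sum_mul]
      refine Finset.sum_le_sum fun i _ => ?_
      rw [Finset.sum_mul]
      refine Finset.sum_le_sum fun j _ => ?_
      refine (le_abs_self _).trans ?_
      rw [abs_mul]
      exact mul_le_mul_of_nonneg_left (abs_le'.mpr (hle i j)) (abs_nonneg _)
    have hstar : star x = x := rfl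
    rw [hstar, Matrix.sub_mulVec, Matrix.one_mulVec, Matrix.smul_mulVec, dotProduct_sub,
      dotProduct_smul, smul_eq_mul]
    nlinarith [mul_le_mul_of_nonneg_left hqx ht, mul_lt_mul_of_pos_right ht1 hxx]

/-- Conjugation by `s^{1/2}` reduces to `s = 1`, where a small multiple of a symmetric matrix is
dominated by the identity. -/
theorem eventually_posDef_sub_smul {m : ℕ} {s r : Mat m m} (hs : s.PosDef) (hr : r.PosDef) :
    ∀ᶠ t : ℝ in 𝓝[>] 0, (s - t • r).PosDef := by
  have hg := det_sqrt_ne_zero hs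
  set g := CFC.sqrt s with hgd
  have hgt : gᵀ = g := sqrt_transpose s
  have hgu : IsUnit g.det := hg.isUnit
  set q : Mat m m := g⁻¹ * r * g⁻¹ with hq
  have hrt : rᵀ = r := hr.isHermitian
  have hqt : qᵀ = q := by
    rw [hq, Matrix.transpose_mul, Matrix.transpose_mul, Matrix.transpose_nonsing_inv, hgt, hrt,
      Matrix.mul_assoc]
  have h1 : ∀ t : ℝ, s - t • r = gᵀ * (1 - t • q) * g := fun t => by
    rw [hgt, Matrix.mul_sub, Matrix.sub_mul, Matrix.mul_one, sqrt_mul_sqrt hs.posSemidef,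
      Matrix.mul_smul, Matrix.smul_mul, hq, ← Matrix.mul_assoc, ← Matrix.mul_assoc,
      Matrix.mul_nonsing_inv _ hgu, Matrix.one_mul, Matrix.mul_assoc, Matrix.nonsing_inv_mul _ hgu,
      Matrix.mul_one]
  have h2 : ∀ᶠ t : ℝ in 𝓝[>] 0, t * ∑ i, ∑ j, |q i j| < 1 := by
    have hc : Continuous fun t : ℝ => t * ∑ i, ∑ j, |q i j| := by fun_prop
    have h3 := (hc.tendsto 0).eventually_lt_const (by rw [zero_mul]; exact one_pos)
    exact h3.filter_mono nhdsWithin_le_nhds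
  filter_upwards [h2, self_mem_nhdsWithin] with t ht ht0
  rw [h1, posDef_congr_iff hg]
  exact posDef_one_sub_smul hqt (le_of_lt ht0) ht

/-- The upper bound is the lower bound with `r` and `s` exchanged and `t` replaced by `1/t`. -/
theorem eventually_mem_loewnerIoo {m : ℕ} {s r : Mat m m} (hs : s.PosDef) (hr : r.PosDef) :
    ∀ᶠ q : ℝ × ℝ in 𝓝[>] 0 ×ˢ atTop, s ∈ loewnerIoo (q.1 • r) (q.2 • r) := by
  have h1 := eventually_posDef_sub_smul hs hr
  have h2 := tendsto_inv_atTop_nhdsGT_zero.eventually (eventually_posDef_sub_smul hr hs)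
  have h3 : ∀ᶠ t : ℝ in atTop, (t • r - s).PosDef := by
    filter_upwards [h2, eventually_gt_atTop 0] with t ht ht0
    have := ht.smul ht0
    rwa [smul_sub, smul_smul, mul_inv_cancel₀ ht0.ne', one_smul] at this
  filter_upwards [h1.prod_inl atTop, h3.prod_inr (𝓝[>] (0 : ℝ))] with q h4 h5
  exact ⟨h4, h5⟩

section

variable {n m k : ℕ} {w : Mat n m → ℂ}

/-- The integrand of `d_w(k)` on the cone. -/
def coneIntegrand (k : ℕ) (w : Mat n m → ℂ) (s : Mat m m) : ℂ :=
  ((s.det ^ (-(k : ℝ) / 2) : ℝ) : ℂ) * coneSymbol w s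

theorem measurable_coneIntegrand (hw : IsSchwartz w) : Measurable (coneIntegrand k w) :=
  (Complex.measurable_ofReal.comp (measurable_det_rpow _)).mul (measurable_coneSymbol hw)

/-- The domain of integration moves with `ξ`; writing it as an indicator on the product makes
measurability in `ξ` a consequence of joint measurability. -/
theorem truncSymbol_eq (ε ρ : ℝ) (ξ : Mat n m) : truncSymbol k w ε ρ ξ =
    ∫ s, {p : Mat n m × Mat m m | p.2 ∈ loewnerIoo (ε • ((2 * Real.pi) ^ 2 • (p.1ᵀ * p.1)))
      (ρ • ((2 * Real.pi) ^ 2 • (p.1ᵀ * p.1)))}.indicator (fun p => coneIntegrand k w p.2) (ξ, s)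
        ∂(coneInvMeasure m) := by
  rw [truncSymbol, ← integral_indicator (measurableSet_loewnerIoo _ _)]
  rfl

theorem measurable_truncSymbol (hw : IsSchwartz w) (ε ρ : ℝ) :
    Measurable (truncSymbol k w ε ρ) := by
  have h : truncSymbol k w ε ρ = _ := funext (truncSymbol_eq ε ρ)
  rw [h]
  have hgr : ∀ t : ℝ, Measurable fun p : Mat n m × Mat m m =>
      t • ((2 * Real.pi) ^ 2 • (p.1ᵀ * p.1)) := fun t =>
    (measurable_of_continuous (f := fun y : Mat n m => t • ((2 * Real.pi) ^ 2 • (yᵀ * y)))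
      (by fun_prop)).comp measurable_fst
  have hset : MeasurableSet {p : Mat n m × Mat m m |
      p.2 ∈ loewnerIoo (ε • ((2 * Real.pi) ^ 2 • (p.1ᵀ * p.1)))
        (ρ • ((2 * Real.pi) ^ 2 • (p.1ᵀ * p.1)))} :=
    ((measurable_snd.sub (hgr ε)) (measurableSet_posDef m)).inter
      (((hgr ρ).sub measurable_snd) (measurableSet_posDef m))
  have h2 := ((measurable_coneIntegrand (k := k) hw).comp
    (measurable_snd (α := Mat n m))).indicator hset
  exact h2.stronglyMeasurable.integral_prod_right'.measurable

/-- A bound for the truncated symbols. -/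
def symbolBound (k : ℕ) (w : Mat n m → ℂ) : ℝ := ∫ s, ‖coneIntegrand k w s‖ ∂(coneInvMeasure m)

theorem IsRieszWavelet.integrable_coneIntegrand (hw : IsRieszWavelet k w) (hm : 1 ≤ m)
    (hmn : m ≤ n) : Integrable (coneIntegrand k w) (coneInvMeasure m) := (hw.dw_eq hm hmn).1

/-- The bound is the `L¹` norm of the full integrand on the cone, hence uniform in `ε`, `ρ` and `ξ`.
-/
theorem norm_truncSymbol_le (hw : IsRieszWavelet k w) (hm : 1 ≤ m) (hmn : m ≤ n) (ε ρ : ℝ)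
    (ξ : Mat n m) : ‖truncSymbol k w ε ρ ξ‖ ≤ symbolBound k w := by
  refine (norm_integral_le_integral_norm _).trans ?_
  exact setIntegral_le_integral (hw.integrable_coneIntegrand hm hmn).norm
    (Eventually.of_forall fun s => norm_nonneg _)

/-- Every positive definite `s` eventually lies in the interval `(εr, ρr)`, so dominated convergence
gives the integral over the whole cone, which is `d_w(k)`. -/
theorem tendsto_truncSymbol (hw : IsRieszWavelet k w) (hm : 1 ≤ m) (hmn : m ≤ n) {ξ : Mat n m}
    (hξ : (ξᵀ * ξ).PosDef) :
    Tendsto (fun q : ℝ × ℝ => truncSymbol k w q.1 q.2 ξ) (𝓝[>] 0 ×ˢ atTop) (𝓝 (dw k w)) := by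
  have hi := hw.integrable_coneIntegrand hm hmn
  have hrp : ((2 * Real.pi) ^ 2 • (ξᵀ * ξ)).PosDef := hξ.smul (by positivity)
  rw [(hw.dw_eq hm hmn).2]
  have heq : ∀ q : ℝ × ℝ, truncSymbol k w q.1 q.2 ξ =
      ∫ s, (loewnerIoo (q.1 • ((2 * Real.pi) ^ 2 • (ξᵀ * ξ)))
        (q.2 • ((2 * Real.pi) ^ 2 • (ξᵀ * ξ)))).indicator (coneIntegrand k w) s
          ∂(coneInvMeasure m) := fun q => by
    rw [integral_indicator (measurableSet_loewnerIoo _ _)]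
    rfl
  simp only [heq]
  refine tendsto_integral_filter_of_dominated_convergence (fun s => ‖coneIntegrand k w s‖)
    (Eventually.of_forall fun q => (hi.aestronglyMeasurable.indicator
      (measurableSet_loewnerIoo _ _))) (Eventually.of_forall fun q => Eventually.of_forall fun s =>
        norm_indicator_le_norm_self _ _) hi.norm ?_
  filter_upwards [ae_coneInv_posDef m] with s hs
  refine tendsto_const_nhds.congr' ?_
  filter_upwards [eventually_mem_loewnerIoo hs hrp] with q hq
  rw [Set.indicator_of_mem hq]
  rfl

end

/-! ### Fourier multipliers on `L²` -/

section

variable {E : Type*} [NormedAddCommGroup E] [InnerProductSpace ℝ E] [FiniteDimensional ℝ E]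
  [MeasurableSpace E] [BorelSpace E]

theorem integral_fourierInv_mul_eq_flip {φ h : E → ℂ} (hφ : Integrable φ) (hh : Integrable h) :
    ∫ x, 𝓕⁻ φ x * h x = ∫ x, φ x * 𝓕⁻ h x := by
  have h1 := VectorFourier.integral_fourierIntegral_smul_eq_flip (μ := (volume : Measure E))
    (ν := volume) (L := -innerₗ E) Real.continuous_fourierChar
    (by
      change Continuous fun p : E × E => -inner ℝ p.1 p.2
      fun_prop) hφ hh
  have h2 : (-innerₗ E).flip = -innerₗ E := by
    ext x y
    simp [real_inner_comm]
  rw [h2] at h1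
  exact h1

theorem continuous_fourierInv {h : E → ℂ} (hh : Integrable h) : Continuous (𝓕⁻ h) :=
  VectorFourier.fourierIntegral_continuous Real.continuous_fourierChar
    (by
      change Continuous fun p : E × E => -inner ℝ p.1 p.2
      fun_prop) hh

/-- A locally integrable function is determined by its integrals against Schwartz functions. -/
theorem ae_eq_of_integral_schwartz {u v : E → ℂ} (hu : LocallyIntegrable u volume)
    (hv : LocallyIntegrable v volume)
    (hui : ∀ g : 𝓢(E, ℂ), HasCompactSupport g → Integrable fun x => g x * u x)
    (hvi : ∀ g : 𝓢(E, ℂ), HasCompactSupport g → Integrable fun x => g x * v x)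
    (h : ∀ g : 𝓢(E, ℂ), HasCompactSupport g → ∫ x, g x * u x = ∫ x, g x * v x) : u =ᵐ[volume] v := by
  have h1 : ∀ᵐ x, (u - v) x = 0 := by
    refine ae_eq_zero_of_integral_contDiff_smul_eq_zero (hu.sub hv) fun g hg hgc => ?_
    have hg₁ : HasCompactSupport (Complex.ofRealCLM ∘ g) := hgc.comp_left rfl
    have hg₂ : ContDiff ℝ (⊤ : ℕ∞) (Complex.ofRealCLM ∘ g) := Complex.ofRealCLM.contDiff.comp hg
    set G := hg₁.toSchwartzMap hg₂ with hG
    have hGc : HasCompactSupport G := hg₁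
    have hGg : ∀ x, G x = (g x : ℂ) := fun x => rfl
    have h2 : ∀ x, g x • (u - v) x = G x * u x - G x * v x := fun x => by
      rw [hGg, Complex.real_smul, Pi.sub_apply, mul_sub]
    simp only [h2]
    rw [integral_sub (hui G hGc) (hvi G hGc), h G hGc, sub_self]
  filter_upwards [h1] with x hx
  exact sub_eq_zero.mp hx

theorem integrable_schwartz_mul_memLp {u : E → ℂ} (hu : MemLp u 2 volume) (g : 𝓢(E, ℂ)) :
    Integrable fun x => g x * u x := by
  have hg : MemLp g 2 volume := g.memLp 2 volume
  exact hg.integrable_mul hu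

/-- The inverse Fourier transform on `L²` is given by the integral on `L¹ ∩ L²`. -/
theorem fourierInv_toLp_ae_eq {h : E → ℂ} (hi : Integrable h) (h2 : MemLp h 2 volume) :
    (𝓕⁻ (h2.toLp h) : Lp ℂ 2 (volume : Measure E)) =ᵐ[volume] 𝓕⁻ h := by
  have hc := continuous_fourierInv hi
  refine ae_eq_of_integral_schwartz ((Lp.memLp _).locallyIntegrable one_le_two)
    hc.locallyIntegrable (fun g _ => integrable_schwartz_mul_memLp (Lp.memLp _) g)
    (fun g hg => (g.continuous.mul hc).integrable_of_hasCompactSupport hg.mul_right)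
    fun g _ => ?_
  -- The `L²` transform is compatible with tempered distributions, so both sides are tested by
  -- moving `𝓕⁻` onto `g`.
  have h3 := Lp.toTemperedDistribution_apply (𝓕⁻ (h2.toLp h) : Lp ℂ 2 (volume : Measure E)) g
  rw [← Lp.fourierInv_toTemperedDistribution_eq, TemperedDistribution.fourierInv_apply,
    Lp.toTemperedDistribution_apply] at h3
  simp only [smul_eq_mul] at h3
  rw [← h3, ← integral_fourierInv_mul_eq_flip g.integrable hi]
  refine integral_congr_ae ?_
  filter_upwards [h2.coeFn_toLp] with x hx
  rw [hx, SchwartzMap.fourierInv_coe]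

theorem memLp_conj {F : E → ℂ} (hF : MemLp F 2 volume) :
    MemLp (fun x => starRingEnd ℂ (F x)) 2 volume :=
  hF.congr_norm (Complex.continuous_conj.comp_aestronglyMeasurable hF.1)
    (Eventually.of_forall fun _ => (RCLike.norm_conj _).symm)

theorem eLpNorm_conj (F : E → ℂ) :
    eLpNorm (fun x => starRingEnd ℂ (F x)) 2 volume = eLpNorm F 2 volume :=
  eLpNorm_congr_norm_ae (Eventually.of_forall fun _ => RCLike.norm_conj _)

theorem memLp_bdd_mul {F M : E → ℂ} (hF : MemLp F 2 volume) (hM : Measurable M) {C : ℝ}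
    (hMC : ∀ x, ‖M x‖ ≤ C) : MemLp (fun x => M x * F x) 2 volume :=
  hF.of_le_mul (hM.aestronglyMeasurable.mul hF.1) (Eventually.of_forall fun x => by
    rw [norm_mul]
    exact mul_le_mul_of_nonneg_right (hMC x) (norm_nonneg _))

/-- Bounded Fourier multipliers on `L²`, in weak form. -/
theorem exists_fourier_multiplier {F : E → ℂ} (hF : MemLp F 2 volume) :
    ∃ B : E → ℂ, MemLp B 2 volume ∧ ∀ (M : E → ℂ) (C : ℝ), Measurable M → (∀ ξ, ‖M ξ‖ ≤ C) →
      ∃ S : E → ℂ, MemLp S 2 volume ∧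
        (∀ g : 𝓢(E, ℂ), ∫ x, F x * 𝓕⁻ (fun ξ => M ξ * 𝓕 (g : E → ℂ) ξ) x = ∫ x, S x * g x) ∧
        ∀ d : ℂ, eLpNorm (fun x => S x - d * F x) 2 volume =
          eLpNorm (fun ξ => (M ξ - d) * B ξ) 2 volume := by
  -- The integral of `F` times a function is bilinear whereas the inner product is conjugate linear
  -- in its first slot. Working with the conjugate of `F`, and hence with the conjugate multiplier,
  -- makes Plancherel applicable.
  set A : Lp ℂ 2 (volume : Measure E) := (memLp_conj hF).toLp _ with hA
  have hAae := (memLp_conj hF).coeFn_toLp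
  set B : Lp ℂ 2 (volume : Measure E) := 𝓕 A with hB
  refine ⟨fun ξ => starRingEnd ℂ (B ξ), memLp_conj (Lp.memLp B), fun M C hM hMC => ?_⟩
  have hMm : Measurable fun ξ => starRingEnd ℂ (M ξ) := Complex.continuous_conj.measurable.comp hM
  have hMB : MemLp (fun ξ => starRingEnd ℂ (M ξ) * B ξ) 2 volume :=
    memLp_bdd_mul (Lp.memLp B) hMm (C := C) fun ξ => (RCLike.norm_conj _).trans_le (hMC ξ)
  set S' : Lp ℂ 2 (volume : Measure E) := 𝓕⁻ (hMB.toLp _) with hS'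
  have hFS : 𝓕 S' = hMB.toLp _ := FourierTransform.fourier_fourierInv_eq _
  refine ⟨fun x => starRingEnd ℂ (S' x), memLp_conj (Lp.memLp S'), fun g => ?_, fun d => ?_⟩
  · set h : E → ℂ := fun ξ => M ξ * 𝓕 (g : E → ℂ) ξ with hh
    have hg2 : MemLp (𝓕 (g : E → ℂ)) 2 volume := (𝓕 g).memLp 2 volume
    have hgi : Integrable (𝓕 (g : E → ℂ)) := (𝓕 g).integrable
    have hh2 : MemLp h 2 volume := memLp_bdd_mul hg2 hM hMC
    have hhi : Integrable h := hgi.bdd_mul hM.aestronglyMeasurable (Eventually.of_forall hMC)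
    have hinv := fourierInv_toLp_ae_eq hhi hh2
    have e1 : ∫ x, F x * 𝓕⁻ h x = inner ℂ A (𝓕⁻ (hh2.toLp h)) := by
      rw [L2.inner_def]
      refine integral_congr_ae ?_
      filter_upwards [hAae, hinv] with x hx1 hx2
      rw [hx1, hx2, RCLike.inner_apply, Complex.conj_conj, mul_comm]
    have e2 : inner ℂ A (𝓕⁻ (hh2.toLp h)) = inner ℂ B (hh2.toLp h) := by
      rw [← Lp.inner_fourier_eq, FourierTransform.fourier_fourierInv_eq]
    have e3 : inner ℂ B (hh2.toLp h) = inner ℂ (hMB.toLp _) ((𝓕 g).toLp 2) := by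
      rw [L2.inner_def, L2.inner_def]
      refine integral_congr_ae ?_
      filter_upwards [hh2.coeFn_toLp, hMB.coeFn_toLp, (𝓕 g).coeFn_toLp 2 volume] with ξ h1 h2 h3
      rw [h1, h2, h3, RCLike.inner_apply, RCLike.inner_apply, map_mul, Complex.conj_conj,
        SchwartzMap.fourier_coe]
      simp only [hh]
      ring
    have e4 : inner ℂ (hMB.toLp _) ((𝓕 g).toLp 2) = inner ℂ S' (g.toLp 2) := by
      rw [← hFS, ← SchwartzMap.toLp_fourier_eq, Lp.inner_fourier_eq]
    rw [e1, e2, e3, e4, L2.inner_def]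
    refine integral_congr_ae ?_
    filter_upwards [g.coeFn_toLp 2 volume] with x hx
    rw [hx, RCLike.inner_apply, mul_comm]
  -- Plancherel again: after conjugation `S - dF` becomes `S' - conj(d) A`, whose transform is
  -- `conj(M - d)` times `B`.
  · have e1 : eLpNorm (fun x => starRingEnd ℂ (S' x) - d * F x) 2 volume =
        ‖S' - (starRingEnd ℂ d) • A‖ₑ := by
      rw [Lp.enorm_def, ← eLpNorm_conj]
      refine eLpNorm_congr_ae ?_
      filter_upwards [hAae, Lp.coeFn_sub S' ((starRingEnd ℂ d) • A),
        Lp.coeFn_smul (starRingEnd ℂ d) A] with x h1 h2 h3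
      rw [h2, Pi.sub_apply, h3, Pi.smul_apply, h1, map_sub, map_mul, Complex.conj_conj, smul_eq_mul]
    have e2 : ‖S' - (starRingEnd ℂ d) • A‖ₑ = ‖hMB.toLp _ - (starRingEnd ℂ d) • B‖ₑ := by
      rw [← hFS, hB, sub_eq_add_neg, sub_eq_add_neg, ← FourierTransform.fourier_smul, ← FourierTransform.fourier_neg,
        ← FourierAdd.fourier_add, ← ofReal_norm, ← ofReal_norm,
        Lp.norm_fourier_eq]
    rw [e1, e2, Lp.enorm_def, ← eLpNorm_conj]
    refine eLpNorm_congr_ae ?_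
    filter_upwards [hMB.coeFn_toLp, Lp.coeFn_sub (hMB.toLp _) ((starRingEnd ℂ d) • B),
        Lp.coeFn_smul (starRingEnd ℂ d) B] with x h1 h2 h3
    rw [h2, Pi.sub_apply, h3, Pi.smul_apply, h1, map_sub, map_mul, smul_eq_mul, map_mul,
      Complex.conj_conj, Complex.conj_conj, sub_mul]

end

/-! ### The truncated integral as a Fourier multiplier -/

/-- Test with a bump function equal to `1` on the unit ball around the given point. -/
theorem locallyIntegrable_of_schwartz {E : Type*} [NormedAddCommGroup E] [InnerProductSpace ℝ E]
    [FiniteDimensional ℝ E] [MeasurableSpace E] [BorelSpace E] {u : E → ℂ}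
    (hu : ∀ g : 𝓢(E, ℂ), HasCompactSupport g → Integrable fun x => g x * u x) :
    LocallyIntegrable u volume := by
  intro x
  let b : ContDiffBump x := ⟨1, 2, one_pos, one_lt_two⟩
  have hg₁ : HasCompactSupport (Complex.ofRealCLM ∘ b) := b.hasCompactSupport.comp_left rfl
  have hg₂ : ContDiff ℝ (⊤ : ℕ∞) (Complex.ofRealCLM ∘ b) := Complex.ofRealCLM.contDiff.comp b.contDiff
  have h := hu (hg₁.toSchwartzMap hg₂) hg₁
  refine ⟨Metric.closedBall x 1, Metric.closedBall_mem_nhds x one_pos, ?_⟩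
  refine h.integrableOn.congr_fun (fun y hy => ?_) measurableSet_closedBall
  have h1 : b y = 1 := b.one_of_mem_closedBall hy
  have h2 : (hg₁.toSchwartzMap hg₂ : E → ℂ) y = ((b y : ℝ) : ℂ) := rfl
  beta_reduce
  rw [h2, h1]
  simp

/-- Dominated convergence for `|M - d|² |B|²`, with majorant `(C + |d|)² |B|²`. -/
theorem tendsto_eLpNorm_multiplier {E α : Type*} [MeasurableSpace E] {μ : Measure E} {l : Filter α}
    [l.IsCountablyGenerated] {M : α → E → ℂ} {B : E → ℂ} {d : ℂ} {C : ℝ} (hB : MemLp B 2 μ)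
    (hM : ∀ q, Measurable (M q)) (hMC : ∀ q ξ, ‖M q ξ‖ ≤ C)
    (hlim : ∀ᵐ ξ ∂μ, Tendsto (fun q => M q ξ) l (𝓝 d)) :
    Tendsto (fun q => eLpNorm (fun ξ => (M q ξ - d) * B ξ) 2 μ) l (𝓝 0) := by
  simp only [eLpNorm_eq_lintegral_rpow_enorm_toReal two_ne_zero ENNReal.ofNat_ne_top]
  have h0 : (0 : ENNReal) = (∫⁻ _ : E, 0 ∂μ) ^ (1 / (2 : ENNReal).toReal) := by simp
  rw [h0]
  refine (ENNReal.continuous_rpow_const.tendsto _).comp ?_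
  have hBi : ∫⁻ ξ, ‖B ξ‖ₑ ^ (2 : ENNReal).toReal ∂μ < ⊤ :=
    lintegral_rpow_enorm_lt_top_of_eLpNorm_lt_top two_ne_zero ENNReal.ofNat_ne_top hB.2
  refine tendsto_lintegral_filter_of_dominated_convergence'
    (fun ξ => ENNReal.ofReal (C + ‖d‖) ^ (2 : ENNReal).toReal * ‖B ξ‖ₑ ^ (2 : ENNReal).toReal)
    (Eventually.of_forall fun q => ?_) (Eventually.of_forall fun q => ?_) ?_ ?_
  · exact ((((hM q).sub_const d).aemeasurable.mul hB.1.aemeasurable).enorm.pow_const _)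
  · refine Eventually.of_forall fun ξ => ?_
    rw [enorm_mul, ENNReal.mul_rpow_of_nonneg _ _ ENNReal.toReal_nonneg]
    gcongr
    rw [← ofReal_norm]
    exact ENNReal.ofReal_le_ofReal ((norm_sub_le _ _).trans (by gcongr; exact hMC q ξ))
  · rw [lintegral_const_mul' _ _ (ENNReal.rpow_ne_top_of_nonneg ENNReal.toReal_nonneg
      ENNReal.ofReal_ne_top)]
    exact ENNReal.mul_ne_top (ENNReal.rpow_ne_top_of_nonneg ENNReal.toReal_nonneg
      ENNReal.ofReal_ne_top) hBi.ne
  · filter_upwards [hlim] with ξ hξ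
    have h1 : Tendsto (fun q => (M q ξ - d) * B ξ) l (𝓝 0) := by
      have := (hξ.sub_const d).mul_const (B ξ)
      simpa using this
    have h2 := ((ENNReal.continuous_rpow_const (y := (2 : ENNReal).toReal)).tendsto _).comp
      ((continuous_enorm.tendsto _).comp h1)
    simpa [Function.comp_def] using h2

section

variable {n m k N : ℕ} {f₀ : Mat n m → ℂ} {w : Mat n m → ℂ}

/-- The truncated integral of the wavelet transforms of the plane averages, as one integral. -/
def tripleTrunc (k : ℕ) (w f₀ : Mat n m → ℂ) (ε ρ : ℝ) (x : Mat n m) : ℂ :=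
  ∫ q, f₀ (x + shift q) * (w q.1.2 * ((q.1.1.det ^ (-(k : ℝ) / 2) : ℝ) : ℂ))
    ∂((((coneInvMeasure m).restrict (loewnerIoo (ε • (1 : Mat m m)) (ρ • 1))).prod volume).prod
      (meanPlaneMeasure n m k))

theorem ae_posSemidef_loewnerIoo {ε : ℝ} (hε : 0 < ε) (ρ : ℝ) :
    ∀ᵐ a ∂((coneInvMeasure m).restrict (loewnerIoo (ε • (1 : Mat m m)) (ρ • 1))),
      a.PosSemidef :=
  (ae_restrict_mem (measurableSet_loewnerIoo _ _)).mono fun _ ha =>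
    (posDef_of_mem_loewnerIoo (Matrix.PosSemidef.one.smul hε.le) ha).posSemidef

theorem measurable_det_rpow_ofReal (e : ℝ) :
    Measurable fun a : Mat m m => ((a.det ^ e : ℝ) : ℂ) :=
  Complex.measurable_ofReal.comp (measurable_det_rpow e)

/-- The weighted integral which controls the truncated integral is finite. -/
theorem lintegral_wt_trunc_lt_top (hfm : Measurable f₀) (hw : IsSchwartz w)
    (hH : ∫⁻ x : Mat n m, ENNReal.ofReal (wt N x) *
      ∫⁻ z, ‖f₀ (x + z)‖ₑ ∂(meanPlaneMeasure n m k) < ⊤) {ε : ℝ} (hε : 0 < ε) (ρ : ℝ) :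
    ∫⁻ x : Mat n m, ENNReal.ofReal (wt N x) *
      ∫⁻ q, ‖f₀ (x + shift q) * (w q.1.2 * ((q.1.1.det ^ (-(k : ℝ) / 2) : ℝ) : ℂ))‖ₑ
        ∂((((coneInvMeasure m).restrict (loewnerIoo (ε • (1 : Mat m m)) (ρ • 1))).prod
          volume).prod (meanPlaneMeasure n m k)) < ⊤ := by
  have hν := ae_posSemidef_loewnerIoo (m := m) hε ρ
  have hcν := lintegral_loewnerIoo_lt_top (m := m) (ρ := ρ) hε (-(k : ℝ) / 2) N
  set ν := (coneInvMeasure m).restrict (loewnerIoo (ε • (1 : Mat m m)) (ρ • 1)) with hν'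
  have hsf : SFinite ν := hν' ▸ inferInstance
  clear_value ν
  have hc := measurable_det_rpow_ofReal (m := m) (-(k : ℝ) / 2)
  exact lintegral_wt_shift_lt_top hfm hw.measurable hw.rapidDecay hH hν
    (c := fun a : Mat m m => ((a.det ^ (-(k : ℝ) / 2) : ℝ) : ℂ)) hc hcν

theorem integral_fourierChar_eq_fourierInv (h : EMat n m → ℂ) (x : Mat n m) :
    ∫ ξ : Mat n m, (𝐞 ((xᵀ * ξ).trace) : ℂ) * h (flat ξ) = 𝓕⁻ h (flat x) := by
  rw [Real.fourierInv_eq, ← integral_comp_flat]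
  refine integral_congr_ae (Eventually.of_forall fun ξ => ?_)
  beta_reduce
  rw [Circle.smul_def, smul_eq_mul, real_inner_comm (flat x), inner_flat]

/-- All operators are moved onto the Schwartz function `g`, where the Fourier calculus is classical;
of `f₀` only the weighted integrability of `|f₀| * μ` is needed. -/
theorem integral_schwartz_mul_tripleTrunc (hw : IsRieszWavelet k w) (hkn : k + m ≤ n)
    (hfm : Measurable f₀)
    (hH : ∫⁻ x : Mat n m, ENNReal.ofReal (wt N x) *
      ∫⁻ z, ‖f₀ (x + z)‖ₑ ∂(meanPlaneMeasure n m k) < ⊤) {ε : ℝ} (hε : 0 < ε) (ρ : ℝ)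
    (g : 𝓢(EMat n m, ℂ)) :
    Integrable (fun x : Mat n m => g (flat x) * tripleTrunc k w f₀ ε ρ x) ∧
    ∫ x : Mat n m, g (flat x) * tripleTrunc k w f₀ ε ρ x =
      ((cConst n k m : ℝ) : ℂ) * ∫ x : Mat n m, f₀ x *
        𝓕⁻ (fun ξ => truncSymbol k w ε ρ ((flatEquiv n m).symm ξ) * 𝓕 (g : EMat n m → ℂ) ξ)
          (flat x) := by
  have hfin := lintegral_wt_trunc_lt_top hfm hw.schwartz hH hε ρ
  have hG : Measurable fun x : Mat n m => g (flat x) :=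
    g.continuous.measurable.comp (measurable_flat n m)
  constructor
  · have h := (integrable_mul_triple hfm hw.schwartz.measurable (measurable_det_rpow_ofReal _) hfin
      hG (rapidDecay_schwartz g)).integral_prod_left
    refine h.congr (Eventually.of_forall fun x => ?_)
    exact integral_const_mul (g (flat x)) fun q : Param n m =>
      f₀ (x + shift q) * (w q.1.2 * ((q.1.1.det ^ (-(k : ℝ) / 2) : ℝ) : ℂ))
  · refine (integral_mul_triple hfm hw.schwartz.measurable (measurable_det_rpow_ofReal _) hfin
      hG (rapidDecay_schwartz g)).trans ?_
    rw [← integral_const_mul ((cConst n k m : ℝ) : ℂ)]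
    refine integral_congr_ae (Eventually.of_forall fun x => ?_)
    beta_reduce
    rw [integral_adjoint_eq hw hkn hε g x, ← integral_fourierChar_eq_fourierInv]
    exact mul_left_comm _ _ _

theorem memLp_comp_flat {F : EMat n m → ℂ} (hF : MemLp F 2 volume) :
    MemLp (fun x : Mat n m => F (flat x)) 2 volume :=
  hF.comp_measurePreserving (measurePreserving_flatEquiv n m)

/-- On `L²`, the truncated integral is a Fourier multiplier. -/
theorem exists_tripleTrunc_multiplier (hw : IsRieszWavelet k w) (hm : 1 ≤ m) (hkn : k + m ≤ n)
    (hfm : Measurable f₀) (hf2 : MemLp f₀ 2 volume)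
    (hH : ∫⁻ x : Mat n m, ENNReal.ofReal (wt N x) *
      ∫⁻ z, ‖f₀ (x + z)‖ₑ ∂(meanPlaneMeasure n m k) < ⊤) :
    ∃ B : EMat n m → ℂ, MemLp B 2 volume ∧ ∀ ε : ℝ, 0 < ε → ∀ ρ : ℝ,
      MemLp (tripleTrunc k w f₀ ε ρ) 2 volume ∧
      eLpNorm (fun x => ((cConst n k m)⁻¹ : ℂ) * tripleTrunc k w f₀ ε ρ x - dw k w * f₀ x) 2 volume
        = eLpNorm (fun ξ => (truncSymbol k w ε ρ ((flatEquiv n m).symm ξ) - dw k w) * B ξ) 2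
          volume := by
  have hmn : m ≤ n := by omega
  have hps := (measurePreserving_flatEquiv n m).symm (flatEquiv n m)
  obtain ⟨B, hB, h⟩ := exists_fourier_multiplier (hf2.comp_measurePreserving hps)
  refine ⟨B, hB, fun ε hε ρ => ?_⟩
  obtain ⟨S, hS, hSg, hSd⟩ := h
    (fun ξ => truncSymbol k w ε ρ ((flatEquiv n m).symm ξ)) (symbolBound k w)
    ((measurable_truncSymbol hw.schwartz ε ρ).comp (flatEquiv n m).symm.measurable)
    (fun ξ => norm_truncSymbol_le hw hm hmn ε ρ _)
  have hc : ((cConst n k m : ℝ) : ℂ) ≠ 0 := by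
    rw [cConst_eq hkn]
    have h1 := polarConst_pos (n := n - k) (m := m) (by omega)
    have h2 := polarConst_pos hmn
    exact_mod_cast (by positivity : (2 * Real.pi) ^ (k * m) *
      (polarConst (n - k) m / polarConst n m) ≠ 0)
  set T : EMat n m → ℂ := fun v => tripleTrunc k w f₀ ε ρ ((flatEquiv n m).symm v) with hT
  have hTf : ∀ x : Mat n m, T (flat x) = tripleTrunc k w f₀ ε ρ x := fun x => rfl
  have hTi : ∀ g : 𝓢(EMat n m, ℂ), Integrable fun v => g v * T v := fun g =>
    (integrable_comp_flat fun v => g v * T v).mp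
      (integral_schwartz_mul_tripleTrunc hw hkn hfm hH hε ρ g).1
  have hcS : MemLp (fun v => ((cConst n k m : ℝ) : ℂ) * S v) 2 volume := hS.const_mul _
  -- The truncated integral is not known beforehand to be in `L²`. Both functions are locally
  -- integrable with equal integrals against test functions, so they agree almost everywhere and `T`
  -- inherits membership in `L²`.
  have hae : T =ᵐ[volume] fun v => ((cConst n k m : ℝ) : ℂ) * S v := by
    refine ae_eq_of_integral_schwartz (locallyIntegrable_of_schwartz fun g _ => hTi g)
      (hcS.locallyIntegrable one_le_two) (fun g _ => hTi g)
      (fun g _ => integrable_schwartz_mul_memLp hcS g) fun g _ => ?_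
    have h1 : ∫ v, g v * T v = ∫ x : Mat n m, g (flat x) * tripleTrunc k w f₀ ε ρ x :=
      (integral_comp_flat fun v => g v * T v).symm
    have h2 : ∫ x : Mat n m, f₀ x *
        𝓕⁻ (fun ξ => truncSymbol k w ε ρ ((flatEquiv n m).symm ξ) * 𝓕 (g : EMat n m → ℂ) ξ)
          (flat x) = ∫ v, S v * g v := by
      rw [← hSg g]
      exact integral_comp_flat fun v => f₀ ((flatEquiv n m).symm v) *
        𝓕⁻ (fun ξ => truncSymbol k w ε ρ ((flatEquiv n m).symm ξ) * 𝓕 (g : EMat n m → ℂ) ξ) v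
    rw [h1, (integral_schwartz_mul_tripleTrunc hw hkn hfm hH hε ρ g).2, h2, ← integral_const_mul]
    exact integral_congr_ae (Eventually.of_forall fun v => by ring)
  have hTm : MemLp T 2 volume := hcS.ae_eq hae.symm
  refine ⟨memLp_comp_flat hTm, ?_⟩
  rw [← hSd (dw k w)]
  set R : EMat n m → ℂ := fun v => S v - dw k w * f₀ ((flatEquiv n m).symm v) with hR
  have hRm : AEStronglyMeasurable R volume :=
    (hS.sub ((hf2.comp_measurePreserving hps).const_mul (dw k w))).1
  refine Eq.trans ?_ (eLpNorm_comp_measurePreserving hRm (measurePreserving_flatEquiv n m))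
  have h3 := (measurePreserving_flatEquiv n m).quasiMeasurePreserving.ae hae
  refine eLpNorm_congr_ae (h3.mono fun x hx => ?_)
  have hx' : tripleTrunc k w f₀ ε ρ x = ((cConst n k m : ℝ) : ℂ) * S (flat x) := hx
  change _ * tripleTrunc k w f₀ ε ρ x - _ = S (flat x) - dw k w * f₀ x
  rw [hx', inv_mul_cancel_left₀ hc]

end

/-! ### Almost everywhere identities for the transforms of `f` -/

section

variable {n m k N : ℕ} {f f₀ w : Mat n m → ℂ}

theorem ae_lintegral_plane_lt_top (hfm : Measurable f₀)
    (hH : ∫⁻ x : Mat n m, ENNReal.ofReal (wt N x) *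
      ∫⁻ z, ‖f₀ (x + z)‖ₑ ∂(meanPlaneMeasure n m k) < ⊤) :
    ∀ᵐ x : Mat n m, ∫⁻ z, ‖f₀ (x + z)‖ₑ ∂(meanPlaneMeasure n m k) < ⊤ := by
  have hm : Measurable fun q : Mat n m × Mat n m => ‖f₀ (q.1 + q.2)‖ₑ :=
    (hfm.comp (measurable_fst.add measurable_snd)).enorm
  have hm1 : Measurable fun x : Mat n m => ENNReal.ofReal (wt N x) *
      ∫⁻ z, ‖f₀ (x + z)‖ₑ ∂(meanPlaneMeasure n m k) :=
    (measurable_wt N).ennreal_ofReal.mul hm.lintegral_prod_right'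
  filter_upwards [ae_lt_top hm1 hH.ne] with x hx
  refine lt_top_iff_ne_top.mpr fun htop => ?_
  rw [htop, ENNReal.mul_top (by simpa using wt_pos _ _)] at hx
  exact lt_irrefl _ hx

/-- The dual transform of the Radon transform is almost everywhere an average over planes. -/
theorem ae_dualRadon_radon (hk : 1 ≤ k) (hkn : k ≤ n) (hfm : Measurable f₀)
    (hH : ∫⁻ x : Mat n m, ENNReal.ofReal (wt N x) *
      ∫⁻ z, ‖f₀ (x + z)‖ₑ ∂(meanPlaneMeasure n m k) < ⊤) {S : Set (Mat n m)}
    (hS : MeasurableSet S) (hS0 : volume S = 0) (hfS : ∀ x ∉ S, f x = f₀ x) :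
    ∀ᵐ x : Mat n m,
      Integrable (fun ξ : Stiefel n (n - k) => radon f ξ (ξ.1ᵀ * x)) (stiefelMeasure n k) ∧
        dualRadon (radon (k := k) f) x = planeConv k f₀ x := by
  -- Translates of a null set are null, so for almost every `x` the set `S - x` is not charged by
  -- the mean plane measure.
  have h := Measure.ae_ae_of_ae_prod ((quasiMeasurePreserving_add (meanPlaneMeasure n m k)
    (u := fun z : Mat n m => z) measurable_id).ae (measure_eq_zero_iff_ae_notMem.mp hS0))
  filter_upwards [h, ae_lintegral_plane_lt_top hfm hH] with x hx0 hx1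
  exact dualRadon_radon_eq hk hkn hfm hS hfS hx0 hx1

/-- The wavelet transform of a function which agrees almost everywhere with the plane average. -/
theorem ae_integrable_wavelet {D : Mat n m → ℂ} (hfm : Measurable f₀) (hw : IsSchwartz w)
    (hH : ∫⁻ x : Mat n m, ENNReal.ofReal (wt N x) *
      ∫⁻ z, ‖f₀ (x + z)‖ₑ ∂(meanPlaneMeasure n m k) < ⊤)
    (hD : D =ᵐ[volume] planeConv k f₀) {a : Mat m m} (ha : a.PosSemidef) :
    ∀ᵐ x : Mat n m, Integrable fun y => D (x - y * CFC.sqrt a) * w y := by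
  -- A Dirac mass at `a` turns the general estimate over the cone into the one for a single wavelet
  -- transform.
  have hν : ∀ᵐ b ∂(Measure.dirac a), b.PosSemidef := by
    rw [ae_dirac_eq]
    exact ha
  have hcν : ∫⁻ b : Mat m m, ‖(1 : ℂ)‖ₑ * ENNReal.ofReal ((1 + b.trace) ^ N)
      ∂(Measure.dirac a) < ⊤ := by
    rw [lintegral_dirac]
    exact ENNReal.mul_lt_top enorm_lt_top ENNReal.ofReal_lt_top
  have hfin := lintegral_wt_shift_lt_top hfm hw.measurable hw.rapidDecay hH hν
    (c := fun _ : Mat m m => (1 : ℂ)) measurable_const hcν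
  filter_upwards [ae_integrable_double hfm hw.measurable (c := fun _ : Mat m m => (1 : ℂ))
    measurable_const hfin hD] with x hx
  have h1 := hx.1.prod_right_ae
  rw [ae_dirac_eq] at h1
  simpa using h1

/-- The truncated integral of a function which agrees almost everywhere with the plane average. -/
theorem ae_truncated_eq {D : Mat n m → ℂ} (hfm : Measurable f₀) (hw : IsSchwartz w)
    (hH : ∫⁻ x : Mat n m, ENNReal.ofReal (wt N x) *
      ∫⁻ z, ‖f₀ (x + z)‖ₑ ∂(meanPlaneMeasure n m k) < ⊤)
    (hD : D =ᵐ[volume] planeConv k f₀) {ε : ℝ} (hε : 0 < ε) (ρ : ℝ) :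
    ∀ᵐ x : Mat n m,
      IntegrableOn (fun a => wavelet w a D x * ((a.det ^ (-(k : ℝ) / 2) : ℝ) : ℂ))
        (loewnerIoo (ε • (1 : Mat m m)) (ρ • 1)) (coneInvMeasure m) ∧
      truncated k w D ε ρ x = tripleTrunc k w f₀ ε ρ x := by
  have hinner : ∀ (x : Mat n m) (a : Mat m m),
      ∫ y, D (x - y * CFC.sqrt a) * (w y * ((a.det ^ (-(k : ℝ) / 2) : ℝ) : ℂ)) =
        wavelet w a D x * ((a.det ^ (-(k : ℝ) / 2) : ℝ) : ℂ) := fun x a => by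
    rw [wavelet, ← integral_mul_const]
    simp only [mul_assoc]
  filter_upwards [ae_integrable_double hfm hw.measurable (measurable_det_rpow_ofReal _)
    (lintegral_wt_trunc_lt_top hfm hw hH hε ρ) hD] with x hx
  refine ⟨hx.1.integral_prod_left.congr (Eventually.of_forall fun a => hinner x a), ?_⟩
  refine Eq.trans ?_ hx.2
  refine Eq.trans ?_ (integral_prod _ hx.1).symm
  exact integral_congr_ae (Eventually.of_forall fun a => (hinner x a).symm)

end

end

end MatrixRadon

/-! ### The inversion theorem -/

theorem mainTheorem3 (n m k : ℕ) (hm : 1 ≤ m) (hk : 1 ≤ k) (hkn : k + m ≤ n)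
    (p : ℝ) (hp1 : 1 ≤ p) (hp : p < (n : ℝ) / ((k : ℝ) + m - 1))
    (f : Matrix (Fin n) (Fin m) ℝ → ℂ)
    (hf2 : MemLp f 2 volume) (hfp : MemLp f (ENNReal.ofReal p) volume)
    (w : Matrix (Fin n) (Fin m) ℝ → ℂ) (hw : IsRieszWavelet k w) :
    -- the integrals defining the Radon transform and its dual converge absolutely a.e.
    (∀ᵐ q : Stiefel n (n - k) × Matrix (Fin (n - k)) (Fin m) ℝ
        ∂((stiefelMeasure n k).prod volume),
      Integrable (fun ω : Matrix (Fin k) (Fin m) ℝ => f (rotationTo q.1 * stack ω q.2))) ∧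
    (∀ᵐ x : Matrix (Fin n) (Fin m) ℝ,
      Integrable (fun ξ : Stiefel n (n - k) => radon f ξ (ξ.1ᵀ * x)) (stiefelMeasure n k)) ∧
    -- the wavelet transforms and the truncated integrals converge absolutely a.e.
    (∀ a : Matrix (Fin m) (Fin m) ℝ, a.PosDef → ∀ᵐ x : Matrix (Fin n) (Fin m) ℝ,
      Integrable (fun y => dualRadon (radon (k := k) f) (x - y * CFC.sqrt a) * w y)) ∧
    (∀ ε ρ : ℝ, 0 < ε → ε < ρ →
      (∀ᵐ x : Matrix (Fin n) (Fin m) ℝ,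
        IntegrableOn
          (fun a => wavelet w a (dualRadon (radon (k := k) f)) x *
            ((a.det ^ (-(k : ℝ) / 2) : ℝ) : ℂ))
          (loewnerIoo (ε • (1 : Matrix (Fin m) (Fin m) ℝ)) (ρ • 1)) (coneInvMeasure m)) ∧
      MemLp (truncated k w (dualRadon (radon (k := k) f)) ε ρ) 2 volume) ∧
    -- the integral defining `d_w(k)` converges absolutely
    Integrable (dwIntegrand k w) ∧
    -- the inversion formula, with the limit taken in `L²`
    Tendsto
      (fun q : ℝ × ℝ => eLpNorm
        (fun x => ((cConst n k m)⁻¹ : ℂ) *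
            truncated k w (dualRadon (radon (k := k) f)) q.1 q.2 x - dw k w * f x) 2 volume)
      (𝓝[>] 0 ×ˢ atTop) (𝓝 0) := by
  have hmn : m ≤ n := by omega
  have hkn' : k ≤ n := by omega
  -- Single planes are null sets of the matrix space, so `f` and a measurable representative may
  -- have different integrals on some planes. The change is tracked through a measurable null set
  -- `S` containing all points where they differ.
  set f₀ := hfp.1.mk f with hf₀
  have hfm : Measurable f₀ := hfp.1.stronglyMeasurable_mk.measurable
  have hff : f =ᵐ[volume] f₀ := hfp.1.ae_eq_mk
  clear_value f₀
  have hp₀ : MemLp f₀ (ENNReal.ofReal p) volume := hfp.ae_eq hff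
  have h2₀ : MemLp f₀ 2 volume := hf2.ae_eq hff
  have hH := lintegral_wt_conv_lt_top hm hk hkn hp1 hp hfm hp₀ (N := m * n + 1) (by omega)
    (by nlinarith [Nat.mul_le_mul_left m hkn'])
  set S := toMeasurable volume {x | f x ≠ f₀ x} with hSdef
  have hS : MeasurableSet S := measurableSet_toMeasurable _ _
  have hS0 : volume S = 0 := (measure_toMeasurable _).trans hff
  have hfS : ∀ x ∉ S, f x = f₀ x := fun x hx => by
    by_contra h
    exact hx (subset_toMeasurable _ _ h)
  have hdual := ae_dualRadon_radon hk hkn' hfm hH hS hS0 hfS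
  set D := dualRadon (radon (k := k) f) with hDdef
  have hD : D =ᵐ[volume] planeConv k f₀ := hdual.mono fun x hx => hx.2
  clear_value D
  obtain ⟨B, hB, hT⟩ := exists_tripleTrunc_multiplier hw hm hkn hfm h2₀ hH
  have htr : ∀ ε : ℝ, 0 < ε → ∀ ρ : ℝ,
      truncated k w D ε ρ =ᵐ[volume] tripleTrunc k w f₀ ε ρ := fun ε hε ρ =>
    (ae_truncated_eq hfm hw.schwartz hH hD hε ρ).mono fun x hx => hx.2
  refine ⟨radon_integrable_ae hm hk hkn hp1 hp hfm hp₀ hS hS0 hfS, hdual.mono fun x hx => hx.1,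
    fun a ha => ae_integrable_wavelet hfm hw.schwartz hH hD ha.posSemidef, fun ε ρ hε _ =>
    ⟨(ae_truncated_eq hfm hw.schwartz hH hD hε ρ).mono fun x hx => hx.1,
      (hT ε hε ρ).1.ae_eq (htr ε hε ρ).symm⟩, hw.integrable_dwIntegrand hm hmn, ?_⟩
  -- The Gram matrix of almost every frequency is positive definite, and at those frequencies the
  -- truncated symbols converge to `d_w(k)`.
  have hlim := (measurePreserving_flatEquiv n m).symm (flatEquiv n m)
    |>.quasiMeasurePreserving.ae ((ae_gram_posDef hmn).mono fun ξ hξ =>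
      tendsto_truncSymbol hw hm hmn hξ)
  refine (tendsto_eLpNorm_multiplier (M := fun q : ℝ × ℝ => fun ξ =>
    truncSymbol k w q.1 q.2 ((flatEquiv n m).symm ξ)) hB
    (fun q => (measurable_truncSymbol hw.schwartz q.1 q.2).comp (flatEquiv n m).symm.measurable)
    (fun q ξ => norm_truncSymbol_le hw hm hmn q.1 q.2 _) hlim).congr' ?_
  have hev : ∀ᶠ q : ℝ × ℝ in 𝓝[>] 0 ×ˢ atTop, 0 < q.1 :=
    tendsto_fst.eventually (eventually_mem_nhdsWithin)
  filter_upwards [hev] with q hq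
  rw [← (hT q.1 hq q.2).2]
  refine eLpNorm_congr_ae ?_
  filter_upwards [htr q.1 hq q.2, hff] with x hx hfx
  rw [hx, hfx]
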